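/- **Setting.** Let $p$ (pressure), $T_{\rm temp}>0$ (temperature), $\Delta F$ (free energy increment) and $r$ (reaction rate) be real analytic functions of $(v,S,\lambda)$ on an open set of states, with $r=r_v=r_S=0$ where $\lambda=0$ and $r_\lambda<0$; put $\Phi=-r\,\Delta F/T_{\rm temp}$. Let $w=(v,u,0,0,S,\lambda)(x)$, with $v>0$, be a real analytic steady planar solution of the ZND equations on $[0,\infty)$, $$uv'-vu'=0,\quad uu'+v\,p(v,S,\lambda)'=0,\quad uS'=\Phi,\quad u\lambda'=r ,$$ such that, with $c_0^2=-v^2p_v$, $\kappa=u/c_0$, $\eta=1-\kappa^2$, $m=u/v$, there are constants with $0<C_1\le\kappa\le C_2<1$ and $0<C_1\le u\le C_2<1$ on $[0,\infty)$, and $|w(x)-w(\infty)|\le Ce^{-\beta x}$ for some $\beta>0$, where $w(\infty)$ is an equilibrium state ($\lambda=0$) in the domain of the thermodynamic functions. Define $$A_x=\begin{pmatrix}u&-v&0&0&0\\vp_v&u&0&vp_S&vp_\lambda\\0&0&u&0&0\\0&0&0&u&0\\0&0&0&0&u\end{pmatrix},\quad A_y=\begin{pmatrix}0&0&-v&0&0\\0&0&0&0&0\\vp_v&0&0&vp_S&vp_\lambda\\0&0&0&0&0\\0&0&0&0&0\end{pmatrix},$$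 $$B=\begin{pmatrix}-u'&v'&0&0&0\\p'-v(c_0^2/v^2)'&u'&0&vp_S'&vp_\lambda'\\0&0&0&0&0\\-\Phi_v&S'&0&-\Phi_S&-\Phi_\lambda\\-r_v&\lambda'&0&-r_S&-r_\lambda\end{pmatrix},$$ $$\Phi_0(x,\zeta)=\{A_x^{-1}(\zeta I+iA_y)\}^t,\qquad \Phi_1(x,\nu)=\{A_x^{-1}\nu\}^t+\{A_x^{-1}B\}^t .$$ Let $s(x,\zeta)=\sqrt{\zeta^2+c_0^2\eta}$ be the branch analytic in $\zeta$ off the cut $[-ic_0\sqrt\eta,ic_0\sqrt\eta]$ with $s\sim\zeta$ at infinity, and $s\ge0$ on the cut. The eigenvalues of $\Phi_0(x,\zeta)$ are $$\mu_1=-\frac{\kappa(\kappa\zeta+s)}{\eta u},\quad \mu_2=-\frac{\kappa(\kappa\zeta-s)}{\eta u},\quad \mu_3=\mu_4=\mu_5=\frac{\zeta}{u},$$ and $\mu_1$ has the eigenvector $Te_1=T(x,\zeta)e_1=\left(\frac{ms}{\kappa u},\frac{\zeta}{u},-i,-\frac{\kappa p_Ss}{um},-\frac{\kappa p_\lambda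 s}{um}\right)^t$. **Theorem.** Let $a\ge0$, $R>0$, $\Re\zeta\ge0$ and $C_\zeta>0$. There are constants $K$ and $C(\delta_*)$, for $\delta_*<\beta$, which may depend on the profile, $a$, $R$, $\zeta$, $C_\zeta$ (and $\delta_*$) but not on $\nu$, $h$, $x$, with the following property. Let $\nu$ satisfy $\Re\nu\ge0$, $|\nu|\le R$, and suppose that for all sufficiently small $h>0$ $$|\mu_1(x,\zeta+h\nu)-\mu_j(x,\zeta+h\nu)|\ge C_\zeta\quad\text{for all }x\ge a,\ j=2,\dots,5 .$$ Then there is $h_0>0$ such that for every $0<h\le h_0$ there exist an exact solution $\theta$ of $$\theta'=\frac1h\left[\Phi_0(x,\zeta)+h\Phi_1(x,\nu)\right]\theta\quad\text{on }[a,\infty),$$ a continuous function $\mu_1^\sharp$ on $[0,\infty)$ with $$|\mu_1^\sharp(x)-\mu_1(x,\zeta+h\nu)|\le K h e^{-\beta x}\quad (x\ge0),$$ and a function $\rho$ with $|\rho(x)|\le Kh$ on $[a,\infty)$ for which $T(x,\zeta)e_1+\rho(x)$ is an eigenvector of $\Phi_0(x,\zeta)+h\Phi_1(x,\nu)$ for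 each $x\ge a$ or zero, such that for every $\delta_*<\beta$ and every $x\ge a$ $$\left|\theta(x)-e^{\frac1h\int_0^x\mu_1^\sharp(t)\,dt}\left[T(x,\zeta)e_1+\rho(x)\right]\right|\le C(\delta_*)\,h\,e^{-\delta_*x}\left|e^{\frac1h\int_0^x\mu_1^\sharp(t)\,dt}\right| .$$ (For small $h$ the vector $Te_1+\rho$ is nonzero, since the third entry of $Te_1$ is $-i$.) -/

import Mathlib

open Complex Matrix Set

noncomputable section

namespace ZND

/-- Partial derivative in `v` of a function of the thermodynamic state `(v, S, lam)`. -/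
def pdv (f : ℝ × ℝ × ℝ → ℝ) (z : ℝ × ℝ × ℝ) : ℝ :=
  deriv (fun t => f (t, z.2.1, z.2.2)) z.1

/-- Partial derivative in the entropy `S`. -/
def pdS (f : ℝ × ℝ × ℝ → ℝ) (z : ℝ × ℝ × ℝ) : ℝ :=
  deriv (fun t => f (z.1, t, z.2.2)) z.2.1

/-- Partial derivative in the mass fraction `lam`. -/
def pdlam (f : ℝ × ℝ × ℝ → ℝ) (z : ℝ × ℝ × ℝ) : ℝ :=
  deriv (fun t => f (z.1, z.2.1, t)) z.2.2

/-- The thermodynamic data of the ZND model: pressure, temperature, free energy increment and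
reaction rate, real analytic functions of `(v, S, lam)` (specific volume, entropy, mass fraction of
reactant) on an open set of states. -/
structure Thermo where
  dom : Set (ℝ × ℝ × ℝ)
  p : ℝ × ℝ × ℝ → ℝ
  temp : ℝ × ℝ × ℝ → ℝ
  dF : ℝ × ℝ × ℝ → ℝ
  r : ℝ × ℝ × ℝ → ℝ
  isOpen_dom : IsOpen dom
  analytic_p : AnalyticOnNhd ℝ p dom
  analytic_temp : AnalyticOnNhd ℝ temp dom
  analytic_dF : AnalyticOnNhd ℝ dF dom
  analytic_r : AnalyticOnNhd ℝ r dom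
  temp_pos : ∀ z ∈ dom, 0 < temp z

/-- The source term `-r ΔF / T` of the entropy equation. -/
def Thermo.entropySource (th : Thermo) (z : ℝ × ℝ × ℝ) : ℝ :=
  -(th.r z * th.dF z) / th.temp z

/-- The assumptions on the reaction rate: `r = r_v = r_S = 0` where `lam = 0`, and `r_lam < 0`. -/
structure Thermo.RateAssumption (th : Thermo) : Prop where
  r_eq : ∀ z ∈ th.dom, z.2.2 = 0 → th.r z = 0
  rlam_neg : ∀ z ∈ th.dom, pdlam th.r z < 0
  rv_eq : ∀ z ∈ th.dom, z.2.2 = 0 → pdv th.r z = 0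
  rS_eq : ∀ z ∈ th.dom, z.2.2 = 0 → pdS th.r z = 0

/-- The components of a planar state `(v, u, 0, 0, S, lam)(x)`. Only `x ≥ 0` is used. -/
structure Profile where
  v : ℝ → ℝ
  u : ℝ → ℝ
  S : ℝ → ℝ
  lam : ℝ → ℝ

namespace Profile

/-- The thermodynamic state at `x`. -/
def state (w : Profile) (x : ℝ) : ℝ × ℝ × ℝ := (w.v x, w.S x, w.lam x)

/-- Square of the sound speed, `c₀² = -v² p_v(v, S, lam)`, along the profile. -/
def c0sq (w : Profile) (th : Thermo) (x : ℝ) : ℝ := -(w.v x) ^ 2 * pdv th.p (w.state x)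

/-- The sound speed along the profile. -/
def c0 (w : Profile) (th : Thermo) (x : ℝ) : ℝ := Real.sqrt (w.c0sq th x)

/-- The Mach number `κ = u / c₀`. -/
def kappa (w : Profile) (th : Thermo) (x : ℝ) : ℝ := w.u x / w.c0 th x

/-- `η = 1 - κ²`. -/
def eta (w : Profile) (th : Thermo) (x : ℝ) : ℝ := 1 - (w.kappa th x) ^ 2

/-- The mass flux `m = u / v` (constant in `x` along a steady profile). -/
def mflux (w : Profile) (x : ℝ) : ℝ := w.u x / w.v x

/-- `w` is a steady planar solution of the ZND equations, analytic and uniformly subsonic on the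
reaction zone `[0, ∞)`, which converges at the exponential rate `β` to an equilibrium
state `(vInf, uInf, 0, 0, SInf, 0)`. -/
structure IsReactionZone (w : Profile) (th : Thermo) (β : ℝ) : Prop where
  analytic_v : AnalyticOnNhd ℝ w.v (Ici 0)
  analytic_u : AnalyticOnNhd ℝ w.u (Ici 0)
  analytic_S : AnalyticOnNhd ℝ w.S (Ici 0)
  analytic_lam : AnalyticOnNhd ℝ w.lam (Ici 0)
  state_mem : ∀ x, 0 ≤ x → w.state x ∈ th.dom
  v_pos : ∀ x, 0 ≤ x → 0 < w.v x
  mass : ∀ x, 0 ≤ x → w.u x * deriv w.v x - w.v x * deriv w.u x = 0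
  momentum : ∀ x, 0 ≤ x →
    w.u x * deriv w.u x + w.v x * deriv (fun y => th.p (w.state y)) x = 0
  entropy : ∀ x, 0 ≤ x → w.u x * deriv w.S x = th.entropySource (w.state x)
  reaction : ∀ x, 0 ≤ x → w.u x * deriv w.lam x = th.r (w.state x)
  bounds : ∃ C₁ C₂ : ℝ, 0 < C₁ ∧ C₂ < 1 ∧ ∀ x, 0 ≤ x →
    (C₁ ≤ w.kappa th x ∧ w.kappa th x ≤ C₂) ∧ (C₁ ≤ w.u x ∧ w.u x ≤ C₂)
  beta_pos : 0 < β
  decay : ∃ C vInf uInf SInf : ℝ, (vInf, SInf, 0) ∈ th.dom ∧ ∀ x, 0 ≤ x →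
    |w.v x - vInf| ≤ C * Real.exp (-β * x) ∧ |w.u x - uInf| ≤ C * Real.exp (-β * x) ∧
    |w.S x - SInf| ≤ C * Real.exp (-β * x) ∧ |w.lam x| ≤ C * Real.exp (-β * x)

/-! The coefficient matrices of the reduced linearized system for `(v, u, U, S, lam)`. -/

def Ax (w : Profile) (th : Thermo) (x : ℝ) : Matrix (Fin 5) (Fin 5) ℝ :=
  let v := w.v x
  let u := w.u x
  let z := w.state x
  !![u, -v, 0, 0, 0;
     v * pdv th.p z, u, 0, v * pdS th.p z, v * pdlam th.p z;
     0, 0, u, 0, 0;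
     0, 0, 0, u, 0;
     0, 0, 0, 0, u]

def Ay (w : Profile) (th : Thermo) (x : ℝ) : Matrix (Fin 5) (Fin 5) ℝ :=
  let v := w.v x
  let z := w.state x
  !![0, 0, -v, 0, 0;
     0, 0, 0, 0, 0;
     v * pdv th.p z, 0, 0, v * pdS th.p z, v * pdlam th.p z;
     0, 0, 0, 0, 0;
     0, 0, 0, 0, 0]

/-- The derivatives `p'`, `(c₀²/v²)'`, `p_S'`, `p_lam'` are derivatives in `x` along the profile. -/
def B (w : Profile) (th : Thermo) (x : ℝ) : Matrix (Fin 5) (Fin 5) ℝ :=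
  let v := w.v x
  let z := w.state x
  let v' := deriv w.v x
  let u' := deriv w.u x
  let S' := deriv w.S x
  let lam' := deriv w.lam x
  let p' := deriv (fun y => th.p (w.state y)) x
  let q' := deriv (fun y => w.c0sq th y / (w.v y) ^ 2) x
  let pS' := deriv (fun y => pdS th.p (w.state y)) x
  let plam' := deriv (fun y => pdlam th.p (w.state y)) x
  !![-u', v', 0, 0, 0;
     p' - v * q', u', 0, v * pS', v * plam';
     0, 0, 0, 0, 0;
     -pdv th.entropySource z, S', 0, -pdS th.entropySource z, -pdlam th.entropySource z;
     -pdv th.r z, lam', 0, -pdS th.r z, -pdlam th.r z]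

/-- `Φ₀(x, ζ) = {A_x⁻¹ (ζ I + i A_y)}ᵗ`. -/
def Phi0 (w : Profile) (th : Thermo) (x : ℝ) (ζ : ℂ) : Matrix (Fin 5) (Fin 5) ℂ :=
  (((w.Ax th x).map ((↑) : ℝ → ℂ))⁻¹ *
    (ζ • (1 : Matrix (Fin 5) (Fin 5) ℂ) + I • (w.Ay th x).map ((↑) : ℝ → ℂ)))ᵀ

/-- `Φ₁(x, ν) = {A_x⁻¹ ν I}ᵗ + {A_x⁻¹ B}ᵗ`. -/
def Phi1 (w : Profile) (th : Thermo) (x : ℝ) (ν : ℂ) : Matrix (Fin 5) (Fin 5) ℂ :=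
  (((w.Ax th x).map ((↑) : ℝ → ℂ))⁻¹ * (ν • (1 : Matrix (Fin 5) (Fin 5) ℂ)))ᵀ +
    (((w.Ax th x).map ((↑) : ℝ → ℂ))⁻¹ * (w.B th x).map ((↑) : ℝ → ℂ))ᵀ

end Profile

/-- The branch of `√(ζ² + b²)`, `b ≥ 0`, which is analytic in `ζ` off the cut `[-ib, ib]` and
asymptotic to `ζ` at infinity; on the cut it takes the nonnegative value, which is its
limit from `Re ζ > 0`. (The power `1/2` is the principal root: `1 + b²/ζ²` is a negative real or
zero only for `ζ` on the cut.) -/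
def branchSqrt (b : ℝ) (ζ : ℂ) : ℂ :=
  open Classical in
  if ζ.re = 0 ∧ |ζ.im| ≤ b then ((Real.sqrt (b ^ 2 - ζ.im ^ 2) : ℝ) : ℂ)
  else ζ * (1 + (b : ℂ) ^ 2 / ζ ^ 2) ^ (1 / 2 : ℂ)

namespace Profile

/-- `s(x, ζ) = √(ζ² + c₀² η)`. -/
def s (w : Profile) (th : Thermo) (x : ℝ) (ζ : ℂ) : ℂ :=
  branchSqrt (w.c0 th x * Real.sqrt (w.eta th x)) ζ

/-- The eigenvalues `μ₁, …, μ₅` (indexed by `0, …, 4`) of `Φ₀(x, ζ)`. -/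
def mu (w : Profile) (th : Thermo) (x : ℝ) (ζ : ℂ) : Fin 5 → ℂ :=
  let κ : ℂ := (w.kappa th x : ℝ)
  let η : ℂ := (w.eta th x : ℝ)
  let u : ℂ := (w.u x : ℝ)
  let s := w.s th x ζ
  ![-κ * (κ * ζ + s) / (η * u), -κ * (κ * ζ - s) / (η * u), ζ / u, ζ / u, ζ / u]

/-- The matrix `T(x, ζ)` whose columns are eigenvectors of `Φ₀(x, ζ)`. -/
def Tmat (w : Profile) (th : Thermo) (x : ℝ) (ζ : ℂ) : Matrix (Fin 5) (Fin 5) ℂ :=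
  let κ : ℂ := (w.kappa th x : ℝ)
  let η : ℂ := (w.eta th x : ℝ)
  let u : ℂ := (w.u x : ℝ)
  let m : ℂ := (w.mflux x : ℝ)
  let pS : ℂ := (pdS th.p (w.state x) : ℝ)
  let pl : ℂ := (pdlam th.p (w.state x) : ℝ)
  let s := w.s th x ζ
  !![m * s / (κ * u), -(m * s / (κ * u)), -(I * m / (1 - η)), 0, 0;
     ζ / u, ζ / u, I, 0, 0;
     -I, -I, ζ / u, 0, 0;
     -κ * pS * s / (u * m), κ * pS * s / (u * m), 0, 1, 0;
     -κ * pl * s / (u * m), κ * pl * s / (u * m), 0, 0, 1]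

/-- `|μ₁(x, ζ + hν) - μ_j(x, ζ + hν)| ≥ c` for `j = 2, …, 5`, `x ≥ a` and all small `h > 0`. -/
def Separated (w : Profile) (th : Thermo) (a c : ℝ) (ζ ν : ℂ) : Prop :=
  ∃ h₁ : ℝ, 0 < h₁ ∧ ∀ h : ℝ, 0 < h → h ≤ h₁ → ∀ x : ℝ, a ≤ x → ∀ j : Fin 5, j ≠ 0 →
    c ≤ ‖w.mu th x (ζ + h * ν) 0 - w.mu th x (ζ + h * ν) j‖

end Profile

end ZND

end

/-!
For small `h` the solution is constructed in a moving frame in which the system is a small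
perturbation of an explicit model, and is then found as the solution that decays at infinity.

**The frame.** Write `z = ζ + hν`. The separation hypothesis keeps `s(x, z)`, which is proportional to
`μ₂ - μ₁`, and `z / u - μ₁` away from zero. Where `μ₂` and `μ₃` may collide, `Φ₀` need not be
diagonalizable with bounded matrices, so the frame `P(x)` (`Profile.frameP`) only makes it
triangular: its first column is `T e₁`, its last three columns span the eigenspace of `z / u`, and one
coupling coefficient `γ` (`frameGamma`) between `μ₂` and `z / u` remains. Of `h Φ₁`, the part with `ν`
turns `ζ` into `z`, and the part with `B` is `O(h e^{-βx})`, except for what the derivatives of the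
two source terms in `λ` contribute at equilibrium
(`Profile.Bres`). In the frame this part occupies the last row only, its diagonal entry
`-r_λ / u` is positive, and the scaling `E` of the last column of the frame makes it
dominate the rest of the row. Hence (`coeff_mul_frameP`)
`(Φ₀ + h Φ₁) P = P (μ₁ + M) + O(h e^{-βx})`, where `M` is a `modelMatrix` whose diagonal has
nonnegative real part, and dominates the rest of each row provided that `|γ| ≤ Re (z / u - μ₁) / 2`.

**The coupling** (`SepFamily.exists_coupling_le`). If `Re ζ > 0`, then `Re (z / u - μ₁) ≥ Re ζ`, and
`γ` is made small by scaling a column. If `Re ζ = 0`, then for small `h` the point `z` is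
far from `± u`, the only places where `μ₂ = μ₃` or `μ₁ = μ₃`, and the coupling can be removed.

**The solution.** Let `n = O(e^{-βx})` be the `(0, 0)` entry of the first order terms in the frame,
that of `-P⁻¹ P'` included. With `μ₁♯ = μ₁ + h n` and `θ = exp (h⁻¹ ∫ μ₁♯) P y` the system for `y` has
the leading matrix `h⁻¹ M`, and a bounded, exponentially decaying remainder whose `(0, 0)` entry
vanishes. As the diagonal pushes outward, all components can be integrated from infinity, and
a weighted contraction (`exists_decaying_solution`) gives a solution within `O(h e^{-βx})` of the null
vector `modelVec` of `M` (`ModelFamily.exists_solution`). No smallness of the remainder is needed,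
because the weight `decayWeight` absorbs it, and no stronger bound on the real parts is needed,
because the diagonal controls what it dominates. The exact eigenvector of the perturbed matrix is
also within `O(h e^{-βx})` of `modelVec` (`ModelFamily.exists_eigenvector`), by a contraction for a
simple eigenvalue. Comparing the two gives the error estimate, even with `e^{-βx}` in place of
`e^{-δx}`.

**Uniformity.** All estimates are made for families of functions indexed by the pairs `(h, ν)` for
which the separation holds. Boundedness with exponentially decaying derivatives (`Tame`)
is stable under algebraic operations. It holds for analytic functions of the state along the profile,
because the profile equations express `v'`, `S'`, `λ'` by functions of the state that vanish
at equilibrium.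
-/

namespace ZND

open Filter Topology MeasureTheory BoundedContinuousFunction

/-! ### The branch of the square root -/

theorem branchSqrt_sq {b : ℝ} {ζ : ℂ} (hb : 0 < b) : branchSqrt b ζ ^ 2 = ζ ^ 2 + b ^ 2 := by
  unfold branchSqrt
  split_ifs with h
  · have h2 : ζ.im ^ 2 ≤ b ^ 2 := sq_le_sq.2 (by rw [abs_of_pos hb]; exact h.2)
    have hz : ζ = ζ.im * I := by
      apply Complex.ext <;> simp [h.1]
    rw [← ofReal_pow, Real.sq_sqrt (by linarith)]
    conv_rhs => rw [hz]
    rw [mul_pow, I_sq]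
    push_cast
    ring
  · have hz : ζ ≠ 0 := by
      rintro rfl
      exact h ⟨rfl, by simpa using hb.le⟩
    rw [mul_pow, ← cpow_nat_mul]
    norm_num
    field_simp

theorem re_cpow_half_nonneg (z : ℂ) : 0 ≤ (z ^ (1 / 2 : ℂ)).re := by
  by_cases hz : z = 0
  · simp [hz]
  rw [cpow_def_of_ne_zero hz, exp_re]
  refine mul_nonneg (Real.exp_pos _).le (Real.cos_nonneg_of_mem_Icc ?_)
  have h1 := neg_pi_lt_arg z
  have h2 := arg_le_pi z
  have h3 : (log z * (1 / 2)).im = arg z / 2 := by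
    rw [show (1 / 2 : ℂ) = ((1 / 2 : ℝ) : ℂ) by norm_num, im_mul_ofReal, log_im]
    ring
  rw [h3]
  constructor <;> linarith

/-- The branch maps the closed right half plane to itself. -/
theorem re_branchSqrt_nonneg {b : ℝ} {ζ : ℂ} (hb : 0 < b) (hζ : 0 ≤ ζ.re) :
    0 ≤ (branchSqrt b ζ).re := by
  have hsq := branchSqrt_sq (ζ := ζ) hb
  by_cases h : ζ.re = 0 ∧ |ζ.im| ≤ b
  · unfold branchSqrt
    rw [if_pos h, ofReal_re]
    exact Real.sqrt_nonneg _
  have hz : ζ ≠ 0 := by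
    rintro rfl
    exact h ⟨rfl, by simpa using hb.le⟩
  have hs : branchSqrt b ζ = ζ * (1 + (b : ℂ) ^ 2 / ζ ^ 2) ^ (1 / 2 : ℂ) := by
    unfold branchSqrt
    rw [if_neg h]
  set q := (1 + (b : ℂ) ^ 2 / ζ ^ 2) ^ (1 / 2 : ℂ) with hq
  have hqre : 0 ≤ q.re := re_cpow_half_nonneg _
  rcases hζ.eq_or_lt with h0 | h0
  · have him : b < |ζ.im| := by
      by_contra h1
      exact h ⟨h0.symm, not_lt.1 h1⟩
    have him0 : ζ.im ≠ 0 := by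
      intro h1
      rw [h1, abs_zero] at him
      linarith
    have hzi : ζ = ζ.im * I := by
      apply Complex.ext <;> simp [← h0]
    have hlt : b ^ 2 < ζ.im ^ 2 := sq_lt_sq.2 (by rwa [abs_of_pos hb])
    have hreal : (1 + (b : ℂ) ^ 2 / ζ ^ 2) = ((1 - b ^ 2 / ζ.im ^ 2 : ℝ) : ℂ) := by
      conv_lhs => rw [hzi]
      rw [mul_pow, I_sq]
      push_cast
      ring
    have hnn : 0 ≤ 1 - b ^ 2 / ζ.im ^ 2 := by
      rw [sub_nonneg, div_le_one (by positivity)]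
      exact hlt.le
    have hqr : q = (((1 - b ^ 2 / ζ.im ^ 2) ^ (1 / 2 : ℝ) : ℝ) : ℂ) := by
      rw [hq, hreal, ofReal_cpow hnn]
      norm_num
    rw [hs, hqr, mul_comm, re_ofReal_mul, ← h0, mul_zero]
  · -- `Re s Im s = Re ζ Im ζ`, and `Re (s / ζ) ≥ 0`: both fail if `Re s < 0`
    have h1 : (branchSqrt b ζ).re * (branchSqrt b ζ).im = ζ.re * ζ.im := by
      have := congrArg Complex.im hsq
      rw [← ofReal_pow, add_im, ofReal_im, pow_two, pow_two, mul_im, mul_im] at this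
      linarith
    have h2 : (branchSqrt b ζ).re * ζ.re + (branchSqrt b ζ).im * ζ.im
        = q.re * (ζ.re ^ 2 + ζ.im ^ 2) := by
      rw [hs, mul_re, mul_im]
      ring
    have h3 : 0 ≤ (branchSqrt b ζ).re * ζ.re + (branchSqrt b ζ).im * ζ.im := by
      rw [h2]; positivity
    by_contra hneg
    push Not at hneg
    have h4 : (branchSqrt b ζ).re * ((branchSqrt b ζ).im * ζ.im) = ζ.re * ζ.im ^ 2 := by
      rw [← mul_assoc, h1]; ring
    have h5 : 0 ≤ (branchSqrt b ζ).re * ((branchSqrt b ζ).im * ζ.im) := by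
      rw [h4]; positivity
    have h6 : (branchSqrt b ζ).im * ζ.im ≤ 0 := by
      by_contra h7
      push Not at h7
      nlinarith
    nlinarith

/-- The branch preserves the sign of the imaginary part. -/
theorem im_branchSqrt_mul_im_nonneg {b : ℝ} {ζ : ℂ} (hb : 0 < b) (hζ : 0 ≤ ζ.re) :
    0 ≤ (branchSqrt b ζ).im * ζ.im := by
  have hsq := branchSqrt_sq (ζ := ζ) hb
  have hre := re_branchSqrt_nonneg hb hζ
  rcases hζ.eq_or_lt with h0 | h0
  · by_cases h : ζ.re = 0 ∧ |ζ.im| ≤ b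
    · have : branchSqrt b ζ = ((Real.sqrt (b ^ 2 - ζ.im ^ 2) : ℝ) : ℂ) := by
        unfold branchSqrt
        rw [if_pos h]
      rw [this, ofReal_im, zero_mul]
    · have hz : ζ ≠ 0 := by
        rintro rfl
        exact h ⟨rfl, by simpa using hb.le⟩
      have hs : branchSqrt b ζ = ζ * (1 + (b : ℂ) ^ 2 / ζ ^ 2) ^ (1 / 2 : ℂ) := by
        unfold branchSqrt
        rw [if_neg h]
      rw [hs, mul_im, ← h0, zero_mul, zero_add]
      have := re_cpow_half_nonneg (1 + (b : ℂ) ^ 2 / ζ ^ 2)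
      nlinarith [mul_nonneg this (sq_nonneg ζ.im)]
  · have h1 : (branchSqrt b ζ).re * (branchSqrt b ζ).im = ζ.re * ζ.im := by
      have := congrArg Complex.im hsq
      rw [← ofReal_pow, add_im, ofReal_im, pow_two, pow_two, mul_im, mul_im] at this
      linarith
    have h4 : (branchSqrt b ζ).re * ((branchSqrt b ζ).im * ζ.im) = ζ.re * ζ.im ^ 2 := by
      rw [← mul_assoc, h1]; ring
    by_contra hneg
    push Not at hneg
    have h5 : ζ.re * ζ.im ^ 2 ≤ 0 := by
      rw [← h4]
      exact mul_nonpos_of_nonneg_of_nonpos hre hneg.le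
    have h6 : ζ.im ≠ 0 := by
      rintro h7
      rw [h7, mul_zero] at hneg
      exact lt_irrefl _ hneg
    have : 0 < ζ.re * ζ.im ^ 2 := by positivity
    linarith

/-- On the closed right half plane the branch is Hölder continuous in the squared parameter. -/
theorem norm_branchSqrt_sub_sq_le {b b' : ℝ} {ζ : ℂ} (hb : 0 < b) (hb' : 0 < b')
    (hζ : 0 ≤ ζ.re) : ‖branchSqrt b ζ - branchSqrt b' ζ‖ ^ 2 ≤ |b ^ 2 - b' ^ 2| := by
  have h1 := re_branchSqrt_nonneg hb hζ
  have h2 := re_branchSqrt_nonneg hb' hζ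
  have h3 := im_branchSqrt_mul_im_nonneg hb hζ
  have h4 := im_branchSqrt_mul_im_nonneg hb' hζ
  have e1 := branchSqrt_sq (ζ := ζ) hb
  have e2 := branchSqrt_sq (ζ := ζ) hb'
  set s := branchSqrt b ζ
  set t := branchSqrt b' ζ
  have hprod : (s - t) * (s + t) = ((b ^ 2 - b' ^ 2 : ℝ) : ℂ) := by
    push_cast
    linear_combination e1 - e2
  have himst : 0 ≤ s.im * t.im := by
    by_cases h0 : ζ.im = 0
    · -- a square root of a positive number is real
      have hs0 : s.im = 0 := by
        have hi := congrArg Complex.im e1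
        have hr := congrArg Complex.re e1
        rw [← ofReal_pow, pow_two, pow_two, add_im, mul_im, mul_im, ofReal_im, h0] at hi
        rw [← ofReal_pow, pow_two, pow_two, add_re, mul_re, mul_re, ofReal_re, h0] at hr
        have hsre : s.re ≠ 0 := by
          intro h5
          rw [h5] at hr
          nlinarith [sq_nonneg s.im, sq_nonneg ζ.re, pow_pos hb 2]
        have : s.re * s.im = 0 := by linarith
        exact (mul_eq_zero.1 this).resolve_left hsre
      rw [hs0, zero_mul]
    · have h5 : 0 ≤ (s.im * t.im) * ζ.im ^ 2 := by
        have := mul_nonneg h3 h4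
        nlinarith
      have h6 : 0 < ζ.im ^ 2 := by positivity
      exact nonneg_of_mul_nonneg_left h5 h6
  have hle : ‖s - t‖ ≤ ‖s + t‖ := by
    rw [← sq_le_sq₀ (norm_nonneg _) (norm_nonneg _), ← normSq_eq_norm_sq, ← normSq_eq_norm_sq,
      normSq_apply, normSq_apply, sub_re, sub_im, add_re, add_im]
    nlinarith [mul_nonneg h1 h2]
  calc ‖s - t‖ ^ 2 = ‖s - t‖ * ‖s - t‖ := sq _
    _ ≤ ‖s - t‖ * ‖s + t‖ := by gcongr
    _ = ‖(s - t) * (s + t)‖ := (norm_mul _ _).symm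
    _ = |b ^ 2 - b' ^ 2| := by rw [hprod, norm_real, Real.norm_eq_abs]

/-- The values of the branch at neighbouring points do not cancel. -/
theorem min_le_norm_branchSqrt_add {b : ℝ} {ζ ζ' : ℂ} (hb : 0 < b) (hζ : 0 ≤ ζ.re)
    (hζ' : 0 ≤ ζ'.re) (hd : ‖ζ - ζ'‖ ≤ b / 2) :
    min ‖branchSqrt b ζ'‖ (b / 2) ≤ ‖branchSqrt b ζ + branchSqrt b ζ'‖ := by
  have h1 := re_branchSqrt_nonneg hb hζ
  have h2 := re_branchSqrt_nonneg hb hζ'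
  have h3 := im_branchSqrt_mul_im_nonneg hb hζ
  have h4 := im_branchSqrt_mul_im_nonneg hb hζ'
  have e1 := branchSqrt_sq (ζ := ζ) hb
  set s := branchSqrt b ζ
  set t := branchSqrt b ζ'
  by_cases hst : 0 ≤ s.im * t.im
  · refine (min_le_left _ _).trans ?_
    rw [← sq_le_sq₀ (norm_nonneg _) (norm_nonneg _), ← normSq_eq_norm_sq, ← normSq_eq_norm_sq,
      normSq_apply, normSq_apply, add_re, add_im]
    nlinarith [mul_nonneg h1 h2, mul_self_nonneg s.re, mul_self_nonneg s.im]
  · -- opposite signs: `ζ` is close to the real axis, so that `Re s` is large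
    push Not at hst
    refine (min_le_right _ _).trans ?_
    have him : ζ.im * ζ'.im ≤ 0 := by
      by_contra h5
      push Not at h5
      have h6 : (s.im * t.im) * (ζ.im * ζ'.im) < 0 := mul_neg_of_neg_of_pos hst h5
      have h7 := mul_nonneg h3 h4
      nlinarith
    have hd' : |ζ.im - ζ'.im| ≤ b / 2 := by
      rw [← sub_im]
      exact (abs_im_le_norm _).trans hd
    have hsqd : (ζ.im - ζ'.im) ^ 2 ≤ (b / 2) ^ 2 :=
      sq_le_sq.2 (by rwa [abs_of_pos (half_pos hb)])
    have hi : ζ.im ^ 2 ≤ (b / 2) ^ 2 := by nlinarith [sq_nonneg ζ'.im]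
    have hr := congrArg Complex.re e1
    rw [← ofReal_pow, pow_two, pow_two, add_re, mul_re, mul_re, ofReal_re] at hr
    have hre : (b / 2) ^ 2 ≤ s.re ^ 2 := by nlinarith [sq_nonneg s.im, sq_nonneg ζ.re]
    have hre' : b / 2 ≤ s.re := (sq_le_sq₀ (half_pos hb).le h1).1 hre
    calc b / 2 ≤ (s + t).re := by rw [add_re]; linarith
      _ ≤ ‖s + t‖ := re_le_norm _

/-! ### Linear systems with dominant diagonal: the solution that decays at infinity -/

/-- The weight `e^{-βt} exp((2k/β) e^{-βt})`: it absorbs coefficients of size `k e^{-βt}`. -/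
noncomputable def decayWeight (β k t : ℝ) : ℝ := Real.exp (-β * t + 2 * k / β * Real.exp (-β * t))

theorem decayWeight_pos (β k t : ℝ) : 0 < decayWeight β k t := Real.exp_pos _

theorem exp_le_decayWeight {β k : ℝ} (hβ : 0 < β) (hk : 0 ≤ k) (t : ℝ) :
    Real.exp (-β * t) ≤ decayWeight β k t := by
  refine Real.exp_le_exp.2 ?_
  have : 0 ≤ 2 * k / β * Real.exp (-β * t) := by positivity
  linarith

theorem decayWeight_le {β k t : ℝ} (hβ : 0 < β) (hk : 0 ≤ k) (ht : 0 ≤ t) :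
    decayWeight β k t ≤ Real.exp (2 * k / β) * Real.exp (-β * t) := by
  rw [← Real.exp_add]
  refine Real.exp_le_exp.2 ?_
  have h1 : Real.exp (-β * t) ≤ 1 := Real.exp_le_one_iff.2 (by nlinarith)
  have : 2 * k / β * Real.exp (-β * t) ≤ 2 * k / β * 1 := by gcongr
  linarith

theorem continuous_decayWeight (β k : ℝ) : Continuous (decayWeight β k) := by
  unfold decayWeight
  fun_prop

theorem hasDerivAt_decayWeight {β k : ℝ} (hβ : 0 < β) (t : ℝ) :
    HasDerivAt (decayWeight β k)
      (-(β + 2 * k * Real.exp (-β * t)) * decayWeight β k t) t := by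
  have h1 : HasDerivAt (fun t : ℝ => -β * t) (-β) t := by
    simpa using (hasDerivAt_id t).const_mul (-β)
  have h2 : HasDerivAt (decayWeight β k) _ t := (h1.fun_add (h1.exp.const_mul (2 * k / β))).exp
  convert h2 using 1
  unfold decayWeight
  field_simp
  ring

theorem tendsto_decayWeight {β k : ℝ} (hβ : 0 < β) :
    Tendsto (decayWeight β k) atTop (𝓝 0) := by
  have h1 : Tendsto (fun t : ℝ => -β * t) atTop atBot :=
    tendsto_id.const_mul_atTop_of_neg (neg_neg_of_pos hβ)
  have h2 : Tendsto (fun t : ℝ => 2 * k / β * Real.exp (-β * t)) atTop (𝓝 (2 * k / β * 0)) :=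
    (Real.tendsto_exp_atBot.comp h1).const_mul _
  exact Real.tendsto_exp_atBot.comp (h1.atBot_add h2)

/-- The solution of the scalar equation `y' = D y + g` that vanishes at infinity, by variation of
constants; it is meaningful when the integral over `[a, ∞)` converges. -/
noncomputable def scalarSol (a : ℝ) (D g : ℝ → ℂ) (x : ℝ) : ℂ :=
  -(exp (∫ t in a..x, D t) * ∫ t in Ioi x, exp (-∫ τ in a..t, D τ) * g t)

section scalar

variable {a β k : ℝ} {D g : ℝ → ℂ}

/-- Where `Re D ≥ 0`, a source which is bounded by half of the diagonal part applied to the weight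
gives a solution bounded by half of the weight: this is what makes the integral equation for
a diagonally dominant system a contraction with factor `1 / 2`. -/
theorem scalarSol_majorant (hβ : 0 < β) (hk : 0 ≤ k) (hD : Continuous D) (hg : Continuous g)
    (hDre : ∀ x, a ≤ x → 0 ≤ (D x).re) {m F : ℝ} (hm : 0 ≤ m) (hF : 0 ≤ F)
    (hbound : ∀ t, a ≤ t → ‖g t‖ ≤ ((D t).re / 2 + k * Real.exp (-β * t)) *
      (decayWeight β k t * m) + F * Real.exp (-β * t)) :
    IntegrableOn (fun t => exp (-∫ τ in a..t, D τ) * g t) (Ioi a) ∧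
      ∀ x, a ≤ x → ‖scalarSol a D g x‖ ≤ (m / 2 + F / β) * decayWeight β k x := by
  set J : ℝ → ℂ := fun x => ∫ t in a..x, D t with hJ
  have hJd : ∀ x, HasDerivAt J (D x) x := fun x =>
    intervalIntegral.integral_hasDerivAt_right (hD.intervalIntegrable _ _)
      (hD.stronglyMeasurableAtFilter _ _) hD.continuousAt
  have hJc : Continuous J := continuous_iff_continuousAt.2 fun x => (hJd x).continuousAt
  have hJre : ∀ x, HasDerivAt (fun x => (J x).re) (D x).re x := fun x =>
    reCLM.hasFDerivAt.comp_hasDerivAt x (hJd x)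
  have hJnn : ∀ x, a ≤ x → 0 ≤ (J x).re := by
    intro x hx
    have : (J x).re = ∫ t in a..x, (D t).re := by
      have h1 := (reCLM : ℂ →L[ℝ] ℝ).intervalIntegral_comp_comm
        (hD.intervalIntegrable (μ := volume) a x)
      exact h1.symm
    rw [this]
    exact intervalIntegral.integral_nonneg hx fun t ht => hDre t ht.1
  -- the majorant `ψ` satisfies `-ψ' = (Re D + β + 2 k e^{-βt}) ψ`
  set ψ : ℝ → ℝ := fun t => Real.exp (-(J t).re) * decayWeight β k t with hψ
  set ψ' : ℝ → ℝ := fun t => -((D t).re + β + 2 * k * Real.exp (-β * t)) * ψ t with hψ'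
  have hψd : ∀ t, HasDerivAt ψ (ψ' t) t := by
    intro t
    have h1 : HasDerivAt ψ _ t :=
      (hJre t).fun_neg.exp.mul (hasDerivAt_decayWeight (k := k) hβ t)
    refine h1.congr_deriv ?_
    simp only [hψ', hψ]
    ring
  have hψpos : ∀ t, 0 < ψ t := fun t => mul_pos (Real.exp_pos _) (decayWeight_pos _ _ _)
  have hψ'neg : ∀ t, a ≤ t → ψ' t ≤ 0 := by
    intro t ht
    have := hDre t ht
    have h2 : 0 ≤ (D t).re + β + 2 * k * Real.exp (-β * t) := by positivity
    have := mul_nonneg h2 (hψpos t).le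
    simp only [hψ']
    linarith
  have hψlim : Tendsto ψ atTop (𝓝 0) := by
    refine tendsto_of_tendsto_of_tendsto_of_le_of_le' tendsto_const_nhds
      (tendsto_decayWeight (k := k) hβ) (Eventually.of_forall fun t => (hψpos t).le) ?_
    filter_upwards [eventually_ge_atTop a] with t ht
    refine mul_le_of_le_one_left (decayWeight_pos _ _ _).le (Real.exp_le_one_iff.2 ?_)
    linarith [hJnn t ht]
  have hint : ∀ x, a ≤ x → IntegrableOn ψ' (Ioi x) := fun x hx =>
    integrableOn_Ioi_deriv_of_nonpos' (fun t _ => hψd t)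
      (fun t ht => hψ'neg t (hx.trans (le_of_lt ht))) hψlim
  have hval : ∀ x, a ≤ x → ∫ t in Ioi x, ψ' t = 0 - ψ x := fun x hx =>
    integral_Ioi_of_hasDerivAt_of_nonpos' (fun t _ => hψd t)
      (fun t ht => hψ'neg t (hx.trans (le_of_lt ht))) hψlim
  have hle : ∀ t, a ≤ t → ‖exp (-J t) * g t‖ ≤ (m / 2 + F / β) * (-ψ' t) := by
    intro t ht
    rw [norm_mul, norm_exp, neg_re]
    have h1 := hDre t ht
    have h2 : ‖g t‖ ≤ ((D t).re / 2 + k * Real.exp (-β * t)) *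
        (decayWeight β k t * m) + F * decayWeight β k t :=
      (hbound t ht).trans (by gcongr; exact exp_le_decayWeight hβ hk t)
    have h3 : F ≤ F / β * ((D t).re + β + 2 * k * Real.exp (-β * t)) := by
      have : F = F / β * β := by field_simp
      have h4 : 0 ≤ F / β * ((D t).re + 2 * k * Real.exp (-β * t)) := by positivity
      linarith
    have h5 : ((D t).re / 2 + k * Real.exp (-β * t)) * m + F ≤
        (m / 2 + F / β) * ((D t).re + β + 2 * k * Real.exp (-β * t)) := by
      have : 0 ≤ m / 2 * β := by positivity
      linarith
    calc Real.exp (-(J t).re) * ‖g t‖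
        ≤ Real.exp (-(J t).re) * (((D t).re / 2 + k * Real.exp (-β * t)) *
        (decayWeight β k t * m) + F * decayWeight β k t) := by gcongr
      _ = (((D t).re / 2 + k * Real.exp (-β * t)) * m + F) * ψ t := by
          simp only [hψ]; ring
      _ ≤ ((m / 2 + F / β) * ((D t).re + β + 2 * k * Real.exp (-β * t))) * ψ t := by
          have := (hψpos t).le
          gcongr
      _ = _ := by simp only [hψ']; ring
  have hmeas : ∀ x, AEStronglyMeasurable (fun t => exp (-J t) * g t)
      (volume.restrict (Ioi x)) := fun x => by
    have : Continuous fun t => exp (-J t) * g t := by fun_prop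
    exact this.aestronglyMeasurable
  have hmajor : ∀ x, a ≤ x → IntegrableOn (fun t => (m / 2 + F / β) * (-ψ' t)) (Ioi x) :=
    fun x hx => (hint x hx).neg.const_mul _
  refine ⟨(hmajor a le_rfl).mono' (hmeas a) ?_, fun x hx => ?_⟩
  · filter_upwards [ae_restrict_mem measurableSet_Ioi] with t ht using hle t (le_of_lt ht)
  · have h1 : ‖∫ t in Ioi x, exp (-J t) * g t‖ ≤ (m / 2 + F / β) * ψ x := by
      calc ‖∫ t in Ioi x, exp (-J t) * g t‖ ≤ ∫ t in Ioi x, (m / 2 + F / β) * (-ψ' t) := by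
            refine norm_integral_le_of_norm_le (hmajor x hx) ?_
            filter_upwards [ae_restrict_mem measurableSet_Ioi] with t ht
              using hle t (hx.trans (le_of_lt ht))
        _ = _ := by
            rw [integral_const_mul, integral_neg, hval x hx]; ring
    unfold scalarSol
    rw [norm_neg, norm_mul, norm_exp]
    calc Real.exp (J x).re * ‖∫ t in Ioi x, exp (-J t) * g t‖
        ≤ Real.exp (J x).re * ((m / 2 + F / β) * ψ x) := by gcongr
      _ = (m / 2 + F / β) * decayWeight β k x := by
          simp only [hψ]
          rw [Real.exp_neg]
          have := (Real.exp_pos (J x).re).ne'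
          field_simp

theorem hasDerivWithinAt_scalarSol (hD : Continuous D) (hg : Continuous g)
    (hint : IntegrableOn (fun t => exp (-∫ τ in a..t, D τ) * g t) (Ioi a)) {x : ℝ}
    (hx : a ≤ x) :
    HasDerivWithinAt (scalarSol a D g) (D x * scalarSol a D g x + g x) (Ici a) x := by
  set J : ℝ → ℂ := fun x => ∫ t in a..x, D t with hJ
  have hJd : ∀ x, HasDerivAt J (D x) x := fun x =>
    intervalIntegral.integral_hasDerivAt_right (hD.intervalIntegrable _ _)
      (hD.stronglyMeasurableAtFilter _ _) hD.continuousAt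
  have hJc : Continuous J := continuous_iff_continuousAt.2 fun x => (hJd x).continuousAt
  have hc : Continuous fun t => exp (-J t) * g t := by fun_prop
  set H : ℝ → ℂ := fun y => (∫ t in Ioi a, exp (-J t) * g t) - ∫ t in a..y, exp (-J t) * g t
  have hH : HasDerivAt H (-(exp (-J x) * g x)) x :=
    (intervalIntegral.integral_hasDerivAt_right (hc.intervalIntegrable _ _)
      (hc.stronglyMeasurableAtFilter _ _) hc.continuousAt).const_sub _
  have heq : ∀ y ∈ Ici a, scalarSol a D g y = -(exp (J y) * H y) := by
    intro y hy
    have : H y = ∫ t in Ioi y, exp (-J t) * g t := by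
      simp only [H]
      rw [← intervalIntegral.integral_Ioi_sub_Ioi hint hy, sub_sub_cancel]
    rw [this]
    rfl
  have hder := ((hJd x).cexp.mul hH).neg.hasDerivWithinAt (s := Ici a)
  refine (hder.congr_of_mem heq hx).congr_deriv ?_
  rw [heq x hx, Complex.exp_neg]
  have := exp_ne_zero (J x)
  field_simp
  ring

end scalar

theorem scalarSol_sub {a x : ℝ} {D g₁ g₂ : ℝ → ℂ}
    (h₁ : IntegrableOn (fun t => exp (-∫ τ in a..t, D τ) * g₁ t) (Ioi a))
    (h₂ : IntegrableOn (fun t => exp (-∫ τ in a..t, D τ) * g₂ t) (Ioi a)) (hx : a ≤ x) :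
    scalarSol a D g₁ x - scalarSol a D g₂ x = scalarSol a D (fun t => g₁ t - g₂ t) x := by
  unfold scalarSol
  have := integral_sub (h₁.mono_set (Ioi_subset_Ioi hx)) (h₂.mono_set (Ioi_subset_Ioi hx))
  simp only [mul_sub]
  rw [this]
  ring

/-- The case of coefficients which are continuous on the whole line. In the unknown
`Y = η / decayWeight` the integral equation is a contraction of the space of bounded
continuous functions. -/
theorem exists_decaying_solution_of_continuous {n : Type*} [Fintype n] {a β k F : ℝ}
    (hβ : 0 < β) (hk : 0 ≤ k) (hF : 0 ≤ F) {D : ℝ → n → ℂ} {K : ℝ → Matrix n n ℂ}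
    {f : ℝ → n → ℂ} (hD : ∀ j, Continuous fun x => D x j)
    (hK : ∀ j l, Continuous fun x => K x j l) (hf : ∀ j, Continuous fun x => f x j)
    (hDre : ∀ x, a ≤ x → ∀ j, 0 ≤ (D x j).re)
    (hKle : ∀ x, a ≤ x → ∀ j,
      ∑ l, ‖K x j l‖ ≤ (D x j).re / 2 + k * Real.exp (-β * x))
    (hfle : ∀ x, a ≤ x → ∀ j, ‖f x j‖ ≤ F * Real.exp (-β * x)) :
    ∃ η : ℝ → n → ℂ,
      (∀ x, a ≤ x → ∀ j, HasDerivWithinAt (fun x => η x j)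
        (D x j * η x j + (K x *ᵥ η x) j + f x j) (Ici a) x) ∧
      ∀ x, a ≤ x → ‖η x‖ ≤ 2 * F / β * decayWeight β k x := by
  set φ : ℝ → ℝ := decayWeight β k with hφ
  have hφpos : ∀ x, 0 < φ x := decayWeight_pos β k
  have hφc : Continuous φ := continuous_decayWeight β k
  set lin : (ℝ →ᵇ (n → ℂ)) → n → ℝ → ℂ := fun Y j t => ∑ l, K t j l * (φ t * Y t l) with hlin
  have hYc : ∀ (Y : ℝ →ᵇ (n → ℂ)) (l : n), Continuous fun t => Y t l := fun Y l =>
    (continuous_apply l).comp Y.continuous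
  have hlinc : ∀ Y j, Continuous (lin Y j) := by
    intro Y j
    refine continuous_finsetSum _ fun l _ => (hK j l).mul ?_
    exact (continuous_ofReal.comp hφc).mul (hYc Y l)
  have hlinb : ∀ (Y : ℝ →ᵇ (n → ℂ)) j t, a ≤ t → ‖lin Y j t‖ ≤
      ((D t j).re / 2 + k * Real.exp (-β * t)) * (φ t * ‖Y‖) := by
    intro Y j t ht
    calc ‖lin Y j t‖ ≤ ∑ l, ‖K t j l * (φ t * Y t l)‖ := norm_sum_le _ _
      _ ≤ ∑ l, ‖K t j l‖ * (φ t * ‖Y‖) := by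
          refine Finset.sum_le_sum fun l _ => ?_
          rw [norm_mul, norm_mul, norm_real, Real.norm_of_nonneg (hφpos t).le]
          have h1 : ‖Y t l‖ ≤ ‖Y‖ := (norm_le_pi_norm (Y t) l).trans (Y.norm_coe_le_norm t)
          have := (hφpos t).le
          gcongr
      _ = (∑ l, ‖K t j l‖) * (φ t * ‖Y‖) := by rw [Finset.sum_mul]
      _ ≤ _ := by
          have := (hφpos t).le
          have := hKle t ht j
          gcongr
  set rhs : (ℝ →ᵇ (n → ℂ)) → n → ℝ → ℂ := fun Y j t => lin Y j t + f t j with hrhs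
  have hrhsc : ∀ Y j, Continuous (rhs Y j) := fun Y j => (hlinc Y j).add (hf j)
  have hrhsb : ∀ (Y : ℝ →ᵇ (n → ℂ)) j t, a ≤ t → ‖rhs Y j t‖ ≤
      ((D t j).re / 2 + k * Real.exp (-β * t)) * (φ t * ‖Y‖) + F * Real.exp (-β * t) :=
    fun Y j t ht => (norm_add_le _ _).trans (add_le_add (hlinb Y j t ht) (hfle t ht j))
  have hmaj := fun Y j => scalarSol_majorant hβ hk (hD j) (hrhsc Y j)
    (fun x hx => hDre x hx j) (norm_nonneg Y) hF (hrhsb Y j)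
  have hder := fun Y j x (hx : a ≤ x) =>
    hasDerivWithinAt_scalarSol (hD j) (hrhsc Y j) (hmaj Y j).1 hx
  have hmax : ∀ x, a ≤ max a x := fun x => le_max_left _ _
  set G : (ℝ →ᵇ (n → ℂ)) → ℝ → n → ℂ := fun Y x j =>
    scalarSol a (fun t => D t j) (rhs Y j) (max a x) / φ (max a x) with hG
  have hGc : ∀ Y, Continuous (G Y) := by
    intro Y
    refine continuous_pi fun j => ?_
    have h1 : ContinuousOn (scalarSol a (fun t => D t j) (rhs Y j)) (Ici a) := fun x hx =>
      (hder Y j x hx).continuousWithinAt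
    have h2 : Continuous fun x => scalarSol a (fun t => D t j) (rhs Y j) (max a x) :=
      h1.comp_continuous (by fun_prop) hmax
    refine h2.div (continuous_ofReal.comp (hφc.comp (by fun_prop))) fun x => ?_
    exact ofReal_ne_zero.2 (hφpos _).ne'
  have hdiv : ∀ {z : ℂ} {m x : ℝ}, ‖z‖ ≤ m * φ x → ‖z / φ x‖ ≤ m := by
    intro z m x h
    rw [norm_div, norm_real, Real.norm_of_nonneg (hφpos x).le]
    exact (div_le_iff₀ (hφpos x)).2 h
  have hGb : ∀ (Y : ℝ →ᵇ (n → ℂ)) x, ‖G Y x‖ ≤ ‖Y‖ / 2 + F / β := by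
    intro Y x
    refine (pi_norm_le_iff_of_nonneg (by positivity)).2 fun j => hdiv ?_
    exact (hmaj Y j).2 _ (hmax x)
  set T : (ℝ →ᵇ (n → ℂ)) → (ℝ →ᵇ (n → ℂ)) := fun Y =>
    BoundedContinuousFunction.ofNormedAddCommGroup (G Y) (hGc Y) _ (hGb Y) with hT
  have hcontr : ContractingWith (1 / 2) T := by
    refine ⟨by rw [← NNReal.coe_lt_coe]; norm_num, LipschitzWith.of_dist_le_mul fun Y Z => ?_⟩
    refine (BoundedContinuousFunction.dist_le (by positivity)).2 fun x => ?_
    rw [dist_eq_norm, dist_eq_norm]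
    refine (pi_norm_le_iff_of_nonneg (by positivity)).2 fun j => ?_
    have h1 : (T Y x - T Z x) j =
        scalarSol a (fun t => D t j) (lin (Y - Z) j) (max a x) / φ (max a x) := by
      change scalarSol a (fun t => D t j) (rhs Y j) (max a x) / φ (max a x) -
        scalarSol a (fun t => D t j) (rhs Z j) (max a x) / φ (max a x) = _
      rw [← sub_div, scalarSol_sub (hmaj Y j).1 (hmaj Z j).1 (hmax x)]
      congr 2
      funext t
      simp only [hrhs, hlin, add_sub_add_right_eq_sub, ← Finset.sum_sub_distrib]
      refine Finset.sum_congr rfl fun l _ => ?_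
      simp only [BoundedContinuousFunction.coe_sub, Pi.sub_apply]
      ring
    rw [h1]
    have h2 := scalarSol_majorant hβ hk (hD j) (hlinc (Y - Z) j)
      (fun x hx => hDre x hx j) (norm_nonneg (Y - Z)) le_rfl
      (fun t ht => by rw [zero_mul, add_zero]; exact hlinb (Y - Z) j t ht)
    refine hdiv ((h2.2 _ (hmax x)).trans (le_of_eq ?_))
    push_cast
    ring
  obtain ⟨Y, hY⟩ : ∃ Y, T Y = Y := ⟨_, hcontr.fixedPoint_isFixedPt⟩
  have hYb : ‖Y‖ ≤ 2 * F / β := by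
    have h1 : ‖T Y‖ ≤ ‖Y‖ / 2 + F / β :=
      (BoundedContinuousFunction.norm_le (by positivity)).2 (hGb Y)
    rw [hY] at h1
    have : 2 * F / β = 2 * (F / β) := by ring
    linarith
  have hYeq : ∀ x ∈ Ici a, ∀ j, (φ x : ℂ) * Y x j = scalarSol a (fun t => D t j) (rhs Y j) x := by
    intro x hx j
    have h1 : Y x j = G Y x j := by
      conv_lhs => rw [← hY]
      rfl
    rw [h1]
    simp only [hG, max_eq_right (mem_Ici.1 hx)]
    exact mul_div_cancel₀ _ (ofReal_ne_zero.2 (hφpos x).ne')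
  refine ⟨fun x j => φ x * Y x j, fun x hx j => ?_, fun x hx => ?_⟩
  · refine ((hder Y j x hx).congr_of_mem (fun y hy => hYeq y hy j) hx).congr_deriv ?_
    rw [← hYeq x hx j]
    exact (add_assoc _ _ _).symm
  · refine (pi_norm_le_iff_of_nonneg (by have := (hφpos x).le; positivity)).2 fun j => ?_
    rw [norm_mul, norm_real, Real.norm_of_nonneg (hφpos x).le, mul_comm]
    have h1 : ‖Y x j‖ ≤ ‖Y‖ := (norm_le_pi_norm (Y x) j).trans (Y.norm_coe_le_norm x)
    have := (hφpos x).le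
    exact mul_le_mul_of_nonneg_right (h1.trans hYb) this

/-- A linear system `η' = D η + K η + f` on `[a, ∞)` whose diagonal part `D` has nonnegative real
part and dominates the rest `K` up to `O(e^{-βx})`, with a source `f = O(e^{-βx})`, has a solution
of size `O(e^{-βx})`, with a bound that depends on `k`, `F`, `β` only. -/
theorem exists_decaying_solution {n : Type*} [Fintype n] {a β k F : ℝ} (ha : 0 ≤ a)
    (hβ : 0 < β) (hk : 0 ≤ k) (hF : 0 ≤ F) {D : ℝ → n → ℂ} {K : ℝ → Matrix n n ℂ}
    {f : ℝ → n → ℂ} (hD : ∀ j, ContinuousOn (fun x => D x j) (Ici a))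
    (hK : ∀ j l, ContinuousOn (fun x => K x j l) (Ici a))
    (hf : ∀ j, ContinuousOn (fun x => f x j) (Ici a))
    (hDre : ∀ x, a ≤ x → ∀ j, 0 ≤ (D x j).re)
    (hKle : ∀ x, a ≤ x → ∀ j,
      ∑ l, ‖K x j l‖ ≤ (D x j).re / 2 + k * Real.exp (-β * x))
    (hfle : ∀ x, a ≤ x → ∀ j, ‖f x j‖ ≤ F * Real.exp (-β * x)) :
    ∃ η : ℝ → n → ℂ,
      (∀ x, a ≤ x → ∀ j, HasDerivWithinAt (fun x => η x j)
        (D x j * η x j + (K x *ᵥ η x) j + f x j) (Ici a) x) ∧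
      ∀ x, a ≤ x → ‖η x‖ ≤ 2 * F / β * Real.exp (2 * k / β) * Real.exp (-β * x) := by
  have hext : ∀ {g : ℝ → ℂ}, ContinuousOn g (Ici a) → Continuous fun x => g (max a x) :=
    fun hg => hg.comp_continuous (by fun_prop) fun x => le_max_left a x
  have hmax : ∀ {x}, a ≤ x → max a x = x := fun hx => max_eq_right hx
  obtain ⟨η, h1, h2⟩ := exists_decaying_solution_of_continuous (a := a) hβ hk hF
    (D := fun x => D (max a x)) (K := fun x => K (max a x)) (f := fun x => f (max a x))
    (fun j => hext (hD j)) (fun j l => hext (hK j l)) (fun j => hext (hf j))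
    (fun x hx => by rw [hmax hx]; exact hDre x hx) (fun x hx => by rw [hmax hx]; exact hKle x hx)
    (fun x hx => by rw [hmax hx]; exact hfle x hx)
  refine ⟨η, fun x hx j => by simpa only [hmax hx] using h1 x hx j, fun x hx => ?_⟩
  refine (h2 x hx).trans ?_
  rw [mul_assoc]
  gcongr
  exact decayWeight_le hβ hk (ha.trans hx)

/-! ### Families of functions with exponentially decaying derivatives -/

section Tame

variable {ι : Type*} {a β : ℝ} {n : ℕ} {f g : ι → ℝ → ℂ}

/-- The family `f` is bounded on `[a, ∞)`, uniformly in the index. -/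
def UnifBdd (a : ℝ) (f : ι → ℝ → ℂ) : Prop :=
  ∃ C : ℝ, ∀ i x, a ≤ x → ‖f i x‖ ≤ C

/-- The family `f` is `O(e^{-βx})` on `[a, ∞)`, uniformly in the index. -/
def UnifDecay (a β : ℝ) (f : ι → ℝ → ℂ) : Prop :=
  ∃ C : ℝ, ∀ i x, a ≤ x → ‖f i x‖ ≤ C * Real.exp (-β * x)

/-- The family `f` is bounded on `[a, ∞)` and its derivatives up to order `n` are `O(e^{-βx})`,
uniformly in the index. Derivatives at the end point `a` are one-sided. -/
def Tame (a β : ℝ) : ℕ → (ι → ℝ → ℂ) → Prop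
  | 0, f => UnifBdd a f ∧ ∀ i, ContinuousOn (f i) (Ici a)
  | n + 1, f => UnifBdd a f ∧ ∃ f' : ι → ℝ → ℂ,
      (∀ i x, a ≤ x → HasDerivWithinAt (f i) (f' i x) (Ici a) x) ∧
        UnifDecay a β f' ∧ Tame a β n f'

theorem UnifBdd.exists_pos (hf : UnifBdd a f) : ∃ C : ℝ, 0 < C ∧ ∀ i x, a ≤ x → ‖f i x‖ ≤ C := by
  obtain ⟨C, hC⟩ := hf
  exact ⟨max C 1, by positivity, fun i x hx => (hC i x hx).trans (le_max_left _ _)⟩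

theorem UnifDecay.exists_pos (hf : UnifDecay a β f) :
    ∃ C : ℝ, 0 < C ∧ ∀ i x, a ≤ x → ‖f i x‖ ≤ C * Real.exp (-β * x) := by
  obtain ⟨C, hC⟩ := hf
  refine ⟨max C 1, by positivity, fun i x hx => (hC i x hx).trans ?_⟩
  have := le_max_left C 1
  gcongr

theorem UnifBdd.add (hf : UnifBdd a f) (hg : UnifBdd a g) :
    UnifBdd a (fun i x => f i x + g i x) := by
  obtain ⟨C, hC⟩ := hf
  obtain ⟨D, hD⟩ := hg
  exact ⟨C + D, fun i x hx => (norm_add_le _ _).trans (add_le_add (hC i x hx) (hD i x hx))⟩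

theorem UnifBdd.mul (hf : UnifBdd a f) (hg : UnifBdd a g) :
    UnifBdd a (fun i x => f i x * g i x) := by
  obtain ⟨C, hC0, hC⟩ := hf.exists_pos
  obtain ⟨D, hD⟩ := hg
  refine ⟨C * D, fun i x hx => ?_⟩
  rw [norm_mul]
  exact mul_le_mul (hC i x hx) (hD i x hx) (norm_nonneg _) hC0.le

theorem UnifDecay.add (hf : UnifDecay a β f) (hg : UnifDecay a β g) :
    UnifDecay a β (fun i x => f i x + g i x) := by
  obtain ⟨C, hC⟩ := hf
  obtain ⟨D, hD⟩ := hg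
  refine ⟨C + D, fun i x hx => ?_⟩
  rw [add_mul]
  exact (norm_add_le _ _).trans (add_le_add (hC i x hx) (hD i x hx))

theorem UnifDecay.mul_bdd (hf : UnifDecay a β f) (hg : UnifBdd a g) :
    UnifDecay a β (fun i x => f i x * g i x) := by
  obtain ⟨C, hC⟩ := hf
  obtain ⟨D, hD0, hD⟩ := hg.exists_pos
  refine ⟨C * D, fun i x hx => ?_⟩
  rw [norm_mul]
  calc ‖f i x‖ * ‖g i x‖ ≤ (C * Real.exp (-β * x)) * D :=
        mul_le_mul (hC i x hx) (hD i x hx) (norm_nonneg _) ((norm_nonneg _).trans (hC i x hx))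
    _ = _ := by ring

theorem UnifDecay.bdd_mul (hf : UnifBdd a f) (hg : UnifDecay a β g) :
    UnifDecay a β (fun i x => f i x * g i x) := by
  simpa only [mul_comm] using hg.mul_bdd hf

theorem UnifDecay.neg (hf : UnifDecay a β f) : UnifDecay a β (fun i x => -f i x) := by
  obtain ⟨C, hC⟩ := hf
  exact ⟨C, fun i x hx => by rw [norm_neg]; exact hC i x hx⟩

theorem UnifDecay.sub (hf : UnifDecay a β f) (hg : UnifDecay a β g) :
    UnifDecay a β (fun i x => f i x - g i x) := by
  simpa only [sub_eq_add_neg] using hf.add hg.neg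

theorem UnifDecay.zero : UnifDecay a β (fun (_ : ι) _ => 0) :=
  ⟨0, fun i x _ => by simp⟩

theorem UnifDecay.congr (hf : UnifDecay a β f) (h : ∀ i x, a ≤ x → g i x = f i x) :
    UnifDecay a β g := by
  obtain ⟨C, hC⟩ := hf
  exact ⟨C, fun i x hx => by rw [h i x hx]; exact hC i x hx⟩

theorem UnifDecay.sum {σ : Type*} (s : Finset σ) {F : σ → ι → ℝ → ℂ}
    (hF : ∀ j ∈ s, UnifDecay a β (F j)) : UnifDecay a β (fun i x => ∑ j ∈ s, F j i x) := by
  classical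
  induction s using Finset.induction_on with
  | empty => simpa using UnifDecay.zero
  | insert j s hj ih =>
    simp only [Finset.sum_insert hj]
    exact (hF j (Finset.mem_insert_self _ _)).add
      (ih fun l hl => hF l (Finset.mem_insert_of_mem hl))

theorem Tame.bdd (hf : Tame a β n f) : UnifBdd a f := by
  cases n <;> exact hf.1

theorem Tame.continuousOn (hf : Tame a β n f) (i : ι) : ContinuousOn (f i) (Ici a) := by
  cases n with
  | zero => exact hf.2 i
  | succ n =>
    obtain ⟨-, f', h, -⟩ := hf
    exact fun x hx => (h i x hx).continuousWithinAt

theorem Tame.of_succ (hf : Tame a β (n + 1) f) : Tame a β n f := by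
  induction n generalizing f with
  | zero => exact ⟨hf.bdd, hf.continuousOn⟩
  | succ n ih =>
    obtain ⟨h1, f', h2, h3, h4⟩ := hf
    exact ⟨h1, f', h2, h3, ih h4⟩

theorem Tame.congr (hf : Tame a β n f) (h : ∀ i x, a ≤ x → g i x = f i x) : Tame a β n g := by
  have hb : UnifBdd a g := by
    obtain ⟨C, hC⟩ := hf.bdd
    exact ⟨C, fun i x hx => by rw [h i x hx]; exact hC i x hx⟩
  cases n with
  | zero => exact ⟨hb, fun i => (hf.2 i).congr fun x hx => h i x hx⟩
  | succ n =>
    obtain ⟨-, f', h2, h3⟩ := hf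
    exact ⟨hb, f', fun i x hx => (h2 i x hx).congr_of_mem (fun y hy => h i y hy) hx, h3⟩

theorem Tame.mono {b : ℝ} (hf : Tame a β n f) (hab : a ≤ b) : Tame b β n f := by
  have hb : ∀ {f : ι → ℝ → ℂ}, UnifBdd a f → UnifBdd b f := fun ⟨C, hC⟩ =>
    ⟨C, fun i x hx => hC i x (hab.trans hx)⟩
  induction n generalizing f with
  | zero => exact ⟨hb hf.1, fun i => (hf.2 i).mono (Ici_subset_Ici.2 hab)⟩
  | succ n ih =>
    obtain ⟨h1, f', h2, ⟨C, hC⟩, h4⟩ := hf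
    exact ⟨hb h1, f', fun i x hx => (h2 i x (hab.trans hx)).mono (Ici_subset_Ici.2 hab),
      ⟨C, fun i x hx => hC i x (hab.trans hx)⟩, ih h4⟩

theorem UnifDecay.mono {b : ℝ} (hf : UnifDecay a β f) (hab : a ≤ b) : UnifDecay b β f := by
  obtain ⟨C, hC⟩ := hf
  exact ⟨C, fun i x hx => hC i x (hab.trans hx)⟩

/-- Functions of the index alone. -/
theorem Tame.const {c : ι → ℂ} {C : ℝ} (hc : ∀ i, ‖c i‖ ≤ C) :
    Tame a β n (fun i _ => c i) := by
  induction n generalizing c C with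
  | zero => exact ⟨⟨C, fun i _ _ => hc i⟩, fun i => continuousOn_const⟩
  | succ n ih =>
    exact ⟨⟨C, fun i _ _ => hc i⟩, fun _ _ => 0, fun i x _ => hasDerivWithinAt_const _ _ _,
      UnifDecay.zero, ih (C := 0) fun i => by simp⟩

theorem Tame.const' (c : ℂ) : Tame a β n (fun (_ : ι) _ => c) :=
  Tame.const (C := ‖c‖) fun _ => le_rfl

theorem Tame.add (hf : Tame a β n f) (hg : Tame a β n g) :
    Tame a β n (fun i x => f i x + g i x) := by
  induction n generalizing f g with
  | zero => exact ⟨hf.1.add hg.1, fun i => (hf.2 i).add (hg.2 i)⟩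
  | succ n ih =>
    obtain ⟨h1, f', h2, h3, h4⟩ := hf
    obtain ⟨k1, g', k2, k3, k4⟩ := hg
    exact ⟨h1.add k1, _, fun i x hx => (h2 i x hx).fun_add (k2 i x hx), h3.add k3, ih h4 k4⟩

theorem Tame.mul (hf : Tame a β n f) (hg : Tame a β n g) :
    Tame a β n (fun i x => f i x * g i x) := by
  induction n generalizing f g with
  | zero => exact ⟨hf.1.mul hg.1, fun i => (hf.2 i).mul (hg.2 i)⟩
  | succ n ih =>
    have hf0 := hf.of_succ
    have hg0 := hg.of_succ
    obtain ⟨h1, f', h2, h3, h4⟩ := hf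
    obtain ⟨k1, g', k2, k3, k4⟩ := hg
    exact ⟨h1.mul k1, _, fun i x hx => (h2 i x hx).fun_mul (k2 i x hx),
      (h3.mul_bdd k1).add (UnifDecay.bdd_mul h1 k3), (ih h4 hg0).add (ih hf0 k4)⟩

theorem Tame.neg (hf : Tame a β n f) : Tame a β n (fun i x => -f i x) :=
  ((Tame.const' (-1)).mul hf).congr fun i x _ => by ring

theorem Tame.sub (hf : Tame a β n f) (hg : Tame a β n g) :
    Tame a β n (fun i x => f i x - g i x) := by
  simpa only [sub_eq_add_neg] using hf.add hg.neg

theorem Tame.pow (hf : Tame a β n f) (k : ℕ) : Tame a β n (fun i x => f i x ^ k) := by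
  induction k with
  | zero => simpa using Tame.const' 1
  | succ k ih => simpa only [pow_succ] using ih.mul hf

theorem Tame.inv {c : ℝ} (hf : Tame a β n f) (hc : 0 < c) (hle : ∀ i x, a ≤ x → c ≤ ‖f i x‖) :
    Tame a β n (fun i x => (f i x)⁻¹) := by
  have hb : UnifBdd a (fun i x => (f i x)⁻¹) :=
    ⟨c⁻¹, fun i x hx => by rw [norm_inv]; exact inv_anti₀ hc (hle i x hx)⟩
  have h0 : ∀ i x, a ≤ x → f i x ≠ 0 := fun i x hx =>
    norm_pos_iff.1 (hc.trans_le (hle i x hx))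
  induction n generalizing f with
  | zero => exact ⟨hb, fun i => (hf.2 i).inv₀ fun x hx => h0 i x hx⟩
  | succ n ih =>
    have hinv := ih hf.of_succ hle hb h0
    obtain ⟨h1, f', h2, h3, h4⟩ := hf
    refine ⟨hb, fun i x => f' i x * (-((f i x)⁻¹ * (f i x)⁻¹)), fun i x hx => ?_,
      h3.mul_bdd (hinv.mul hinv).neg.bdd, h4.mul (hinv.mul hinv).neg⟩
    refine ((h2 i x hx).fun_inv (h0 i x hx)).congr_deriv ?_
    field_simp

theorem Tame.div {c : ℝ} (hg : Tame a β n g) (hf : Tame a β n f) (hc : 0 < c)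
    (hle : ∀ i x, a ≤ x → c ≤ ‖f i x‖) : Tame a β n (fun i x => g i x / f i x) := by
  simpa only [div_eq_mul_inv] using hg.mul (hf.inv hc hle)

theorem Tame.sum {σ : Type*} (s : Finset σ) {F : σ → ι → ℝ → ℂ}
    (hF : ∀ j ∈ s, Tame a β n (F j)) : Tame a β n (fun i x => ∑ j ∈ s, F j i x) := by
  classical
  induction s using Finset.induction_on with
  | empty => simpa using Tame.const' 0
  | insert j s hj ih =>
    simp only [Finset.sum_insert hj]
    exact (hF j (Finset.mem_insert_self _ _)).add
      (ih fun l hl => hF l (Finset.mem_insert_of_mem hl))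

theorem Tame.prod {σ : Type*} (s : Finset σ) {F : σ → ι → ℝ → ℂ}
    (hF : ∀ j ∈ s, Tame a β n (F j)) : Tame a β n (fun i x => ∏ j ∈ s, F j i x) := by
  classical
  induction s using Finset.induction_on with
  | empty => simpa using Tame.const' 1
  | insert j s hj ih =>
    simp only [Finset.prod_insert hj]
    exact (hF j (Finset.mem_insert_self _ _)).mul
      (ih fun l hl => hF l (Finset.mem_insert_of_mem hl))

/-- A continuous square root of a tame family is tame, if it is bounded away from zero. -/
theorem Tame.of_sq {c : ℝ} (hg : Tame a β n g) (hsq : ∀ i x, a ≤ x → f i x ^ 2 = g i x)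
    (hcont : ∀ i, ContinuousOn (f i) (Ici a)) (hc : 0 < c)
    (hle : ∀ i x, a ≤ x → c ≤ ‖f i x‖) : Tame a β n f := by
  have hb : UnifBdd a f := by
    obtain ⟨C, hC⟩ := hg.bdd
    refine ⟨C + 1, fun i x hx => ?_⟩
    have h1 : ‖f i x‖ ^ 2 ≤ C := by rw [← norm_pow, hsq i x hx]; exact hC i x hx
    nlinarith [sq_nonneg (‖f i x‖ - 1), norm_nonneg (f i x)]
  have h0 : ∀ i x, a ≤ x → f i x ≠ 0 := fun i x hx =>
    norm_pos_iff.1 (hc.trans_le (hle i x hx))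
  induction n generalizing g with
  | zero => exact ⟨hb, hcont⟩
  | succ n ih =>
    have hf := ih hg.of_succ hsq
    have hinv := hf.inv hc hle
    obtain ⟨h1, g', h2, h3, h4⟩ := hg
    have hhalf : Tame a β n (fun i x => 1 / 2 * (f i x)⁻¹) := (Tame.const' (1 / 2)).mul hinv
    refine ⟨hb, fun i x => g' i x * (1 / 2 * (f i x)⁻¹), fun i x hx => ?_,
      h3.mul_bdd hhalf.bdd, h4.mul hhalf⟩
    -- the difference quotient of `f` is that of `f²` divided by `f y + f x`
    rw [hasDerivWithinAt_iff_tendsto_slope]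
    have hslope := hasDerivWithinAt_iff_tendsto_slope.1 (h2 i x hx)
    have hadd : Filter.Tendsto (fun y => (f i y + f i x)⁻¹)
        (nhdsWithin x (Ici a \ {x})) (nhds ((f i x + f i x)⁻¹)) := by
      refine Filter.Tendsto.inv₀ ?_ ?_
      · exact (((hcont i) x hx).mono_left (nhdsWithin_mono _ sdiff_subset)).add_const _
      · rw [← two_mul]
        exact mul_ne_zero two_ne_zero (h0 i x hx)
    have hlim := hslope.mul hadd
    have heq : g' i x * (f i x + f i x)⁻¹ = g' i x * (1 / 2 * (f i x)⁻¹) := by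
      have := h0 i x hx
      field_simp
      ring
    rw [heq] at hlim
    refine hlim.congr' ?_
    have hne : ∀ᶠ y in nhdsWithin x (Ici a \ {x}), f i y + f i x ≠ 0 := by
      have h5 : Filter.Tendsto (fun y => f i y + f i x)
          (nhdsWithin x (Ici a \ {x})) (nhds (f i x + f i x)) :=
        (((hcont i) x hx).mono_left (nhdsWithin_mono _ sdiff_subset)).add_const _
      refine h5.eventually_ne ?_
      rw [← two_mul]
      exact mul_ne_zero two_ne_zero (h0 i x hx)
    filter_upwards [hne, self_mem_nhdsWithin] with y hy hmem
    simp only [slope, vsub_eq_sub, ← hsq i y hmem.1, ← hsq i x hx, real_smul]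
    field_simp
    ring

theorem Tame.det {m : Type*} [Fintype m] [DecidableEq m] {A : ι → ℝ → Matrix m m ℂ}
    (hA : ∀ j l, Tame a β n (fun i x => A i x j l)) : Tame a β n (fun i x => (A i x).det) := by
  simp only [Matrix.det_apply']
  exact Tame.sum _ fun σ _ => (Tame.const' _).mul (Tame.prod _ fun j _ => hA _ _)

theorem Tame.matrix_inv {m : Type*} [Fintype m] [DecidableEq m] {A : ι → ℝ → Matrix m m ℂ}
    {c : ℝ} (hA : ∀ j l, Tame a β n (fun i x => A i x j l)) (hc : 0 < c)
    (hle : ∀ i x, a ≤ x → c ≤ ‖(A i x).det‖) (j l : m) :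
    Tame a β n (fun i x => (A i x)⁻¹ j l) := by
  have hadj : Tame a β n (fun i x => (A i x).adjugate j l) := by
    simp only [Matrix.adjugate_apply]
    refine Tame.det fun j' l' => ?_
    by_cases h : j' = l
    · subst h
      simpa using Tame.const' _
    · simpa [Matrix.updateRow_ne h] using hA j' l'
  refine (((Tame.det hA).inv hc hle).mul hadj).congr fun i x hx => ?_
  rw [Matrix.inv_def, Matrix.smul_apply, Ring.inverse_eq_inv, smul_eq_mul]

theorem Tame.matrix_mul {m : Type*} [Fintype m] {A B : ι → ℝ → Matrix m m ℂ}
    (hA : ∀ j l, Tame a β n (fun i x => A i x j l))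
    (hB : ∀ j l, Tame a β n (fun i x => B i x j l)) (j l : m) :
    Tame a β n (fun i x => (A i x * B i x) j l) := by
  simp only [Matrix.mul_apply]
  exact Tame.sum _ fun k _ => (hA j k).mul (hB k l)

theorem Tame.exists_deriv (hf : Tame a β (n + 1) f) : ∃ f' : ι → ℝ → ℂ,
    (∀ i x, a ≤ x → HasDerivWithinAt (f i) (f' i x) (Ici a) x) ∧
      UnifDecay a β f' ∧ Tame a β n f' := hf.2

end Tame

/-! ### Perturbation of a simple eigenvector -/

theorem norm_mulVec_le {m : Type*} [Fintype m] {A : Matrix m m ℂ} {C : ℝ} (hC : 0 ≤ C)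
    (hA : ∀ j l, ‖A j l‖ ≤ C) (v : m → ℂ) : ‖A *ᵥ v‖ ≤ Fintype.card m * C * ‖v‖ := by
  refine (pi_norm_le_iff_of_nonneg (by positivity)).2 fun j => ?_
  calc ‖(A *ᵥ v) j‖ ≤ ∑ l, ‖A j l * v l‖ := norm_sum_le _ _
    _ ≤ ∑ _l : m, C * ‖v‖ := by
        refine Finset.sum_le_sum fun l _ => ?_
        rw [norm_mul]
        exact mul_le_mul (hA j l) (norm_le_pi_norm v l) (norm_nonneg _) hC
    _ = _ := by
        rw [Finset.sum_const, nsmul_eq_mul, Finset.card_univ]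
        ring

/-- Let `M v₀ = 0`, with left null vector `e₀`, and let `J` invert `M` on vectors with vanishing
`0`-th entry. Then a small perturbation `M + E` has an eigenvector `v₀ + t` with `t = O(‖E‖)`. -/
theorem exists_eigenvector_add {m : Type*} [Fintype m] [DecidableEq m] {o : m}
    {M J E : Matrix m m ℂ} {v₀ : m → ℂ} {K ε V : ℝ} (hv₀ : v₀ o = 1) (hMv : M *ᵥ v₀ = 0)
    (hJ : ∀ g : m → ℂ, g o = 0 → M *ᵥ (J *ᵥ g) = g) (hJ0 : ∀ g : m → ℂ, (J *ᵥ g) o = 0)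
    (hK : 0 ≤ K) (hε : 0 ≤ ε) (hJK : ∀ g, ‖J *ᵥ g‖ ≤ K * ‖g‖)
    (hE : ∀ g, ‖E *ᵥ g‖ ≤ ε * ‖g‖) (hV : ‖v₀‖ ≤ V)
    (hsmall : 6 * K * ε * (V + 1) ^ 2 ≤ 1) :
    ∃ t : m → ℂ, ‖t‖ ≤ 2 * K * ε * (V + 1) ^ 2 ∧
      ∃ σ : ℂ, (M + E) *ᵥ (v₀ + t) = σ • (v₀ + t) := by
  set W := V + 1 with hW
  have hV0 : 0 ≤ V := (norm_nonneg _).trans hV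
  have hW1 : 1 ≤ W := by linarith
  have hWW : W ≤ W ^ 2 := by nlinarith
  have hKε : 0 ≤ K * ε := mul_nonneg hK hε
  set σ : (m → ℂ) → ℂ := fun t => (E *ᵥ (v₀ + t)) o with hσ
  set g : (m → ℂ) → m → ℂ := fun t => σ t • (v₀ + t) - E *ᵥ (v₀ + t) with hg
  have hw : ∀ t ∈ Metric.closedBall (0 : m → ℂ) 1, ‖v₀ + t‖ ≤ W := by
    intro t ht
    have h1 : ‖t‖ ≤ 1 := by simpa using ht
    exact (norm_add_le _ _).trans (add_le_add hV h1)
  have hσb : ∀ t ∈ Metric.closedBall (0 : m → ℂ) 1, ‖σ t‖ ≤ ε * W := fun t ht =>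
    ((norm_le_pi_norm _ o).trans (hE _)).trans (by gcongr; exact hw t ht)
  have hgb : ∀ t ∈ Metric.closedBall (0 : m → ℂ) 1, ‖J *ᵥ g t‖ ≤ 2 * K * ε * W ^ 2 := by
    intro t ht
    have h1 : ‖g t‖ ≤ (ε * W) * W + ε * W := by
      refine (norm_sub_le _ _).trans (add_le_add ?_ ?_)
      · rw [norm_smul]
        exact mul_le_mul (hσb t ht) (hw t ht) (norm_nonneg _) (by positivity)
      · exact (hE _).trans (by gcongr; exact hw t ht)
    calc ‖J *ᵥ g t‖ ≤ K * ((ε * W) * W + ε * W) := (hJK _).trans (by gcongr)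
      _ = K * ε * (W ^ 2 + W) := by ring
      _ ≤ K * ε * (W ^ 2 + W ^ 2) := by gcongr
      _ = _ := by ring
  have hmaps : MapsTo (fun t => J *ᵥ g t) (Metric.closedBall 0 1) (Metric.closedBall 0 1) := by
    intro t ht
    have := hgb t ht
    simp only [Metric.mem_closedBall, dist_zero_right]
    have h0 : 0 ≤ K * ε * W ^ 2 := by positivity
    linarith
  have hlip : ∀ t ∈ Metric.closedBall (0 : m → ℂ) 1, ∀ s ∈ Metric.closedBall (0 : m → ℂ) 1,
      ‖J *ᵥ g t - J *ᵥ g s‖ ≤ 1 / 2 * ‖t - s‖ := by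
    intro t ht s hs
    have hEd : ‖E *ᵥ (v₀ + t) - E *ᵥ (v₀ + s)‖ ≤ ε * ‖t - s‖ := by
      rw [← mulVec_sub, add_sub_add_left_eq_sub]
      exact hE _
    have hσd : ‖σ t - σ s‖ ≤ ε * ‖t - s‖ :=
      (norm_le_pi_norm (E *ᵥ (v₀ + t) - E *ᵥ (v₀ + s)) o).trans hEd
    have hgd : ‖g t - g s‖ ≤ (ε * W) * ‖t - s‖ + (ε * ‖t - s‖) * W + ε * ‖t - s‖ := by
      have h1 : g t - g s = σ t • (t - s) + (σ t - σ s) • (v₀ + s) -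
          (E *ᵥ (v₀ + t) - E *ᵥ (v₀ + s)) := by
        simp only [hg, smul_add, smul_sub, sub_smul]
        abel
      rw [h1]
      refine (norm_sub_le _ _).trans (add_le_add ((norm_add_le _ _).trans (add_le_add ?_ ?_)) hEd)
      · rw [norm_smul]
        exact mul_le_mul_of_nonneg_right (hσb t ht) (norm_nonneg _)
      · rw [norm_smul]
        exact mul_le_mul hσd (hw s hs) (norm_nonneg _) (by positivity)
    rw [← mulVec_sub]
    calc ‖J *ᵥ (g t - g s)‖
        ≤ K * ((ε * W) * ‖t - s‖ + (ε * ‖t - s‖) * W + ε * ‖t - s‖) :=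
          (hJK _).trans (by gcongr)
      _ = K * ε * (2 * W + 1) * ‖t - s‖ := by ring
      _ ≤ K * ε * (3 * W ^ 2) * ‖t - s‖ := by
          gcongr
          linarith
      _ ≤ 1 / 2 * ‖t - s‖ := by
          gcongr
          linarith
  have hcontr : ContractingWith (1 / 2) (hmaps.restrict _ _ _) := by
    refine ⟨by rw [← NNReal.coe_lt_coe]; norm_num, LipschitzWith.of_dist_le_mul fun t s => ?_⟩
    rw [Subtype.dist_eq, Subtype.dist_eq, dist_eq_norm, dist_eq_norm]
    simpa using hlip t t.2 s s.2
  obtain ⟨t, htmem, htfix, -⟩ := hcontr.exists_fixedPoint'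
    (Metric.isClosed_closedBall.isComplete) hmaps (x := 0) (by simp) (edist_ne_top _ _)
  have htfix' : J *ᵥ g t = t := htfix
  refine ⟨t, ?_, σ t, ?_⟩
  · rw [← htfix']
    exact hgb t htmem
  · have ht0 : t o = 0 := by rw [← htfix']; exact hJ0 _
    have hg0 : g t o = 0 := by
      simp [hg, hσ, hv₀, ht0]
    have hMt : M *ᵥ t = g t := by
      conv_lhs => rw [← htfix']
      exact hJ _ hg0
    rw [add_mulVec, mulVec_add, hMv, hMt, zero_add]
    simp [hg]

/-! ### The model system -/

/-- The coefficient matrix of the model system: the leading part, with eigenvalues relative to the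
distinguished one, and in the last row the part of the first order coefficients that
does not decay. -/
def modelMatrix (δ₂ δ₃ γ : ℂ) (b : Fin 5 → ℂ) (h : ℂ) : Matrix (Fin 5) (Fin 5) ℂ :=
  !![0, 0, 0, 0, 0;
     0, δ₂, 0, 0, 0;
     0, γ, δ₃, 0, 0;
     0, 0, 0, δ₃, 0;
     h * b 0, h * b 1, h * b 2, h * b 3, δ₃ + h * b 4]

/-- The null vector of `modelMatrix`. -/
noncomputable def modelVec (δ₃ : ℂ) (b : Fin 5 → ℂ) (h : ℂ) : Fin 5 → ℂ :=
  ![1, 0, 0, 0, -(h * b 0 / (δ₃ + h * b 4))]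

/-- The inverse of `modelMatrix` on vectors with vanishing first entry. -/
noncomputable def modelInv (δ₂ δ₃ γ : ℂ) (b : Fin 5 → ℂ) (h : ℂ) : Matrix (Fin 5) (Fin 5) ℂ :=
  !![0, 0, 0, 0, 0;
     0, 1 / δ₂, 0, 0, 0;
     0, -(γ / δ₂ / δ₃), 1 / δ₃, 0, 0;
     0, 0, 0, 1 / δ₃, 0;
     0, -(h * ((b 1 - b 2 * (γ / δ₃)) / δ₂) / (δ₃ + h * b 4)), -(h * (b 2 / δ₃) / (δ₃ + h * b 4)),
      -(h * (b 3 / δ₃) / (δ₃ + h * b 4)), 1 / (δ₃ + h * b 4)]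

theorem modelMatrix_mulVec_modelVec {δ₂ δ₃ γ : ℂ} {b : Fin 5 → ℂ} {h : ℂ}
    (h5 : δ₃ + h * b 4 ≠ 0) : modelMatrix δ₂ δ₃ γ b h *ᵥ modelVec δ₃ b h = 0 := by
  ext j
  fin_cases j <;> simp [modelMatrix, modelVec, mulVec, dotProduct, Fin.sum_univ_five]
  field_simp
  ring

theorem modelMatrix_mulVec_modelInv {δ₂ δ₃ γ : ℂ} {b : Fin 5 → ℂ} {h : ℂ} (h2 : δ₂ ≠ 0)
    (h3 : δ₃ ≠ 0) (h5 : δ₃ + h * b 4 ≠ 0) (g : Fin 5 → ℂ) :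
    modelMatrix δ₂ δ₃ γ b h *ᵥ (modelInv δ₂ δ₃ γ b h *ᵥ g) = g - Pi.single 0 (g 0) := by
  ext j
  fin_cases j <;>
    simp [modelMatrix, modelInv, mulVec, dotProduct, Fin.sum_univ_five]
  all_goals field_simp
  all_goals ring

theorem modelInv_mulVec_zero (δ₂ δ₃ γ : ℂ) (b : Fin 5 → ℂ) (h : ℂ) (g : Fin 5 → ℂ) :
    (modelInv δ₂ δ₃ γ b h *ᵥ g) 0 = 0 := by
  simp [modelInv, mulVec, dotProduct, Fin.sum_univ_five]

theorem modelVec_zero (δ₃ : ℂ) (b : Fin 5 → ℂ) (h : ℂ) : modelVec δ₃ b h 0 = 1 := rfl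

/-! ### Families of model systems -/

theorem exists_forall_decay {ι σ : Type*} [Finite σ] {a β : ℝ} {F : σ → ι → ℝ → ℂ}
    (hF : ∀ j, UnifDecay a β (F j)) :
    ∃ C : ℝ, 0 < C ∧ ∀ j i x, a ≤ x → ‖F j i x‖ ≤ C * Real.exp (-β * x) := by
  have := Fintype.ofFinite σ
  choose C hC0 hC using fun j => (hF j).exists_pos
  refine ⟨1 + ∑ j, C j, by have := Finset.sum_nonneg fun j (_ : j ∈ Finset.univ) => (hC0 j).le
                           linarith, fun j i x hx => (hC j i x hx).trans ?_⟩
  have := Finset.single_le_sum (fun j _ => (hC0 j).le) (Finset.mem_univ j)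
  gcongr
  linarith

theorem exists_forall_bdd {ι σ : Type*} [Finite σ] {a : ℝ} {F : σ → ι → ℝ → ℂ}
    (hF : ∀ j, UnifBdd a (F j)) :
    ∃ C : ℝ, 0 < C ∧ ∀ j i x, a ≤ x → ‖F j i x‖ ≤ C := by
  have := Fintype.ofFinite σ
  choose C hC0 hC using fun j => (hF j).exists_pos
  refine ⟨1 + ∑ j, C j, by have := Finset.sum_nonneg fun j (_ : j ∈ Finset.univ) => (hC0 j).le
                           linarith, fun j i x hx => (hC j i x hx).trans ?_⟩
  have := Finset.single_le_sum (fun j _ => (hC0 j).le) (Finset.mem_univ j)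
  linarith

/-- Coefficients of a family of model systems: they are tame, the two gaps and the last diagonal
entry stay away from zero, and the diagonal dominates the off-diagonal terms that do not decay. -/
structure ModelFamily {ι : Type*} (a β : ℝ) (h : ι → ℝ) (δ₂ δ₃ γ : ι → ℝ → ℂ)
    (b : ι → ℝ → Fin 5 → ℂ) : Prop where
  h_pos : ∀ i, 0 < h i
  h_le : ∀ i, h i ≤ 1
  tame₂ : Tame a β 1 δ₂
  tame₃ : Tame a β 1 δ₃
  tameγ : Tame a β 1 γ
  tameb : ∀ k, Tame a β 1 (fun i x => b i x k)
  lower : ∃ c : ℝ, 0 < c ∧ ∀ i x, a ≤ x →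
    c ≤ ‖δ₂ i x‖ ∧ c ≤ ‖δ₃ i x‖ ∧ c ≤ ‖δ₃ i x + h i * b i x 4‖
  re₂ : ∀ i x, a ≤ x → 0 ≤ (δ₂ i x).re
  dom₃ : ∀ i x, a ≤ x → ‖γ i x‖ ≤ (δ₃ i x).re / 2
  dom₅ : ∀ i x, a ≤ x →
    ‖b i x 0‖ + ‖b i x 1‖ + ‖b i x 2‖ + ‖b i x 3‖ ≤ (b i x 4).re / 2

namespace ModelFamily

variable {ι : Type*} {a β : ℝ} {h : ι → ℝ} {δ₂ δ₃ γ : ι → ℝ → ℂ} {b : ι → ℝ → Fin 5 → ℂ}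

theorem tame_h (hm : ModelFamily a β h δ₂ δ₃ γ b) :
    Tame a β 1 (fun i (_ : ℝ) => (h i : ℂ)) :=
  Tame.const (C := 1) fun i => by
    rw [norm_real, Real.norm_of_nonneg (hm.h_pos i).le]
    exact hm.h_le i

theorem tame_last (hm : ModelFamily a β h δ₂ δ₃ γ b) :
    Tame a β 1 (fun i x => (b i x 0) / (δ₃ i x + h i * b i x 4)) := by
  obtain ⟨c, hc, hle⟩ := hm.lower
  exact (hm.tameb 0).div (hm.tame₃.add (hm.tame_h.mul (hm.tameb 4))) hc
    fun i x hx => (hle i x hx).2.2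

theorem tame_vec (hm : ModelFamily a β h δ₂ δ₃ γ b) (j : Fin 5) :
    Tame a β 1 (fun i x => modelVec (δ₃ i x) (b i x) (h i) j) := by
  fin_cases j
  · exact Tame.const' 1
  · exact Tame.const' 0
  · exact Tame.const' 0
  · exact Tame.const' 0
  · exact (hm.tame_h.mul hm.tame_last).neg.congr fun i x _ => by simp [modelVec, mul_div_assoc]

theorem tame_inv (hm : ModelFamily a β h δ₂ δ₃ γ b) (j l : Fin 5) :
    Tame a β 1 (fun i x => modelInv (δ₂ i x) (δ₃ i x) (γ i x) (b i x) (h i) j l) := by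
  obtain ⟨c, hc, hle⟩ := hm.lower
  have d2 : ∀ {g}, Tame a β 1 g → Tame a β 1 (fun i x => g i x / δ₂ i x) := fun hg =>
    hg.div hm.tame₂ hc fun i x hx => (hle i x hx).1
  have d3 : ∀ {g}, Tame a β 1 g → Tame a β 1 (fun i x => g i x / δ₃ i x) := fun hg =>
    hg.div hm.tame₃ hc fun i x hx => (hle i x hx).2.1
  have d5 : ∀ {g}, Tame a β 1 g → Tame a β 1 (fun i x => g i x / (δ₃ i x + h i * b i x 4)) :=
    fun hg => hg.div (hm.tame₃.add (hm.tame_h.mul (hm.tameb 4))) hc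
      fun i x hx => (hle i x hx).2.2
  have z : Tame a β 1 (fun (_ : ι) (_ : ℝ) => (0 : ℂ)) := Tame.const' 0
  have o : Tame a β 1 (fun (_ : ι) (_ : ℝ) => (1 : ℂ)) := Tame.const' 1
  fin_cases j <;> fin_cases l
  any_goals exact z
  · exact d2 o
  · exact (d3 (d2 hm.tameγ)).neg
  · exact d3 o
  · exact d3 o
  · exact (d5 (hm.tame_h.mul (d2 ((hm.tameb 1).sub ((hm.tameb 2).mul (d3 hm.tameγ)))))).neg
  · exact (d5 (hm.tame_h.mul (d3 (hm.tameb 2)))).neg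
  · exact (d5 (hm.tame_h.mul (d3 (hm.tameb 3)))).neg
  · exact d5 o

theorem ne_zero (hm : ModelFamily a β h δ₂ δ₃ γ b) (i : ι) {x : ℝ} (hx : a ≤ x) :
    δ₂ i x ≠ 0 ∧ δ₃ i x ≠ 0 ∧ δ₃ i x + h i * b i x 4 ≠ 0 := by
  obtain ⟨c, hc, hle⟩ := hm.lower
  obtain ⟨h1, h2, h3⟩ := hle i x hx
  exact ⟨norm_pos_iff.1 (hc.trans_le h1), norm_pos_iff.1 (hc.trans_le h2),
    norm_pos_iff.1 (hc.trans_le h3)⟩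

/-- A decaying perturbation of first order has an eigenvector close to `modelVec`. -/
theorem exists_eigenvector (hm : ModelFamily a β h δ₂ δ₃ γ b) (ha : 0 ≤ a) (hβ : 0 < β)
    {N : ι → ℝ → Matrix (Fin 5) (Fin 5) ℂ} (hN : ∀ j l, UnifDecay a β (fun i x => N i x j l)) :
    ∃ K h₀ : ℝ, 0 < K ∧ 0 < h₀ ∧ ∀ i, h i ≤ h₀ → ∀ x, a ≤ x → ∃ t : Fin 5 → ℂ,
      ‖t‖ ≤ K * h i * Real.exp (-β * x) ∧ ∃ σ : ℂ,
        (modelMatrix (δ₂ i x) (δ₃ i x) (γ i x) (b i x) (h i) + (h i : ℂ) • N i x) *ᵥ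
          (modelVec (δ₃ i x) (b i x) (h i) + t) =
        σ • (modelVec (δ₃ i x) (b i x) (h i) + t) := by
  obtain ⟨CJ, hCJ, hJ⟩ := exists_forall_bdd (σ := Fin 5 × Fin 5)
    (F := fun p i x => modelInv (δ₂ i x) (δ₃ i x) (γ i x) (b i x) (h i) p.1 p.2)
    fun p => (hm.tame_inv p.1 p.2).bdd
  obtain ⟨V, hV, hVb⟩ := exists_forall_bdd fun j => (hm.tame_vec j).bdd
  obtain ⟨CN, hCN, hNb⟩ := exists_forall_decay (σ := Fin 5 × Fin 5) (fun p => hN p.1 p.2)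
  set κ : ℝ := 2 * (5 * CJ) * (5 * CN) * (V + 1) ^ 2 with hκ
  have hκ0 : 0 < κ := by positivity
  refine ⟨κ, 1 / (3 * κ), hκ0, by positivity, fun i hi x hx => ?_⟩
  have hpos := (hm.h_pos i).le
  have hexp : Real.exp (-β * x) ≤ 1 := Real.exp_le_one_iff.2 (by nlinarith)
  obtain ⟨n2, n3, n5⟩ := hm.ne_zero i hx
  have hsmall : 6 * (5 * CJ) * (5 * (h i * (CN * Real.exp (-β * x)))) * (V + 1) ^ 2 ≤ 1 := by
    have h1 : 6 * (5 * CJ) * (5 * (h i * (CN * Real.exp (-β * x)))) * (V + 1) ^ 2 =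
        3 * κ * (h i * Real.exp (-β * x)) := by rw [hκ]; ring
    rw [h1]
    calc 3 * κ * (h i * Real.exp (-β * x)) ≤ 3 * κ * (1 / (3 * κ) * 1) := by gcongr
      _ = 1 := by field_simp
  obtain ⟨t, ht, σ, hσ⟩ := exists_eigenvector_add (o := 0)
    (M := modelMatrix (δ₂ i x) (δ₃ i x) (γ i x) (b i x) (h i))
    (J := modelInv (δ₂ i x) (δ₃ i x) (γ i x) (b i x) (h i)) (E := (h i : ℂ) • N i x)
    (modelVec_zero _ _ _) (modelMatrix_mulVec_modelVec n5)
    (fun g hg => by rw [modelMatrix_mulVec_modelInv n2 n3 n5, hg]; simp)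
    (modelInv_mulVec_zero _ _ _ _ _) (by positivity) (by positivity)
    (fun g => by simpa using norm_mulVec_le hCJ.le (fun j l => hJ (j, l) i x hx) g)
    (fun g => by
      simpa using norm_mulVec_le (A := (h i : ℂ) • N i x)
        (C := h i * (CN * Real.exp (-β * x))) (by positivity) (fun j l => by
        rw [Matrix.smul_apply, norm_smul, norm_real, Real.norm_of_nonneg hpos]
        gcongr
        exact hNb (j, l) i x hx) g)
    ((pi_norm_le_iff_of_nonneg hV.le).2 fun j => hVb j i x hx) hsmall
  refine ⟨t, ht.trans (le_of_eq ?_), σ, hσ⟩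
  rw [hκ]
  ring

/-- The model system has a solution which differs from the null vector of its leading part by
`O(h e^{-βx})`. The first entry of the source `N v₀` is `O(h)`, since `N 0 0 = 0`; the other entries
are only `O(1)`, and a corrector of size `O(h e^{-βx})` removes them. -/
theorem exists_solution (hm : ModelFamily a β h δ₂ δ₃ γ b) (ha : 0 ≤ a) (hβ : 0 < β)
    {N : ι → ℝ → Matrix (Fin 5) (Fin 5) ℂ} (hNt : ∀ j l, Tame a β 1 (fun i x => N i x j l))
    (hN : ∀ j l, UnifDecay a β (fun i x => N i x j l)) (hN0 : ∀ i x, N i x 0 0 = 0) :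
    ∃ K : ℝ, 0 < K ∧ ∀ i, ∃ y : ℝ → Fin 5 → ℂ,
      (∀ x, a ≤ x → HasDerivWithinAt y ((1 / h i : ℂ) •
        (modelMatrix (δ₂ i x) (δ₃ i x) (γ i x) (b i x) (h i) *ᵥ y x) + N i x *ᵥ y x)
          (Ici a) x) ∧
      ∀ x, a ≤ x → ‖y x - modelVec (δ₃ i x) (b i x) (h i)‖ ≤ K * h i * Real.exp (-β * x) := by
  -- the last entry of the null vector is `-h q`
  obtain ⟨q', hq', hq'd, hq't⟩ := hm.tame_last.exists_deriv
  set q : ι → ℝ → ℂ := fun i x => (b i x 0) / (δ₃ i x + h i * b i x 4) with hq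
  set v : ι → ℝ → Fin 5 → ℂ := fun i x => modelVec (δ₃ i x) (b i x) (h i) with hv
  have hv5 : ∀ i x, v i x = ![1, 0, 0, 0, -(h i * q i x)] := by
    intro i x
    simp only [hv, modelVec, hq, mul_div_assoc]
  -- the corrector `h ξ` removes the part of the source that is not `O(h)`
  set ξ : ι → ℝ → Fin 5 → ℂ := fun i x =>
    -(modelInv (δ₂ i x) (δ₃ i x) (γ i x) (b i x) (h i) *ᵥ (N i x *ᵥ v i x)) with hξ
  have hNv : ∀ j, Tame a β 1 (fun i x => (N i x *ᵥ v i x) j) := fun j =>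
    Tame.sum _ fun l _ => (hNt j l).mul (hm.tame_vec l)
  have hNvd : ∀ j, UnifDecay a β (fun i x => (N i x *ᵥ v i x) j) := fun j =>
    UnifDecay.sum _ fun l _ => (hN j l).mul_bdd (hm.tame_vec l).bdd
  have hξt : ∀ j, Tame a β 1 (fun i x => ξ i x j) := fun j =>
    (Tame.sum _ fun l _ => (hm.tame_inv j l).mul (hNv l)).neg
  have hξd : ∀ j, UnifDecay a β (fun i x => ξ i x j) := fun j =>
    (UnifDecay.sum _ fun l _ => UnifDecay.bdd_mul (hm.tame_inv j l).bdd (hNvd l)).neg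
  choose ξ' hξ' hξ'd hξ't using fun j => (hξt j).exists_deriv
  set F : Fin 5 → ι → ℝ → ℂ := fun j i x =>
    (![-(N i x 0 4 * q i x), 0, 0, 0, q' i x] : Fin 5 → ℂ) j + (N i x *ᵥ ξ i x) j - ξ' j i x
    with hF
  have hqb : UnifBdd a q := hm.tame_last.bdd
  have hNξd : ∀ j, UnifDecay a β (fun i x => (N i x *ᵥ ξ i x) j) := fun j =>
    UnifDecay.sum _ fun l _ => (hN j l).mul_bdd (hξt l).bdd
  have hNξt : ∀ j, Tame a β 0 (fun i x => (N i x *ᵥ ξ i x) j) := fun j =>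
    Tame.sum _ fun l _ => ((hNt j l).mul (hξt l)).of_succ
  have hFd : ∀ j, UnifDecay a β (F j) := by
    intro j
    refine (UnifDecay.add ?_ (hNξd j)).sub (hξ'd j)
    fin_cases j
    · exact ((hN 0 4).mul_bdd hqb).neg
    · exact UnifDecay.zero
    · exact UnifDecay.zero
    · exact UnifDecay.zero
    · exact hq'd
  have hFt : ∀ j, Tame a β 0 (F j) := by
    intro j
    refine (Tame.add ?_ (hNξt j)).sub (hξ't j)
    fin_cases j
    · exact ((hNt 0 4).mul hm.tame_last).neg.of_succ
    · exact Tame.const' 0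
    · exact Tame.const' 0
    · exact Tame.const' 0
    · exact hq't
  obtain ⟨CF, hCF, hFb⟩ := exists_forall_decay hFd
  obtain ⟨CN, hCN, hNb⟩ := exists_forall_decay (σ := Fin 5 × Fin 5) (fun p => hN p.1 p.2)
  obtain ⟨Cξ, hCξ, hξb⟩ := exists_forall_decay hξd
  set k : ℝ := 5 * CN with hk
  refine ⟨Cξ + 2 * CF / β * Real.exp (2 * k / β), by positivity, fun i => ?_⟩
  have hpos := hm.h_pos i
  have hne : (h i : ℂ) ≠ 0 := ofReal_ne_zero.2 hpos.ne'
  set D : ℝ → Fin 5 → ℂ := fun x => ![0, δ₂ i x / h i, δ₃ i x / h i, δ₃ i x / h i,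
    δ₃ i x / h i + b i x 4] with hD
  set K₀ : ℝ → Matrix (Fin 5) (Fin 5) ℂ := fun x =>
    !![0, 0, 0, 0, 0;
       0, 0, 0, 0, 0;
       0, γ i x / h i, 0, 0, 0;
       0, 0, 0, 0, 0;
       b i x 0, b i x 1, b i x 2, b i x 3, 0] with hK₀
  have hDK : ∀ x (w : Fin 5 → ℂ) j, (1 / h i : ℂ) *
      (modelMatrix (δ₂ i x) (δ₃ i x) (γ i x) (b i x) (h i) *ᵥ w) j =
      D x j * w j + (K₀ x *ᵥ w) j := by
    intro x w j
    fin_cases j <;>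
      simp [modelMatrix, hD, hK₀, mulVec, dotProduct, Fin.sum_univ_five] <;> field_simp <;> ring
  have cdiv : ∀ {g : ι → ℝ → ℂ} {n}, Tame a β n g →
      ContinuousOn (fun x => g i x / (h i : ℂ)) (Ici a) := fun hg =>
    (hg.continuousOn i).div_const _
  have hDc : ∀ j, ContinuousOn (fun x => D x j) (Ici a) := by
    intro j
    fin_cases j
    · exact continuousOn_const
    · exact cdiv hm.tame₂
    · exact cdiv hm.tame₃
    · exact cdiv hm.tame₃
    · exact (cdiv hm.tame₃).add ((hm.tameb 4).continuousOn i)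
  have hK₀c : ∀ j l, ContinuousOn (fun x => K₀ x j l) (Ici a) := by
    intro j l
    fin_cases j <;> fin_cases l
    any_goals exact continuousOn_const
    · exact cdiv hm.tameγ
    · exact (hm.tameb 0).continuousOn i
    · exact (hm.tameb 1).continuousOn i
    · exact (hm.tameb 2).continuousOn i
    · exact (hm.tameb 3).continuousOn i
  have re_div : ∀ z : ℂ, (z / (h i : ℂ)).re = z.re / h i := fun z => div_ofReal_re z (h i)
  have hδ3 : ∀ x, a ≤ x → 0 ≤ (δ₃ i x).re := fun x hx => by
    have := hm.dom₃ i x hx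
    have := norm_nonneg (γ i x)
    linarith
  have hb4 : ∀ x, a ≤ x → 0 ≤ (b i x 4).re := fun x hx => by
    have := hm.dom₅ i x hx
    have : 0 ≤ ‖b i x 0‖ + ‖b i x 1‖ + ‖b i x 2‖ + ‖b i x 3‖ := by positivity
    linarith
  have hDre : ∀ x, a ≤ x → ∀ j, 0 ≤ (D x j).re := by
    intro x hx j
    have h2 := hm.re₂ i x hx
    have h3 := hδ3 x hx
    have h4 := hb4 x hx
    fin_cases j
    · simp [hD]
    · simp only [hD]
      change 0 ≤ (δ₂ i x / (h i : ℂ)).re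
      rw [re_div]; positivity
    · change 0 ≤ (δ₃ i x / (h i : ℂ)).re
      rw [re_div]; positivity
    · change 0 ≤ (δ₃ i x / (h i : ℂ)).re
      rw [re_div]; positivity
    · change 0 ≤ (δ₃ i x / (h i : ℂ) + b i x 4).re
      rw [add_re, re_div]; positivity
  have hK₀le : ∀ x, a ≤ x → ∀ j, ∑ l, ‖K₀ x j l‖ ≤ (D x j).re / 2 := by
    intro x hx j
    have h3 := hδ3 x hx
    have h2 := div_nonneg (hDre x hx j) zero_le_two
    fin_cases j
    · simp [hK₀, hD, Fin.sum_univ_five]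
    · simpa [hK₀, Fin.sum_univ_five] using h2
    · have h5 := hm.dom₃ i x hx
      have h6 : (D x 2).re = (δ₃ i x).re / h i := re_div _
      have h7 : ‖γ i x / (h i : ℂ)‖ = ‖γ i x‖ / h i := by
        rw [norm_div, norm_real, Real.norm_of_nonneg hpos.le]
      have h8 : ∑ l, ‖K₀ x 2 l‖ = ‖γ i x / (h i : ℂ)‖ := by
        simp [hK₀, Fin.sum_univ_five]
      change ∑ l, ‖K₀ x 2 l‖ ≤ (D x 2).re / 2
      rw [h8, h7, h6, div_right_comm]
      gcongr
    · simpa [hK₀, Fin.sum_univ_five] using h2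
    · have h5 := hm.dom₅ i x hx
      have h6 : (D x 4).re = (δ₃ i x).re / h i + (b i x 4).re := by
        change (δ₃ i x / (h i : ℂ) + b i x 4).re = _
        rw [add_re, re_div]
      have h8 : ∑ l, ‖K₀ x 4 l‖ = ‖b i x 0‖ + ‖b i x 1‖ + ‖b i x 2‖ + ‖b i x 3‖ := by
        simp [hK₀, Fin.sum_univ_five]
      change ∑ l, ‖K₀ x 4 l‖ ≤ (D x 4).re / 2
      rw [h8, h6]
      have : 0 ≤ (δ₃ i x).re / h i := by positivity
      linarith
  obtain ⟨η, hη, hηb⟩ := exists_decaying_solution (k := k) (F := CF * h i) ha hβ (by positivity)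
    (by positivity) (D := D) (K := fun x => K₀ x + N i x) (f := fun x j => h i * F j i x) hDc
    (fun j l => (hK₀c j l).add ((hNt j l).continuousOn i))
    (fun j => continuousOn_const.mul ((hFt j).continuousOn i)) hDre
    (fun x hx j => by
      have h1 : ∑ l, ‖N i x j l‖ ≤ k * Real.exp (-β * x) := by
        calc ∑ l, ‖N i x j l‖ ≤ ∑ _l : Fin 5, CN * Real.exp (-β * x) :=
              Finset.sum_le_sum fun l _ => hNb (j, l) i x hx
          _ = k * Real.exp (-β * x) := by
              rw [Finset.sum_const, Finset.card_univ, Fintype.card_fin, nsmul_eq_mul, hk]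
              push_cast
              ring
      calc ∑ l, ‖(K₀ x + N i x) j l‖ ≤ ∑ l, (‖K₀ x j l‖ + ‖N i x j l‖) :=
            Finset.sum_le_sum fun l _ => norm_add_le _ _
        _ ≤ _ := by
            rw [Finset.sum_add_distrib]
            exact add_le_add (hK₀le x hx j) h1)
    (fun x hx j => by
      rw [norm_mul, norm_real, Real.norm_of_nonneg hpos.le]
      calc h i * ‖F j i x‖ ≤ h i * (CF * Real.exp (-β * x)) := by gcongr; exact hFb j i x hx
        _ = _ := by ring)
  refine ⟨fun x => v i x + (h i : ℂ) • ξ i x + η x, fun x hx => ?_, fun x hx => ?_⟩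
  · rw [hasDerivWithinAt_pi]
    intro j
    obtain ⟨n2, n3, n5⟩ := hm.ne_zero i hx
    have hvd : HasDerivWithinAt (fun x => v i x j)
        ((![0, 0, 0, 0, -(h i * q' i x)] : Fin 5 → ℂ) j) (Ici a) x := by
      simp only [hv5]
      fin_cases j
      · exact hasDerivWithinAt_const _ _ _
      · exact hasDerivWithinAt_const _ _ _
      · exact hasDerivWithinAt_const _ _ _
      · exact hasDerivWithinAt_const _ _ _
      · exact ((hq' i x hx).const_mul _).fun_neg
    refine ((hvd.fun_add ((hξ' j i x hx).const_mul (h i : ℂ))).fun_add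
      (hη x hx j)).congr_deriv ?_
    have hMv := modelMatrix_mulVec_modelVec (δ₂ := δ₂ i x) (γ := γ i x) n5
    have hMξ : (modelMatrix (δ₂ i x) (δ₃ i x) (γ i x) (b i x) (h i) *ᵥ ξ i x) =
        -(N i x *ᵥ v i x - Pi.single 0 ((N i x *ᵥ v i x) 0)) := by
      simp only [hξ]
      rw [mulVec_neg, modelMatrix_mulVec_modelInv n2 n3 n5]
    have hNv0 : (N i x *ᵥ v i x) 0 = -(h i * (N i x 0 4 * q i x)) := by
      rw [hv5]
      simp [mulVec, dotProduct, Fin.sum_univ_five, hN0]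
      ring
    have hv0 : modelMatrix (δ₂ i x) (δ₃ i x) (γ i x) (b i x) (h i) *ᵥ v i x = 0 := hMv
    simp only [mulVec_add, mulVec_smul, hv0, hMξ, hNv0, Pi.add_apply, Pi.smul_apply, smul_eq_mul,
      smul_add, zero_add, Pi.neg_apply, Pi.sub_apply, hDK x (η x) j, add_mulVec, hF]
    have hc : (1 / h i : ℂ) * h i = 1 := by field_simp
    fin_cases j <;> simp <;> field_simp <;> ring
  · have h1 : (v i x + (h i : ℂ) • ξ i x + η x) - modelVec (δ₃ i x) (b i x) (h i) =
        (h i : ℂ) • ξ i x + η x := by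
      simp only [hv]
      abel
    have hξn : ‖ξ i x‖ ≤ Cξ * Real.exp (-β * x) :=
      (pi_norm_le_iff_of_nonneg (by positivity)).2 fun j => hξb j i x hx
    rw [h1]
    calc ‖(h i : ℂ) • ξ i x + η x‖ ≤ ‖(h i : ℂ) • ξ i x‖ + ‖η x‖ := norm_add_le _ _
      _ ≤ h i * (Cξ * Real.exp (-β * x)) +
          2 * (CF * h i) / β * Real.exp (2 * k / β) * Real.exp (-β * x) := by
          refine add_le_add ?_ (hηb x hx)
          rw [norm_smul, norm_real, Real.norm_of_nonneg hpos.le]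
          gcongr
      _ = _ := by ring

end ModelFamily

/-! ### The profile -/

section partial_derivatives

variable {dom : Set (ℝ × ℝ × ℝ)} {F : ℝ × ℝ × ℝ → ℝ} {z : ℝ × ℝ × ℝ}

theorem hasDerivAt_pdv (hF : DifferentiableAt ℝ F z) :
    HasDerivAt (fun t => F (t, z.2.1, z.2.2)) (fderiv ℝ F z (1, 0, 0)) z.1 :=
  hF.hasFDerivAt.comp_hasDerivAt_of_eq z.1
    ((hasDerivAt_id z.1).prodMk (hasDerivAt_const z.1 (z.2.1, z.2.2))) rfl

theorem hasDerivAt_pdS (hF : DifferentiableAt ℝ F z) :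
    HasDerivAt (fun t => F (z.1, t, z.2.2)) (fderiv ℝ F z (0, 1, 0)) z.2.1 :=
  hF.hasFDerivAt.comp_hasDerivAt_of_eq z.2.1
    ((hasDerivAt_const z.2.1 z.1).prodMk
      ((hasDerivAt_id z.2.1).prodMk (hasDerivAt_const z.2.1 z.2.2))) rfl

theorem hasDerivAt_pdlam (hF : DifferentiableAt ℝ F z) :
    HasDerivAt (fun t => F (z.1, z.2.1, t)) (fderiv ℝ F z (0, 0, 1)) z.2.2 :=
  hF.hasFDerivAt.comp_hasDerivAt_of_eq z.2.2
    ((hasDerivAt_const z.2.2 z.1).prodMk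
      ((hasDerivAt_const z.2.2 z.2.1).prodMk (hasDerivAt_id z.2.2))) rfl

theorem pdv_eq (hF : DifferentiableAt ℝ F z) : pdv F z = fderiv ℝ F z (1, 0, 0) :=
  (hasDerivAt_pdv hF).deriv

theorem pdS_eq (hF : DifferentiableAt ℝ F z) : pdS F z = fderiv ℝ F z (0, 1, 0) :=
  (hasDerivAt_pdS hF).deriv

theorem pdlam_eq (hF : DifferentiableAt ℝ F z) : pdlam F z = fderiv ℝ F z (0, 0, 1) :=
  (hasDerivAt_pdlam hF).deriv

theorem fderiv_apply_eq (hF : DifferentiableAt ℝ F z) (a b c : ℝ) :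
    fderiv ℝ F z (a, b, c) = pdv F z * a + pdS F z * b + pdlam F z * c := by
  have h : ((a, b, c) : ℝ × ℝ × ℝ) =
      a • ((1, 0, 0) : ℝ × ℝ × ℝ) + b • ((0, 1, 0) : ℝ × ℝ × ℝ) +
        c • ((0, 0, 1) : ℝ × ℝ × ℝ) := by simp
  rw [h, map_add, map_add, map_smul, map_smul, map_smul, ← pdv_eq hF, ← pdS_eq hF,
    ← pdlam_eq hF]
  simp only [smul_eq_mul]
  ring

theorem analytic_fderiv_apply (hF : AnalyticOnNhd ℝ F dom) (e : ℝ × ℝ × ℝ) :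
    AnalyticOnNhd ℝ (fun z => fderiv ℝ F z e) dom := fun z hz =>
  ((ContinuousLinearMap.apply ℝ ℝ e).analyticAt _).comp (hF.fderiv z hz)

theorem analytic_pdv (ho : IsOpen dom) (hF : AnalyticOnNhd ℝ F dom) :
    AnalyticOnNhd ℝ (pdv F) dom :=
  (analytic_fderiv_apply hF (1, 0, 0)).congr ho fun z hz =>
    (pdv_eq (hF z hz).differentiableAt).symm

theorem analytic_pdS (ho : IsOpen dom) (hF : AnalyticOnNhd ℝ F dom) :
    AnalyticOnNhd ℝ (pdS F) dom :=
  (analytic_fderiv_apply hF (0, 1, 0)).congr ho fun z hz =>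
    (pdS_eq (hF z hz).differentiableAt).symm

theorem analytic_pdlam (ho : IsOpen dom) (hF : AnalyticOnNhd ℝ F dom) :
    AnalyticOnNhd ℝ (pdlam F) dom :=
  (analytic_fderiv_apply hF (0, 0, 1)).congr ho fun z hz =>
    (pdlam_eq (hF z hz).differentiableAt).symm

end partial_derivatives

theorem Thermo.analytic_entropySource (th : Thermo) :
    AnalyticOnNhd ℝ th.entropySource th.dom := fun z hz =>
  ((th.analytic_r z hz).mul (th.analytic_dF z hz)).neg.div (th.analytic_temp z hz)
    (th.temp_pos z hz).ne'

theorem Thermo.RateAssumption.entropySource_eq {th : Thermo} (hr : th.RateAssumption)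
    {z : ℝ × ℝ × ℝ} (hz : z ∈ th.dom) (h0 : z.2.2 = 0) :
    th.entropySource z = 0 ∧ pdv th.entropySource z = 0 ∧ pdS th.entropySource z = 0 := by
  have r0 := hr.r_eq z hz h0
  have dr := (th.analytic_r z hz).differentiableAt
  have dd := (th.analytic_dF z hz).differentiableAt
  have dT := (th.analytic_temp z hz).differentiableAt
  have hT := (th.temp_pos z hz).ne'
  refine ⟨by simp [Thermo.entropySource, r0], ?_, ?_⟩
  · have h1 := hasDerivAt_pdv dr
    rw [← pdv_eq dr, hr.rv_eq z hz h0] at h1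
    have h2 := ((h1.mul (hasDerivAt_pdv dd)).neg.div (hasDerivAt_pdv dT) hT).deriv
    refine h2.trans ?_
    simp [r0]
  · have h1 := hasDerivAt_pdS dr
    rw [← pdS_eq dr, hr.rS_eq z hz h0] at h1
    have h2 := ((h1.mul (hasDerivAt_pdS dd)).neg.div (hasDerivAt_pdS dT) hT).deriv
    refine h2.trans ?_
    simp [r0]

/-- A continuous function on `[0, ∞)` that is positive, with a positive limit, is bounded below
by a positive constant. -/
theorem exists_pos_le_of_tendsto {f : ℝ → ℝ} {l : ℝ} (hf : ContinuousOn f (Ici 0))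
    (hpos : ∀ x, 0 ≤ x → 0 < f x) (hl : 0 < l) (hlim : Filter.Tendsto f Filter.atTop (nhds l)) :
    ∃ c : ℝ, 0 < c ∧ ∀ x, 0 ≤ x → c ≤ f x := by
  obtain ⟨X, hX⟩ := Filter.eventually_atTop.1 (hlim.eventually (lt_mem_nhds (half_lt_self hl)))
  obtain ⟨y, hy, hmin⟩ := (isCompact_Icc (a := (0 : ℝ)) (b := max X 0)).exists_isMinOn
    ⟨0, left_mem_Icc.2 (le_max_right _ _)⟩ (hf.mono Icc_subset_Ici_self)
  refine ⟨min (f y) (l / 2), lt_min (hpos y hy.1) (half_pos hl), fun x hx => ?_⟩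
  rcases le_total x (max X 0) with h | h
  · exact (min_le_left _ _).trans (hmin ⟨hx, h⟩)
  · exact (min_le_right _ _).trans (hX x ((le_max_left _ _).trans h)).le

namespace Profile.IsReactionZone

variable {th : Thermo} {w : Profile} {β : ℝ}

theorem hasDerivAt_state (hw : w.IsReactionZone th β) {x : ℝ} (hx : 0 ≤ x) :
    HasDerivAt w.state (deriv w.v x, deriv w.S x, deriv w.lam x) x :=
  (hw.analytic_v x hx).differentiableAt.hasDerivAt.prodMk
    ((hw.analytic_S x hx).differentiableAt.hasDerivAt.prodMk
      (hw.analytic_lam x hx).differentiableAt.hasDerivAt)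

theorem hasDerivAt_comp_state (hw : w.IsReactionZone th β) {F : ℝ × ℝ × ℝ → ℝ}
    (hF : AnalyticOnNhd ℝ F th.dom) {x : ℝ} (hx : 0 ≤ x) :
    HasDerivAt (fun y => F (w.state y)) (pdv F (w.state x) * deriv w.v x +
      pdS F (w.state x) * deriv w.S x + pdlam F (w.state x) * deriv w.lam x) x := by
  have hd := (hF _ (hw.state_mem x hx)).differentiableAt
  have := hd.hasFDerivAt.comp_hasDerivAt x (hw.hasDerivAt_state hx)
  rwa [fderiv_apply_eq hd] at this

/-- An analytic function of the state converges at the rate `β`. -/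
theorem exists_decay (hw : w.IsReactionZone th β) : ∃ zInf : ℝ × ℝ × ℝ, zInf ∈ th.dom ∧
    zInf.2.2 = 0 ∧ ∀ F : ℝ × ℝ × ℝ → ℝ, AnalyticOnNhd ℝ F th.dom →
      ∃ C : ℝ, ∀ x, 0 ≤ x → |F (w.state x) - F zInf| ≤ C * Real.exp (-β * x) := by
  obtain ⟨C, vI, uI, SI, hmem, hdec⟩ := hw.decay
  refine ⟨(vI, SI, 0), hmem, rfl, fun F hF => ?_⟩
  have hβ := hw.beta_pos
  have hlin : Filter.Tendsto (fun x : ℝ => -β * x) Filter.atTop Filter.atBot :=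
    Filter.tendsto_id.const_mul_atTop_of_neg (neg_neg_of_pos hβ)
  have hst : ∀ x, 0 ≤ x → ‖w.state x - (vI, SI, 0)‖ ≤ C * Real.exp (-β * x) := by
    intro x hx
    obtain ⟨h1, -, h3, h4⟩ := hdec x hx
    refine max_le h1 (max_le h3 ?_)
    change |w.lam x - 0| ≤ _
    rwa [sub_zero]
  have hlim0 : Filter.Tendsto (fun x : ℝ => C * Real.exp (-β * x)) Filter.atTop (nhds 0) := by
    simpa using (Real.tendsto_exp_atBot.comp hlin).const_mul C
  have hlim : Filter.Tendsto w.state Filter.atTop (nhds (vI, SI, 0)) := by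
    rw [tendsto_iff_norm_sub_tendsto_zero]
    refine squeeze_zero' (Filter.Eventually.of_forall fun x => norm_nonneg _) ?_ hlim0
    filter_upwards [Filter.eventually_ge_atTop 0] with x hx using hst x hx
  have hbig := (hF _ hmem).differentiableAt.isBigO_sub.comp_tendsto hlim
  obtain ⟨L, hL0, hL⟩ := hbig.exists_pos
  obtain ⟨X, hX⟩ := Filter.eventually_atTop.1 hL.bound
  have hcont : ContinuousOn (fun x => F (w.state x)) (Ici 0) := fun x hx =>
    (hw.hasDerivAt_comp_state hF hx).continuousAt.continuousWithinAt
  obtain ⟨M, hM⟩ := (isCompact_Icc (a := (0 : ℝ)) (b := max X 0)).exists_bound_of_continuousOn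
    ((hcont.sub (continuousOn_const (c := F (vI, SI, 0)))).mono Icc_subset_Ici_self)
  have hM0 : 0 ≤ M := (norm_nonneg _).trans (hM 0 (left_mem_Icc.2 (le_max_right _ _)))
  refine ⟨L * C + M * Real.exp (β * max X 0), fun x hx => ?_⟩
  have hC0 : 0 ≤ C * Real.exp (-β * x) := (norm_nonneg _).trans (hst x hx)
  rw [add_mul]
  rcases le_total x (max X 0) with h | h
  · have h1 : |F (w.state x) - F (vI, SI, 0)| ≤ M := hM x ⟨hx, h⟩
    have h2 : M * 1 ≤ M * Real.exp (β * max X 0) * Real.exp (-β * x) := by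
      rw [mul_assoc, ← Real.exp_add]
      gcongr
      exact Real.one_le_exp (by nlinarith)
    have h3 : 0 ≤ L * C * Real.exp (-β * x) := by rw [mul_assoc]; positivity
    linarith
  · have h1 : |F (w.state x) - F (vI, SI, 0)| ≤ L * ‖w.state x - (vI, SI, 0)‖ :=
      hX x ((le_max_left _ _).trans h)
    have h2 : L * ‖w.state x - (vI, SI, 0)‖ ≤ L * C * Real.exp (-β * x) := by
      rw [mul_assoc]
      gcongr
      exact hst x hx
    have h3 : 0 ≤ M * Real.exp (β * max X 0) * Real.exp (-β * x) := by positivity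
    linarith

theorem c0_pos (hw : w.IsReactionZone th β) {x : ℝ} (hx : 0 ≤ x) : 0 < w.c0 th x := by
  obtain ⟨C₁, C₂, h1, -, hb⟩ := hw.bounds
  have hκ : 0 < w.kappa th x := h1.trans_le (hb x hx).1.1
  refine (Real.sqrt_nonneg _).lt_of_ne fun h => ?_
  rw [kappa, show w.c0 th x = 0 from h.symm, div_zero] at hκ
  exact lt_irrefl _ hκ

theorem c0_sq (hw : w.IsReactionZone th β) {x : ℝ} (hx : 0 ≤ x) :
    w.c0 th x ^ 2 = -(w.v x) ^ 2 * pdv th.p (w.state x) := by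
  have h := hw.c0_pos hx
  exact Real.sq_sqrt (Real.sqrt_pos.1 h).le

theorem u_pos (hw : w.IsReactionZone th β) {x : ℝ} (hx : 0 ≤ x) : 0 < w.u x := by
  obtain ⟨C₁, C₂, h1, -, hb⟩ := hw.bounds
  exact h1.trans_le (hb x hx).2.1

theorem pdv_p_eq (hw : w.IsReactionZone th β) {x : ℝ} (hx : 0 ≤ x) :
    pdv th.p (w.state x) = -(w.c0 th x ^ 2 / w.v x ^ 2) := by
  rw [hw.c0_sq hx]
  have := (hw.v_pos x hx).ne'
  field_simp

/-- The uniform bounds of the profile, in terms of `v`, `u` and the sound speed. -/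
theorem exists_bounds (hw : w.IsReactionZone th β) : ∃ c : ℝ, 0 < c ∧ ∀ x, 0 ≤ x →
    c ≤ w.u x ∧ w.u x ≤ 1 ∧ c ≤ w.c0 th x ∧ c ≤ w.c0 th x ^ 2 - w.u x ^ 2 := by
  obtain ⟨C₁, C₂, h1, h2, hb⟩ := hw.bounds
  have h12 : C₁ ≤ C₂ := (hb 0 le_rfl).1.1.trans (hb 0 le_rfl).1.2
  have hC2 : 0 < C₂ := h1.trans_le h12
  refine ⟨min C₁ (C₁ ^ 2 * (1 - C₂ ^ 2)), lt_min h1 (by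
    have : 0 < 1 - C₂ ^ 2 := by nlinarith
    positivity), fun x hx => ?_⟩
  obtain ⟨⟨k1, k2⟩, u1, u2⟩ := hb x hx
  have hc := hw.c0_pos hx
  have hu := hw.u_pos hx
  have hle : w.u x ≤ C₂ * w.c0 th x := (div_le_iff₀ hc).1 k2
  have huc : w.u x ≤ w.c0 th x := by nlinarith
  refine ⟨(min_le_left _ _).trans u1, by linarith, (min_le_left _ _).trans (u1.trans huc),
    (min_le_right _ _).trans ?_⟩
  have h3 : w.u x ^ 2 ≤ C₂ ^ 2 * w.c0 th x ^ 2 := by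
    rw [← mul_pow]
    exact pow_le_pow_left₀ hu.le hle 2
  have h4 : C₁ ^ 2 ≤ w.c0 th x ^ 2 := pow_le_pow_left₀ h1.le (u1.trans huc) 2
  have h5 : 0 ≤ 1 - C₂ ^ 2 := by nlinarith
  nlinarith

/-- The mass flux is constant. -/
theorem exists_mflux (hw : w.IsReactionZone th β) :
    ∃ m : ℝ, 0 < m ∧ ∀ x, 0 ≤ x → w.u x = m * w.v x ∧ deriv w.u x = m * deriv w.v x := by
  have hd : ∀ x, 0 ≤ x → HasDerivAt (fun y => w.u y / w.v y) 0 x := by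
    intro x hx
    have h1 := (hw.analytic_u x hx).differentiableAt.hasDerivAt.fun_div
      (hw.analytic_v x hx).differentiableAt.hasDerivAt (hw.v_pos x hx).ne'
    refine h1.congr_deriv ?_
    rw [div_eq_zero_iff]
    left
    linarith [hw.mass x hx]
  have hconst : ∀ x, 0 ≤ x → w.u x / w.v x = w.u 0 / w.v 0 := by
    intro x hx
    refine constant_of_has_deriv_right_zero (a := 0) (b := x)
      (fun y hy => (hd y hy.1).continuousAt.continuousWithinAt)
      (fun y hy => (hd y hy.1).hasDerivWithinAt) x ⟨hx, le_rfl⟩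
  refine ⟨w.u 0 / w.v 0, div_pos (hw.u_pos le_rfl) (hw.v_pos 0 le_rfl), fun x hx => ?_⟩
  have hv := (hw.v_pos x hx).ne'
  rw [← hconst x hx]
  refine ⟨by field_simp, ?_⟩
  have := hw.mass x hx
  field_simp
  linarith

end Profile.IsReactionZone

namespace Profile.IsReactionZone

variable {th : Thermo} {w : Profile} {β a : ℝ} {ι : Type*}

theorem unifDecay_of_eq_zero (hw : w.IsReactionZone th β) {F : ℝ × ℝ × ℝ → ℝ}
    (hF : AnalyticOnNhd ℝ F th.dom) (h0 : ∀ z ∈ th.dom, z.2.2 = 0 → F z = 0) :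
    UnifDecay 0 β (fun (_ : ι) x => ((F (w.state x) : ℝ) : ℂ)) := by
  obtain ⟨z, hz, hz0, h⟩ := hw.exists_decay
  obtain ⟨C, hC⟩ := h F hF
  refine ⟨C, fun _ x hx => ?_⟩
  rw [norm_real, Real.norm_eq_abs]
  simpa [h0 z hz hz0] using hC x hx

theorem unifBdd_comp_state (hw : w.IsReactionZone th β) {F : ℝ × ℝ × ℝ → ℝ}
    (hF : AnalyticOnNhd ℝ F th.dom) :
    UnifBdd 0 (fun (_ : ι) x => ((F (w.state x) : ℝ) : ℂ)) := by
  obtain ⟨z, hz, hz0, h⟩ := hw.exists_decay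
  obtain ⟨C, hC⟩ := h F hF
  refine ⟨|C| + |F z|, fun _ x hx => ?_⟩
  rw [norm_real, Real.norm_eq_abs]
  have h1 : Real.exp (-β * x) ≤ 1 := Real.exp_le_one_iff.2 (by nlinarith [hw.beta_pos])
  have h2 : C * Real.exp (-β * x) ≤ |C| * 1 := by
    refine mul_le_mul (le_abs_self C) h1 (Real.exp_pos _).le (abs_nonneg C)
  have h3 : |F (w.state x)| ≤ |F (w.state x) - F z| + |F z| := by
    simpa using abs_add_le (F (w.state x) - F z) (F z)
  linarith [hC x hx]

theorem exists_pos_le_comp_state (hw : w.IsReactionZone th β) {F : ℝ × ℝ × ℝ → ℝ}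
    (hF : AnalyticOnNhd ℝ F th.dom) (hpos : ∀ z ∈ th.dom, 0 < F z) :
    ∃ c : ℝ, 0 < c ∧ ∀ x, 0 ≤ x → c ≤ F (w.state x) := by
  obtain ⟨z, hz, -, h⟩ := hw.exists_decay
  obtain ⟨C, hC⟩ := h F hF
  refine exists_pos_le_of_tendsto (l := F z)
    (fun x hx => (hw.hasDerivAt_comp_state hF hx).continuousAt.continuousWithinAt)
    (fun x hx => hpos _ (hw.state_mem x hx)) (hpos z hz) ?_
  rw [tendsto_iff_norm_sub_tendsto_zero]
  have hlin : Filter.Tendsto (fun x : ℝ => -β * x) Filter.atTop Filter.atBot :=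
    Filter.tendsto_id.const_mul_atTop_of_neg (neg_neg_of_pos hw.beta_pos)
  have hlim0 : Filter.Tendsto (fun x : ℝ => C * Real.exp (-β * x)) Filter.atTop (nhds 0) := by
    simpa using (Real.tendsto_exp_atBot.comp hlin).const_mul C
  refine squeeze_zero' (Filter.Eventually.of_forall fun x => norm_nonneg _) ?_ hlim0
  filter_upwards [Filter.eventually_ge_atTop 0] with x hx using hC x hx

theorem deriv_S_eq (hw : w.IsReactionZone th β) {x : ℝ} (hx : 0 ≤ x) :
    deriv w.S x = th.entropySource (w.state x) / w.u x := by
  rw [eq_div_iff (hw.u_pos hx).ne', mul_comm]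
  exact hw.entropy x hx

theorem deriv_lam_eq (hw : w.IsReactionZone th β) {x : ℝ} (hx : 0 ≤ x) :
    deriv w.lam x = th.r (w.state x) / w.u x := by
  rw [eq_div_iff (hw.u_pos hx).ne', mul_comm]
  exact hw.reaction x hx

theorem deriv_v_eq (hw : w.IsReactionZone th β) {x : ℝ} (hx : 0 ≤ x) :
    deriv w.v x = w.v x ^ 2 * (pdS th.p (w.state x) * deriv w.S x +
      pdlam th.p (w.state x) * deriv w.lam x) / (w.c0 th x ^ 2 - w.u x ^ 2) := by
  obtain ⟨c, hc, hb⟩ := hw.exists_bounds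
  have hne : w.c0 th x ^ 2 - w.u x ^ 2 ≠ 0 := (hc.trans_le (hb x hx).2.2.2).ne'
  have hmom := hw.momentum x hx
  rw [(hw.hasDerivAt_comp_state th.analytic_p hx).deriv] at hmom
  have hmass := hw.mass x hx
  rw [eq_div_iff hne, hw.c0_sq hx]
  linear_combination (-w.u x) * hmass - w.v x * hmom

/-- The derivatives of the state are rational expressions in analytic functions of the state, that
vanish at equilibrium. -/
theorem tame_derivs (hw : w.IsReactionZone th β) (hr : th.RateAssumption) {n : ℕ}
    (hF : ∀ F : ℝ × ℝ × ℝ → ℝ, AnalyticOnNhd ℝ F th.dom →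
      Tame 0 β n (fun (_ : ι) x => ((F (w.state x) : ℝ) : ℂ))) :
    Tame 0 β n (fun (_ : ι) x => ((w.u x : ℝ) : ℂ)) ∧
    (Tame 0 β n (fun (_ : ι) x => ((deriv w.v x : ℝ) : ℂ)) ∧
      UnifDecay 0 β (fun (_ : ι) x => ((deriv w.v x : ℝ) : ℂ))) ∧
    (Tame 0 β n (fun (_ : ι) x => ((deriv w.S x : ℝ) : ℂ)) ∧
      UnifDecay 0 β (fun (_ : ι) x => ((deriv w.S x : ℝ) : ℂ))) ∧
    (Tame 0 β n (fun (_ : ι) x => ((deriv w.lam x : ℝ) : ℂ)) ∧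
      UnifDecay 0 β (fun (_ : ι) x => ((deriv w.lam x : ℝ) : ℂ))) := by
  obtain ⟨m, -, hm⟩ := hw.exists_mflux
  obtain ⟨c, hc, hb⟩ := hw.exists_bounds
  have hv : Tame 0 β n (fun (_ : ι) x => ((w.v x : ℝ) : ℂ)) := hF _ fun z _ => analyticAt_fst
  have hu : Tame 0 β n (fun (_ : ι) x => ((w.u x : ℝ) : ℂ)) :=
    ((Tame.const' (m : ℂ)).mul hv).congr fun _ x hx => by rw [(hm x hx).1]; push_cast; rfl
  have hui : Tame 0 β n (fun (_ : ι) x => ((w.u x : ℝ) : ℂ)⁻¹) := hu.inv hc fun _ x hx => by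
    rw [norm_real, Real.norm_of_nonneg (hw.u_pos hx).le]
    exact (hb x hx).1
  have hS : ∀ (_ : ι) x, 0 ≤ x → ((deriv w.S x : ℝ) : ℂ) =
      ((th.entropySource (w.state x) : ℝ) : ℂ) * ((w.u x : ℝ) : ℂ)⁻¹ := fun _ x hx => by
    rw [hw.deriv_S_eq hx]; push_cast; rw [div_eq_mul_inv]
  have hl : ∀ (_ : ι) x, 0 ≤ x → ((deriv w.lam x : ℝ) : ℂ) =
      ((th.r (w.state x) : ℝ) : ℂ) * ((w.u x : ℝ) : ℂ)⁻¹ := fun _ x hx => by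
    rw [hw.deriv_lam_eq hx]; push_cast; rw [div_eq_mul_inv]
  have tS := ((hF _ th.analytic_entropySource).mul hui).congr hS
  have tl := ((hF _ th.analytic_r).mul hui).congr hl
  have dS := ((hw.unifDecay_of_eq_zero (ι := ι) th.analytic_entropySource
    fun z hz h0 => (hr.entropySource_eq hz h0).1).mul_bdd hui.bdd).congr hS
  have dl := ((hw.unifDecay_of_eq_zero (ι := ι) th.analytic_r hr.r_eq).mul_bdd hui.bdd).congr hl
  have hpS := hF _ (analytic_pdS th.isOpen_dom th.analytic_p)
  have hpl := hF _ (analytic_pdlam th.isOpen_dom th.analytic_p)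
  have hcc : Tame 0 β n (fun (_ : ι) x => ((w.c0 th x ^ 2 : ℝ) : ℂ)) :=
    ((hv.pow 2).mul (hF _ (analytic_pdv th.isOpen_dom th.analytic_p))).neg.congr
      fun _ x hx => by rw [hw.c0_sq hx]; push_cast; ring
  have hden : Tame 0 β n (fun (_ : ι) x => (((w.c0 th x ^ 2 : ℝ) : ℂ) - (w.u x : ℂ) ^ 2)⁻¹) :=
    (hcc.sub (hu.pow 2)).inv hc fun _ x hx => by
      have h1 : ((w.c0 th x ^ 2 : ℝ) : ℂ) - (w.u x : ℂ) ^ 2 =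
          ((w.c0 th x ^ 2 - w.u x ^ 2 : ℝ) : ℂ) := by push_cast; ring
      rw [h1, norm_real]
      exact (hb x hx).2.2.2.trans (le_abs_self _)
  have hvd : ∀ (_ : ι) x, 0 ≤ x → ((deriv w.v x : ℝ) : ℂ) =
      (((pdS th.p (w.state x) : ℝ) : ℂ) * ((deriv w.S x : ℝ) : ℂ) +
        ((pdlam th.p (w.state x) : ℝ) : ℂ) * ((deriv w.lam x : ℝ) : ℂ)) *
      ((w.v x : ℂ) ^ 2 * (((w.c0 th x ^ 2 : ℝ) : ℂ) - (w.u x : ℂ) ^ 2)⁻¹) := fun _ x hx => by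
    rw [hw.deriv_v_eq hx]; push_cast; rw [div_eq_mul_inv]; ring
  refine ⟨hu, ⟨?_, ?_⟩, ⟨tS, dS⟩, tl, dl⟩
  · exact (((hpS.mul tS).add (hpl.mul tl)).mul ((hv.pow 2).mul hden)).congr hvd
  · exact (((UnifDecay.bdd_mul hpS.bdd dS).add (UnifDecay.bdd_mul hpl.bdd dl)).mul_bdd
      ((hv.pow 2).mul hden).bdd).congr hvd

/-- Along the profile, analytic functions of the state are tame of every order. -/
theorem tame_comp_state (hw : w.IsReactionZone th β) (hr : th.RateAssumption) (n : ℕ)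
    (F : ℝ × ℝ × ℝ → ℝ) (hF : AnalyticOnNhd ℝ F th.dom) :
    Tame 0 β n (fun (_ : ι) x => ((F (w.state x) : ℝ) : ℂ)) := by
  induction n generalizing F with
  | zero =>
    exact ⟨hw.unifBdd_comp_state hF, fun _ x hx =>
      (continuous_ofReal.continuousAt.comp
        (hw.hasDerivAt_comp_state hF hx).continuousAt).continuousWithinAt⟩
  | succ n ih =>
    obtain ⟨-, ⟨tv, dv⟩, ⟨tS, dS⟩, tl, dl⟩ := hw.tame_derivs (ι := ι) hr ih
    have h1 := ih _ (analytic_pdv th.isOpen_dom hF)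
    have h2 := ih _ (analytic_pdS th.isOpen_dom hF)
    have h3 := ih _ (analytic_pdlam th.isOpen_dom hF)
    refine ⟨hw.unifBdd_comp_state hF, fun _ x => ((pdv F (w.state x) : ℝ) : ℂ) * (deriv w.v x : ℝ) +
      (pdS F (w.state x) : ℝ) * (deriv w.S x : ℝ) + (pdlam F (w.state x) : ℝ) * (deriv w.lam x : ℝ),
      fun _ x hx => ?_, ((UnifDecay.bdd_mul h1.bdd dv).add (UnifDecay.bdd_mul h2.bdd dS)).add
        (UnifDecay.bdd_mul h3.bdd dl), ((h1.mul tv).add (h2.mul tS)).add (h3.mul tl)⟩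
    refine ((hw.hasDerivAt_comp_state hF hx).ofReal_comp.congr_deriv ?_).hasDerivWithinAt
    push_cast
    rfl

theorem tame_c0 (hw : w.IsReactionZone th β) (hr : th.RateAssumption) (n : ℕ) :
    Tame 0 β n (fun (_ : ι) x => ((w.c0 th x : ℝ) : ℂ)) := by
  obtain ⟨c, hc, hb⟩ := hw.exists_bounds
  have hF : AnalyticOnNhd ℝ (fun z : ℝ × ℝ × ℝ => -z.1 ^ 2 * pdv th.p z) th.dom := fun z hz =>
    (analyticAt_fst.pow 2).neg.mul (analytic_pdv th.isOpen_dom th.analytic_p z hz)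
  refine (hw.tame_comp_state hr n _ hF).of_sq (fun _ x hx => ?_) (fun _ x hx => ?_) hc
    fun _ x hx => ?_
  · rw [← ofReal_pow, hw.c0_sq hx]
    rfl
  · exact (continuous_ofReal.continuousAt.comp (Real.continuous_sqrt.continuousAt.comp
      (hw.hasDerivAt_comp_state hF hx).continuousAt)).continuousWithinAt
  · rw [norm_real]
    exact (hb x hx).2.2.1.trans (le_abs_self _)

/-- The derivative along the profile of an analytic function of the state is tame and decays. -/
theorem tame_deriv_comp_state (hw : w.IsReactionZone th β) (hr : th.RateAssumption) (n : ℕ)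
    {F : ℝ × ℝ × ℝ → ℝ} (hF : AnalyticOnNhd ℝ F th.dom) :
    Tame 0 β n (fun (_ : ι) x => ((deriv (fun y => F (w.state y)) x : ℝ) : ℂ)) ∧
      UnifDecay 0 β (fun (_ : ι) x => ((deriv (fun y => F (w.state y)) x : ℝ) : ℂ)) := by
  obtain ⟨-, ⟨tv, dv⟩, ⟨tS, dS⟩, tl, dl⟩ := hw.tame_derivs (ι := ι) hr (hw.tame_comp_state hr n)
  have h1 := hw.tame_comp_state (ι := ι) hr n _ (analytic_pdv th.isOpen_dom hF)
  have h2 := hw.tame_comp_state (ι := ι) hr n _ (analytic_pdS th.isOpen_dom hF)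
  have h3 := hw.tame_comp_state (ι := ι) hr n _ (analytic_pdlam th.isOpen_dom hF)
  have heq : ∀ (_ : ι) x, 0 ≤ x → ((deriv (fun y => F (w.state y)) x : ℝ) : ℂ) =
      ((pdv F (w.state x) : ℝ) : ℂ) * (deriv w.v x : ℝ) +
      (pdS F (w.state x) : ℝ) * (deriv w.S x : ℝ) +
      (pdlam F (w.state x) : ℝ) * (deriv w.lam x : ℝ) := fun _ x hx => by
    rw [(hw.hasDerivAt_comp_state hF hx).deriv]
    push_cast
    rfl
  exact ⟨(((h1.mul tv).add (h2.mul tS)).add (h3.mul tl)).congr heq,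
    (((UnifDecay.bdd_mul h1.bdd dv).add (UnifDecay.bdd_mul h2.bdd dS)).add
        (UnifDecay.bdd_mul h3.bdd dl)).congr heq⟩

end Profile.IsReactionZone

/-- The part of `B` that does not vanish at equilibrium: the derivatives of the source terms in the
mass fraction. -/
noncomputable def Profile.Bres (w : Profile) (th : Thermo) (x : ℝ) : Matrix (Fin 5) (Fin 5) ℂ :=
  !![0, 0, 0, 0, 0;
     0, 0, 0, 0, 0;
     0, 0, 0, 0, 0;
     0, 0, 0, 0, ((-pdlam th.entropySource (w.state x) : ℝ) : ℂ);
     0, 0, 0, 0, ((-pdlam th.r (w.state x) : ℝ) : ℂ)]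

namespace Profile.IsReactionZone

variable {th : Thermo} {w : Profile} {β a : ℝ} {ι : Type*}

/-- All other entries of `B` are derivatives along the profile, or source terms and their
derivatives in `v` and `S`, which vanish at `λ = 0`. -/
theorem tame_B_sub_Bres (hw : w.IsReactionZone th β) (hr : th.RateAssumption) (n : ℕ)
    (j l : Fin 5) :
    Tame 0 β n (fun (_ : ι) x => ((w.B th x).map ((↑) : ℝ → ℂ) - w.Bres th x) j l) ∧
      UnifDecay 0 β (fun (_ : ι) x => ((w.B th x).map ((↑) : ℝ → ℂ) - w.Bres th x) j l) := by
  obtain ⟨m, -, hm⟩ := hw.exists_mflux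
  have ho := th.isOpen_dom
  obtain ⟨-, ⟨tv, dv⟩, ⟨tS, dS⟩, tl, dl⟩ := hw.tame_derivs (ι := ι) hr (hw.tame_comp_state hr n)
  have hmc : Tame 0 β n (fun (_ : ι) _ => (m : ℂ)) := Tame.const' _
  have hu : ∀ (_ : ι) x, 0 ≤ x → ((deriv w.u x : ℝ) : ℂ) = m * (deriv w.v x : ℝ) :=
    fun _ x hx => by rw [(hm x hx).2]; push_cast; rfl
  have tu := (hmc.mul tv).congr hu
  have du := (UnifDecay.bdd_mul hmc.bdd dv).congr hu
  have hv : Tame 0 β n (fun (_ : ι) x => ((w.v x : ℝ) : ℂ)) :=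
    hw.tame_comp_state hr n (fun z => z.1) fun z _ => analyticAt_fst
  obtain ⟨tp, dp⟩ := hw.tame_deriv_comp_state (ι := ι) hr n th.analytic_p
  obtain ⟨tpS, dpS⟩ := hw.tame_deriv_comp_state (ι := ι) hr n (analytic_pdS ho th.analytic_p)
  obtain ⟨tpl, dpl⟩ := hw.tame_deriv_comp_state (ι := ι) hr n (analytic_pdlam ho th.analytic_p)
  obtain ⟨tpv, dpv⟩ := hw.tame_deriv_comp_state (ι := ι) hr n (analytic_pdv ho th.analytic_p)
  have hq : ∀ (_ : ι) x, 0 ≤ x →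
      ((deriv (fun y => w.c0sq th y / (w.v y) ^ 2) x : ℝ) : ℂ) =
        -((deriv (fun y => pdv th.p (w.state y)) x : ℝ) : ℂ) := fun _ x hx => by
    have h1 : (fun y => w.c0sq th y / (w.v y) ^ 2) =ᶠ[nhds x]
        fun y => -pdv th.p (w.state y) := by
      have hc := (hw.analytic_v x hx).continuousAt
      filter_upwards [hc.eventually_ne (hw.v_pos x hx).ne'] with y hy
      unfold c0sq
      field_simp
    rw [h1.deriv_eq, deriv.fun_neg]
    push_cast
    rfl
  have tq := tpv.neg.congr hq
  have dq := dpv.neg.congr hq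
  have source : ∀ {G : ℝ × ℝ × ℝ → ℝ}, AnalyticOnNhd ℝ G th.dom →
      (∀ z ∈ th.dom, z.2.2 = 0 → G z = 0) →
      Tame 0 β n (fun (_ : ι) x => -((G (w.state x) : ℝ) : ℂ)) ∧
        UnifDecay 0 β (fun (_ : ι) x => -((G (w.state x) : ℝ) : ℂ)) := fun hG h0 =>
    ⟨(hw.tame_comp_state hr n _ hG).neg, (hw.unifDecay_of_eq_zero hG h0).neg⟩
  have hE := th.analytic_entropySource
  have z : Tame 0 β n (fun (_ : ι) (_ : ℝ) => (0 : ℂ)) ∧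
      UnifDecay 0 β (fun (_ : ι) (_ : ℝ) => (0 : ℂ)) := ⟨Tame.const' 0, UnifDecay.zero⟩
  fin_cases j <;> fin_cases l <;> simp [B, Bres]
  all_goals first
    | exact z
    | exact ⟨tu.neg, du.neg⟩
    | exact ⟨tv, dv⟩
    | exact ⟨tu, du⟩
    | exact ⟨tS, dS⟩
    | exact ⟨tl, dl⟩
    | exact ⟨tp.sub (hv.mul tq), dp.sub (UnifDecay.bdd_mul hv.bdd dq)⟩
    | exact ⟨hv.mul tpS, UnifDecay.bdd_mul hv.bdd dpS⟩
    | exact ⟨hv.mul tpl, UnifDecay.bdd_mul hv.bdd dpl⟩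
    | exact source (analytic_pdv ho hE) fun z hz h0 => (hr.entropySource_eq hz h0).2.1
    | exact source (analytic_pdS ho hE) fun z hz h0 => (hr.entropySource_eq hz h0).2.2
    | exact source (analytic_pdv ho th.analytic_r) hr.rv_eq
    | exact source (analytic_pdS ho th.analytic_r) hr.rS_eq

end Profile.IsReactionZone

/-! ### The frame -/

section Frame

variable (v u k pS pl ζ s α ε E : ℂ)

/-- The matrix `A_x`, with `p_v` expressed by the sound speed `k`. -/
noncomputable def symAx : Matrix (Fin 5) (Fin 5) ℂ :=
  !![u, -v, 0, 0, 0;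
     -(k ^ 2 / v), u, 0, v * pS, v * pl;
     0, 0, u, 0, 0;
     0, 0, 0, u, 0;
     0, 0, 0, 0, u]

/-- The matrix `A_y`, with `p_v` expressed by the sound speed `k`. -/
noncomputable def symAy : Matrix (Fin 5) (Fin 5) ℂ :=
  !![0, 0, -v, 0, 0;
     0, 0, 0, 0, 0;
     -(k ^ 2 / v), 0, 0, v * pS, v * pl;
     0, 0, 0, 0, 0;
     0, 0, 0, 0, 0]

/-- The eigenvalue `μ₁`. -/
noncomputable def symMu₁ : ℂ := -((u * ζ + k * s) / (k ^ 2 - u ^ 2))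

/-- The eigenvalue `μ₂`. -/
noncomputable def symMu₂ : ℂ := (k * s - u * ζ) / (k ^ 2 - u ^ 2)

/-- The columns of this matrix become, after multiplication by `A_xᵗ`, a frame in which `Φ₀` is
triangular. The first column gives the eigenvector `T e₁`, the last three span the
eigenspace of `ζ / u`, and the second one, for `α = 0`, is chosen so that the frame does not
degenerate where `μ₂ = μ₃`. The parameters `ε`, `E` scale the off-diagonal terms, and `α` serves to
diagonalize. -/
noncomputable def frameQ : Matrix (Fin 5) (Fin 5) ℂ :=
  !![-((ζ - u * symMu₁ u k ζ s) / (u * v)), ε, 0, 0, 0;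
     symMu₁ u k ζ s / u, ε * (α * u), u, 0, 0;
     -(I / u), -(ε * (I * (v * s / (u * k)) + α * (I * ζ))), -(I * ζ), 0, 0;
     pS * v * (ζ - u * symMu₁ u k ζ s) / (u * k ^ 2), -(ε * (pS * v ^ 2 / k ^ 2)), 0, 1, 0;
     pl * v * (ζ - u * symMu₁ u k ζ s) / (u * k ^ 2), -(ε * (pl * v ^ 2 / k ^ 2)), 0, 0, E]

/-- The coupling coefficient of the frame. -/
noncomputable def frameGamma : ℂ :=
  ε * (symMu₂ u k ζ s * v / u ^ 2 + α * (ζ / u - symMu₂ u k ζ s))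

/-- The triangular form of `Φ₀` in the frame. -/
noncomputable def frameLam : Matrix (Fin 5) (Fin 5) ℂ :=
  !![symMu₁ u k ζ s, 0, 0, 0, 0;
     0, symMu₂ u k ζ s, 0, 0, 0;
     0, frameGamma v u k ζ s α ε, ζ / u, 0, 0;
     0, 0, 0, ζ / u, 0;
     0, 0, 0, 0, ζ / u]

variable {v u k pS pl ζ s α ε E}

theorem frame_relation (hv : v ≠ 0) (hu : u ≠ 0) (hk : k ≠ 0) (hD : k ^ 2 - u ^ 2 ≠ 0)
    (hs : s ^ 2 = ζ ^ 2 + (k ^ 2 - u ^ 2)) :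
    (ζ • (1 : Matrix (Fin 5) (Fin 5) ℂ) + I • symAy v k pS pl)ᵀ * frameQ v u k pS pl ζ s α ε E =
      (symAx v u k pS pl)ᵀ * frameQ v u k pS pl ζ s α ε E * frameLam v u k ζ s α ε := by
  rw [Matrix.mul_assoc]
  ext j l
  fin_cases j <;> fin_cases l <;>
    simp [Matrix.mul_apply, Fin.sum_univ_five, symAx, symAy, frameQ, frameLam, frameGamma,
      symMu₁, symMu₂, Matrix.one_apply]
  all_goals try field_simp
  all_goals try ring_nf
  all_goals try simp only [hs, I_sq]
  all_goals try ring

theorem symAx_det (hv : v ≠ 0) : (symAx v u k pS pl).det = -(u ^ 3 * (k ^ 2 - u ^ 2)) := by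
  simp [symAx, Matrix.det_succ_row_zero, Fin.sum_univ_succ, Fin.succAbove, Matrix.submatrix]
  field_simp
  ring

theorem frame_det (hv : v ≠ 0) (hu : u ≠ 0) (hk : k ≠ 0) (hD : k ^ 2 - u ^ 2 ≠ 0)
    (hs : s ^ 2 = ζ ^ 2 + (k ^ 2 - u ^ 2)) :
    ((symAx v u k pS pl)ᵀ * frameQ v u k pS pl ζ s α ε E).det =
      2 * I * ε * E * u ^ 2 * (ζ - u * symMu₁ u k ζ s) * s * (k ^ 2 - u ^ 2) / k := by
  rw [det_mul, det_transpose]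
  have h2 : (frameQ v u k pS pl ζ s α ε E).det =
      -(2 * I * ε * E * (ζ - u * symMu₁ u k ζ s) * s / (u * k)) := by
    simp [frameQ, Matrix.det_succ_row_zero, Fin.sum_univ_succ, Fin.succAbove, Matrix.submatrix]
    simp only [symMu₁]
    field_simp
    ring_nf
    simp only [hs]
    ring
  rw [symAx_det hv, h2]
  field_simp

end Frame

namespace Profile

/-- `frameQ` along the profile. -/
noncomputable def frame (w : Profile) (th : Thermo) (x : ℝ) (ζ α ε E : ℂ) :
    Matrix (Fin 5) (Fin 5) ℂ :=
  frameQ (w.v x) (w.u x) (w.c0 th x) (pdS th.p (w.state x)) (pdlam th.p (w.state x)) ζ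
    (w.s th x ζ) α ε E

/-- The frame in which the system is of model form, to leading order. -/
noncomputable def frameP (w : Profile) (th : Thermo) (x : ℝ) (ζ α ε E : ℂ) :
    Matrix (Fin 5) (Fin 5) ℂ :=
  ((w.Ax th x).map ((↑) : ℝ → ℂ))ᵀ * w.frame th x ζ α ε E

/-- The last row of the non-decaying first order coefficients, in the frame. -/
noncomputable def frameRow (w : Profile) (th : Thermo) (x : ℝ) (ζ α ε E : ℂ) : Fin 5 → ℂ :=
  fun l => -(pdlam th.entropySource (w.state x) * w.frame th x ζ α ε E 3 l +
    pdlam th.r (w.state x) * w.frame th x ζ α ε E 4 l) / (w.u x * E)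

namespace IsReactionZone

variable {th : Thermo} {w : Profile} {β : ℝ} {x : ℝ} {ζ α ε E : ℂ}

theorem ofReal_ne (hw : w.IsReactionZone th β) (hx : 0 ≤ x) : (w.v x : ℂ) ≠ 0 ∧ (w.u x : ℂ) ≠ 0 ∧
    (w.c0 th x : ℂ) ≠ 0 ∧ (w.c0 th x : ℂ) ^ 2 - (w.u x : ℂ) ^ 2 ≠ 0 := by
  obtain ⟨c, hc, hb⟩ := hw.exists_bounds
  have h4 := (hc.trans_le (hb x hx).2.2.2).ne'
  refine ⟨ofReal_ne_zero.2 (hw.v_pos x hx).ne', ofReal_ne_zero.2 (hw.u_pos hx).ne',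
    ofReal_ne_zero.2 (hw.c0_pos hx).ne', ?_⟩
  rw [← ofReal_pow, ← ofReal_pow, ← ofReal_sub]
  exact ofReal_ne_zero.2 h4

theorem Ax_map (hw : w.IsReactionZone th β) (hx : 0 ≤ x) : (w.Ax th x).map ((↑) : ℝ → ℂ) =
    symAx (w.v x) (w.u x) (w.c0 th x) (pdS th.p (w.state x)) (pdlam th.p (w.state x)) := by
  have hv := (hw.ofReal_ne hx).1
  ext j l
  fin_cases j <;> fin_cases l <;> simp [Ax, symAx, hw.pdv_p_eq hx]
  field_simp

theorem Ay_map (hw : w.IsReactionZone th β) (hx : 0 ≤ x) : (w.Ay th x).map ((↑) : ℝ → ℂ) =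
    symAy (w.v x) (w.c0 th x) (pdS th.p (w.state x)) (pdlam th.p (w.state x)) := by
  have hv := (hw.ofReal_ne hx).1
  ext j l
  fin_cases j <;> fin_cases l <;> simp [Ay, symAy, hw.pdv_p_eq hx]
  field_simp

theorem eta_pos (hw : w.IsReactionZone th β) (hx : 0 ≤ x) : 0 < w.eta th x := by
  obtain ⟨C₁, C₂, h1, h2, hb⟩ := hw.bounds
  have h := (hb x hx).1
  unfold eta
  nlinarith

/-- Half the length of the cut of `s`. -/
theorem cut_pos (hw : w.IsReactionZone th β) (hx : 0 ≤ x) :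
    0 < w.c0 th x * Real.sqrt (w.eta th x) :=
  mul_pos (hw.c0_pos hx) (Real.sqrt_pos.2 (hw.eta_pos hx))

theorem cut_sq (hw : w.IsReactionZone th β) (hx : 0 ≤ x) :
    (w.c0 th x * Real.sqrt (w.eta th x)) ^ 2 = w.c0 th x ^ 2 - w.u x ^ 2 := by
  rw [mul_pow, Real.sq_sqrt (hw.eta_pos hx).le, eta, kappa]
  have := (hw.c0_pos hx).ne'
  field_simp

theorem s_sq (hw : w.IsReactionZone th β) (hx : 0 ≤ x) (ζ : ℂ) :
    w.s th x ζ ^ 2 = ζ ^ 2 + ((w.c0 th x : ℂ) ^ 2 - (w.u x : ℂ) ^ 2) := by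
  rw [s, branchSqrt_sq (hw.cut_pos hx), ← ofReal_pow, hw.cut_sq hx]
  push_cast
  rfl

theorem mu_zero (hw : w.IsReactionZone th β) (hx : 0 ≤ x) (ζ : ℂ) :
    w.mu th x ζ 0 = symMu₁ (w.u x) (w.c0 th x) ζ (w.s th x ζ) := by
  obtain ⟨h1, h2, h3, h4⟩ := hw.ofReal_ne hx
  have h5 : (w.eta th x : ℂ) = ((w.c0 th x : ℂ) ^ 2 - (w.u x : ℂ) ^ 2) / (w.c0 th x : ℂ) ^ 2 := by
    unfold eta kappa
    push_cast
    field_simp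
  have h6 : (w.kappa th x : ℂ) = w.u x / w.c0 th x := by unfold kappa; push_cast; rfl
  simp [mu, symMu₁, h5, h6]
  field_simp

theorem mu_one (hw : w.IsReactionZone th β) (hx : 0 ≤ x) (ζ : ℂ) :
    w.mu th x ζ 1 = symMu₂ (w.u x) (w.c0 th x) ζ (w.s th x ζ) := by
  obtain ⟨h1, h2, h3, h4⟩ := hw.ofReal_ne hx
  have h5 : (w.eta th x : ℂ) = ((w.c0 th x : ℂ) ^ 2 - (w.u x : ℂ) ^ 2) / (w.c0 th x : ℂ) ^ 2 := by
    unfold eta kappa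
    push_cast
    field_simp
  have h6 : (w.kappa th x : ℂ) = w.u x / w.c0 th x := by unfold kappa; push_cast; rfl
  simp [mu, symMu₂, h5, h6]
  field_simp
  ring

theorem mu_one_sub_mu_zero (hw : w.IsReactionZone th β) (hx : 0 ≤ x) (ζ : ℂ) :
    w.mu th x ζ 1 - w.mu th x ζ 0 =
      ((2 * w.c0 th x / (w.c0 th x ^ 2 - w.u x ^ 2) : ℝ) : ℂ) * w.s th x ζ := by
  have h4 := (hw.ofReal_ne hx).2.2.2
  rw [hw.mu_zero hx, hw.mu_one hx]
  unfold symMu₁ symMu₂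
  push_cast
  field_simp
  ring

/-- The first column of the frame is the eigenvector `T e₁`. -/
theorem frameP_mulVec_single (hw : w.IsReactionZone th β) (hx : 0 ≤ x) :
    w.frameP th x ζ α ε E *ᵥ Pi.single 0 1 = w.Tmat th x ζ *ᵥ Pi.single 0 1 := by
  obtain ⟨h1, h2, h3, h4⟩ := hw.ofReal_ne hx
  have h5 : (w.mflux x : ℂ) = w.u x / w.v x := by unfold mflux; push_cast; rfl
  have h6 : (w.kappa th x : ℂ) = w.u x / w.c0 th x := by unfold kappa; push_cast; rfl
  ext j
  rw [frameP, hw.Ax_map hx]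
  fin_cases j <;>
    simp [frame, frameQ, symAx, Matrix.mul_apply, Fin.sum_univ_five, Tmat, h5, h6, symMu₁]
  all_goals field_simp
  all_goals try ring

theorem frameP_det (hw : w.IsReactionZone th β) (hx : 0 ≤ x) :
    (w.frameP th x ζ α ε E).det =
      2 * I * ε * E * (w.u x : ℂ) ^ 2 * (ζ - w.u x * symMu₁ (w.u x) (w.c0 th x) ζ (w.s th x ζ)) *
        w.s th x ζ * ((w.c0 th x : ℂ) ^ 2 - (w.u x : ℂ) ^ 2) / w.c0 th x := by
  obtain ⟨h1, h2, h3, h4⟩ := hw.ofReal_ne hx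
  rw [frameP, hw.Ax_map hx]
  exact frame_det h1 h2 h3 h4 (hw.s_sq hx ζ)

theorem Ax_det_ne_zero (hw : w.IsReactionZone th β) (hx : 0 ≤ x) :
    ((w.Ax th x).map ((↑) : ℝ → ℂ)).det ≠ 0 := by
  obtain ⟨h1, h2, h3, h4⟩ := hw.ofReal_ne hx
  rw [hw.Ax_map hx, symAx_det h1]
  exact neg_ne_zero.2 (mul_ne_zero (pow_ne_zero _ h2) h4)

/-- The coefficient matrix of the system, in the frame. -/
theorem coeff_mul_frameP (hw : w.IsReactionZone th β) (hx : 0 ≤ x) (hE : E ≠ 0) (h ν : ℂ) :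
    (w.Phi0 th x ζ + h • w.Phi1 th x ν) * w.frameP th x (ζ + h * ν) α ε E =
      w.frameP th x (ζ + h * ν) α ε E * (w.mu th x (ζ + h * ν) 0 • 1 +
        modelMatrix (w.mu th x (ζ + h * ν) 1 - w.mu th x (ζ + h * ν) 0)
          ((ζ + h * ν) / w.u x - w.mu th x (ζ + h * ν) 0)
          (frameGamma (w.v x) (w.u x) (w.c0 th x) (ζ + h * ν) (w.s th x (ζ + h * ν)) α ε)
          (w.frameRow th x (ζ + h * ν) α ε E) h) +
      h • (((w.B th x).map ((↑) : ℝ → ℂ) - w.Bres th x)ᵀ * w.frame th x (ζ + h * ν) α ε E) := by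
  obtain ⟨h1, h2, h3, h4⟩ := hw.ofReal_ne hx
  set z := ζ + h * ν with hz
  set A := (w.Ax th x).map ((↑) : ℝ → ℂ) with hA
  set Y := (w.Ay th x).map ((↑) : ℝ → ℂ) with hY
  set Bc := (w.B th x).map ((↑) : ℝ → ℂ) with hB
  set Q := w.frame th x z α ε E with hQ
  have hdet := hw.Ax_det_ne_zero hx
  have hcoef : w.Phi0 th x ζ + h • w.Phi1 th x ν =
      (A⁻¹ * (z • (1 : Matrix (Fin 5) (Fin 5) ℂ) + I • Y + h • Bc))ᵀ := by
    simp only [Phi0, Phi1, ← hA, ← hY, ← hB, hz, Matrix.mul_add, Matrix.mul_smul, Matrix.mul_one,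
      transpose_add, transpose_smul, smul_add, add_smul, mul_smul]
    abel
  have hinv : (A⁻¹)ᵀ * (Aᵀ * Q) = Q := by
    rw [← Matrix.mul_assoc, ← transpose_mul, Matrix.mul_nonsing_inv _ (isUnit_iff_ne_zero.2 hdet),
      transpose_one, Matrix.one_mul]
  have hrel := frame_relation (pS := (pdS th.p (w.state x) : ℂ))
    (pl := (pdlam th.p (w.state x) : ℂ)) (α := α) (ε := ε) (E := E) h1 h2 h3 h4 (hw.s_sq hx z)
  rw [← hw.Ax_map hx, ← hw.Ay_map hx] at hrel
  set L := frameLam (w.v x) (w.u x) (w.c0 th x) z (w.s th x z) α ε with hL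
  -- the last column of the frame is a multiple of the last unit vector
  have hcol : ∀ j, w.frameP th x z α ε E j 4 = if j = 4 then w.u x * E else 0 := by
    intro j
    rw [frameP, hw.Ax_map hx]
    fin_cases j <;> simp [frame, frameQ, symAx, Matrix.mul_apply, Fin.sum_univ_five]
  set Rw : Matrix (Fin 5) (Fin 5) ℂ :=
    Matrix.of fun j l => if j = 4 then w.frameRow th x z α ε E l else 0 with hRw
  have hres : w.frameP th x z α ε E * Rw = (w.Bres th x)ᵀ * Q := by
    ext j l
    rw [Matrix.mul_apply, Fin.sum_univ_five]
    simp only [hRw, Matrix.of_apply, hcol]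
    fin_cases j <;>
      simp [Matrix.mul_apply, Fin.sum_univ_five, Bres, frameRow, ← hQ]
    field_simp
    ring
  have hmodel : w.mu th x z 0 • (1 : Matrix (Fin 5) (Fin 5) ℂ) +
        modelMatrix (w.mu th x z 1 - w.mu th x z 0) (z / w.u x - w.mu th x z 0)
          (frameGamma (w.v x) (w.u x) (w.c0 th x) z (w.s th x z) α ε)
          (w.frameRow th x z α ε E) h = L + h • Rw := by
    rw [hw.mu_zero hx, hw.mu_one hx]
    ext j l
    fin_cases j <;> fin_cases l <;>
      simp [modelMatrix, hL, frameLam, hRw]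
    ring
  have hX : ∀ X : Matrix (Fin 5) (Fin 5) ℂ, (A⁻¹ * X)ᵀ * w.frameP th x z α ε E = Xᵀ * Q := by
    intro X
    rw [transpose_mul, Matrix.mul_assoc, show w.frameP th x z α ε E = Aᵀ * Q from rfl, hinv]
  have hPL : w.frameP th x z α ε E * L = (z • (1 : Matrix (Fin 5) (Fin 5) ℂ) + I • Y)ᵀ * Q :=
    hrel.symm
  rw [hcoef, hX, hmodel, Matrix.mul_add, Matrix.mul_smul, hres, hPL, transpose_add,
    Matrix.add_mul, transpose_smul, transpose_sub, Matrix.sub_mul, Matrix.smul_mul, smul_sub]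
  abel

end IsReactionZone
end Profile

/-! ### The solution for a separated family of parameters -/

theorem norm_le_norm_add_ofReal {z : ℂ} {t : ℝ} (hz : 0 ≤ z.re) (ht : 0 ≤ t) :
    ‖z‖ ≤ ‖z + t‖ := by
  rw [← sq_le_sq₀ (norm_nonneg _) (norm_nonneg _), ← normSq_eq_norm_sq, ← normSq_eq_norm_sq,
    normSq_apply, normSq_apply, add_re, add_im, ofReal_re, ofReal_im, add_zero]
  nlinarith [mul_nonneg hz ht]

theorem hasDerivWithinAt_mulVec {m : Type*} [Fintype m] {A : ℝ → Matrix m m ℂ}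
    {A' : Matrix m m ℂ} {y : ℝ → m → ℂ} {y' : m → ℂ} {s : Set ℝ} {x : ℝ}
    (hA : ∀ j l, HasDerivWithinAt (fun x => A x j l) (A' j l) s x)
    (hy : HasDerivWithinAt y y' s x) :
    HasDerivWithinAt (fun x => A x *ᵥ y x) (A' *ᵥ y x + A x *ᵥ y') s x := by
  rw [hasDerivWithinAt_pi] at hy ⊢
  intro j
  have h := HasDerivWithinAt.fun_sum (u := Finset.univ) fun l _ => (hA j l).fun_mul (hy l)
  refine h.congr_deriv ?_
  rw [Finset.sum_add_distrib]
  rfl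

theorem Profile.IsReactionZone.continuousOn_s {th : Thermo} {w : Profile} {β : ℝ}
    (hw : w.IsReactionZone th β) {ζ : ℂ} (hζ : 0 ≤ ζ.re) :
    ContinuousOn (fun x => w.s th x ζ) (Ici 0) := by
  intro x hx
  have hc : ContinuousOn (fun y => w.c0 th y ^ 2 - w.u y ^ 2) (Ici 0) := by
    have hu : ContinuousOn w.u (Ici 0) := fun y hy =>
      (hw.analytic_u y hy).continuousAt.continuousWithinAt
    have hF : AnalyticOnNhd ℝ (fun z : ℝ × ℝ × ℝ => -z.1 ^ 2 * pdv th.p z) th.dom := fun z hz =>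
      (analyticAt_fst.pow 2).neg.mul (analytic_pdv th.isOpen_dom th.analytic_p z hz)
    have hk : ContinuousOn (fun y => w.c0 th y ^ 2) (Ici 0) := fun y hy =>
      (hw.hasDerivAt_comp_state hF hy).continuousAt.continuousWithinAt.congr
        (fun y' hy' => hw.c0_sq hy') (hw.c0_sq hy)
    exact hk.sub (hu.pow 2)
  have hlim : Filter.Tendsto (fun y => Real.sqrt |(w.c0 th y ^ 2 - w.u y ^ 2) -
      (w.c0 th x ^ 2 - w.u x ^ 2)|) (nhdsWithin x (Ici 0)) (nhds 0) := by
    have h1 := ((((hc x hx).sub_const (w.c0 th x ^ 2 - w.u x ^ 2)).abs).sqrt)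
    simpa [ContinuousWithinAt] using h1
  rw [ContinuousWithinAt, tendsto_iff_norm_sub_tendsto_zero]
  refine squeeze_zero' (Filter.Eventually.of_forall fun y => norm_nonneg _) ?_ hlim
  filter_upwards [self_mem_nhdsWithin] with y hy
  refine Real.le_sqrt_of_sq_le ?_
  have h := norm_branchSqrt_sub_sq_le (hw.cut_pos hy) (hw.cut_pos hx) hζ
  rwa [hw.cut_sq hy, hw.cut_sq hx] at h

theorem Profile.IsReactionZone.continuousOn_mu_zero {th : Thermo} {w : Profile} {β : ℝ}
    (hw : w.IsReactionZone th β) (hr : th.RateAssumption) {ζ : ℂ} (hζ : 0 ≤ ζ.re) :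
    ContinuousOn (fun x => w.mu th x ζ 0) (Ici 0) := by
  have hk := (hw.tame_c0 (ι := Unit) hr 0).continuousOn ()
  have hu := (hw.tame_derivs (ι := Unit) hr (hw.tame_comp_state hr 0)).1.continuousOn ()
  have hs := hw.continuousOn_s hζ
  have h : ContinuousOn (fun x => symMu₁ (w.u x) (w.c0 th x) ζ (w.s th x ζ)) (Ici 0) := by
    unfold symMu₁
    refine (((hu.mul continuousOn_const).add (hk.mul hs)).div ((hk.pow 2).sub (hu.pow 2)) ?_).neg
    exact fun x hx => (hw.ofReal_ne hx).2.2.2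
  exact h.congr fun x hx => hw.mu_zero hx ζ

/-- A family of parameters `h`, `ν` for which the eigenvalue `μ₁(x, ζ + hν)` is uniformly
separated from the others, on `x ≥ a`. -/
structure SepFamily (w : Profile) (th : Thermo) (a : ℝ) (ζ : ℂ) {ι : Type*} (h : ι → ℝ)
    (ν : ι → ℂ) : Prop where
  h_pos : ∀ i, 0 < h i
  h_le : ∀ i, h i ≤ 1
  re_nonneg : ∀ i, 0 ≤ (ζ + h i * ν i).re
  bdd : ∃ R : ℝ, ∀ i, ‖ν i‖ ≤ R
  lower : ∃ c : ℝ, 0 < c ∧ ∀ i x, a ≤ x → c ≤ ‖w.s th x (ζ + h i * ν i)‖ ∧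
    c ≤ ‖(ζ + h i * ν i) / w.u x - w.mu th x (ζ + h i * ν i) 0‖
  s_sub : ∃ C : ℝ, ∀ i x, a ≤ x → ‖w.s th x (ζ + h i * ν i) - w.s th x ζ‖ ≤ C * h i

namespace SepFamily

variable {w : Profile} {th : Thermo} {a β : ℝ} {ζ : ℂ} {ι : Type*} {h : ι → ℝ} {ν : ι → ℂ}

theorem tame_z (hs : SepFamily w th a ζ h ν) (n : ℕ) :
    Tame a β n (fun i _ => ζ + h i * ν i) := by
  obtain ⟨R, hR⟩ := hs.bdd
  refine Tame.const (C := ‖ζ‖ + 1 * R) fun i => (norm_add_le _ _).trans ?_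
  rw [norm_mul, norm_real, Real.norm_of_nonneg (hs.h_pos i).le]
  gcongr
  · exact hs.h_le i
  · exact hR i

theorem tame_s (hs : SepFamily w th a ζ h ν) (hw : w.IsReactionZone th β)
    (hr : th.RateAssumption) (ha : 0 ≤ a) (n : ℕ) :
    Tame a β n (fun i x => w.s th x (ζ + h i * ν i)) := by
  obtain ⟨c, hc, hle⟩ := hs.lower
  have hk := (hw.tame_c0 (ι := ι) hr n).mono ha
  have hu := (hw.tame_derivs (ι := ι) hr (hw.tame_comp_state hr n)).1.mono ha
  exact (((hs.tame_z n).pow 2).add ((hk.pow 2).sub (hu.pow 2))).of_sq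
    (fun i x hx => hw.s_sq (ha.trans hx) _)
    (fun i => (hw.continuousOn_s (hs.re_nonneg i)).mono (Ici_subset_Ici.2 ha)) hc
    fun i x hx => (hle i x hx).1

theorem tame_div_u {n : ℕ} {f : ι → ℝ → ℂ} (hw : w.IsReactionZone th β) (hr : th.RateAssumption)
    (ha : 0 ≤ a) (hf : Tame a β n f) : Tame a β n (fun i x => f i x / w.u x) := by
  obtain ⟨c, hc, hb⟩ := hw.exists_bounds
  refine hf.div ((hw.tame_derivs (ι := ι) hr (hw.tame_comp_state hr n)).1.mono ha) hc
    fun _ x hx => ?_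
  rw [norm_real]
  exact (hb x (ha.trans hx)).1.trans (le_abs_self _)

theorem tame_div_c0 {n : ℕ} {f : ι → ℝ → ℂ} (hw : w.IsReactionZone th β) (hr : th.RateAssumption)
    (ha : 0 ≤ a) (hf : Tame a β n f) : Tame a β n (fun i x => f i x / w.c0 th x) := by
  obtain ⟨c, hc, hb⟩ := hw.exists_bounds
  refine hf.div ((hw.tame_c0 (ι := ι) hr n).mono ha) hc fun _ x hx => ?_
  rw [norm_real]
  exact (hb x (ha.trans hx)).2.2.1.trans (le_abs_self _)

theorem tame_div_v {n : ℕ} {f : ι → ℝ → ℂ} (hw : w.IsReactionZone th β) (hr : th.RateAssumption)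
    (ha : 0 ≤ a) (hf : Tame a β n f) : Tame a β n (fun i x => f i x / w.v x) := by
  obtain ⟨m, hm0, hm⟩ := hw.exists_mflux
  refine ((tame_div_u hw hr ha hf).mul (Tame.const' (m : ℂ))).congr fun i x hx => ?_
  have h1 := (hw.ofReal_ne (ha.trans hx)).1
  have h2 : (m : ℂ) ≠ 0 := ofReal_ne_zero.2 hm0.ne'
  rw [(hm x (ha.trans hx)).1]
  push_cast
  field_simp

theorem tame_div_gap {n : ℕ} {f : ι → ℝ → ℂ} (hw : w.IsReactionZone th β) (hr : th.RateAssumption)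
    (ha : 0 ≤ a) (hf : Tame a β n f) :
    Tame a β n (fun i x => f i x / ((w.c0 th x : ℂ) ^ 2 - (w.u x : ℂ) ^ 2)) := by
  obtain ⟨c, hc, hb⟩ := hw.exists_bounds
  refine hf.div ((((hw.tame_c0 (ι := ι) hr n).mono ha).pow 2).sub
    (((hw.tame_derivs (ι := ι) hr (hw.tame_comp_state hr n)).1.mono ha).pow 2)) hc
    fun _ x hx => ?_
  rw [← ofReal_pow, ← ofReal_pow, ← ofReal_sub, norm_real]
  exact (hb x (ha.trans hx)).2.2.2.trans (le_abs_self _)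

theorem tame_mu (hs : SepFamily w th a ζ h ν) (hw : w.IsReactionZone th β)
    (hr : th.RateAssumption) (ha : 0 ≤ a) (n : ℕ) :
    Tame a β n (fun i x => w.mu th x (ζ + h i * ν i) 0) ∧
      Tame a β n (fun i x => w.mu th x (ζ + h i * ν i) 1) ∧
      Tame a β n (fun i x => (ζ + h i * ν i) / w.u x) := by
  have hk := (hw.tame_c0 (ι := ι) hr n).mono ha
  have hu := (hw.tame_derivs (ι := ι) hr (hw.tame_comp_state hr n)).1.mono ha
  have hS := hs.tame_s hw hr ha n
  have hz := hs.tame_z (β := β) n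
  refine ⟨?_, ?_, tame_div_u hw hr ha hz⟩
  · refine (tame_div_gap hw hr ha ((hu.mul hz).add (hk.mul hS))).neg.congr fun i x hx => ?_
    rw [hw.mu_zero (ha.trans hx)]
    rfl
  · refine (tame_div_gap hw hr ha ((hk.mul hS).sub (hu.mul hz))).congr fun i x hx => ?_
    rw [hw.mu_one (ha.trans hx)]
    rfl

theorem tame_frame (hs : SepFamily w th a ζ h ν) (hw : w.IsReactionZone th β)
    (hr : th.RateAssumption) (ha : 0 ≤ a) {n : ℕ} {α : ι → ℝ → ℂ} (hα : Tame a β n α)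
    (ε E : ℂ) (j l : Fin 5) :
    Tame a β n (fun i x => w.frame th x (ζ + h i * ν i) (α i x) ε E j l) := by
  have ho := th.isOpen_dom
  have hk := (hw.tame_c0 (ι := ι) hr n).mono ha
  have hu := (hw.tame_derivs (ι := ι) hr (hw.tame_comp_state hr n)).1.mono ha
  have hv : Tame a β n (fun (_ : ι) x => ((w.v x : ℝ) : ℂ)) :=
    (hw.tame_comp_state hr n (fun z => z.1) fun z _ => analyticAt_fst).mono ha
  have hpS := (hw.tame_comp_state (ι := ι) hr n _ (analytic_pdS ho th.analytic_p)).mono ha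
  have hpl := (hw.tame_comp_state (ι := ι) hr n _ (analytic_pdlam ho th.analytic_p)).mono ha
  have hS := hs.tame_s hw hr ha n
  have hz := hs.tame_z (β := β) n
  have hμ : Tame a β n (fun i x => symMu₁ (w.u x) (w.c0 th x) (ζ + h i * ν i)
      (w.s th x (ζ + h i * ν i))) :=
    (hs.tame_mu hw hr ha n).1.congr fun i x hx => (hw.mu_zero (ha.trans hx) _).symm
  have hd := hz.sub (hu.mul hμ)
  have cst : ∀ c : ℂ, Tame a β n (fun (_ : ι) (_ : ℝ) => c) := fun c => Tame.const' c
  have du : ∀ {f : ι → ℝ → ℂ}, Tame a β n f → Tame a β n (fun i x => f i x / w.u x) :=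
    fun hf => tame_div_u hw hr ha hf
  have dv : ∀ {f : ι → ℝ → ℂ}, Tame a β n f → Tame a β n (fun i x => f i x / w.v x) :=
    fun hf => tame_div_v hw hr ha hf
  have dk : ∀ {f : ι → ℝ → ℂ}, Tame a β n f → Tame a β n (fun i x => f i x / w.c0 th x) :=
    fun hf => tame_div_c0 hw hr ha hf
  fin_cases j <;> fin_cases l
  any_goals exact cst _
  · exact (dv (du hd)).neg.congr fun i x _ => by simp [Profile.frame, frameQ, div_div]
  · exact du hμ
  · exact (cst ε).mul (hα.mul hu)
  · exact hu
  · exact (du (cst I)).neg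
  · exact ((cst ε).mul (((cst I).mul (dk (du (hv.mul hS)))).add (hα.mul ((cst I).mul hz)))).neg.congr
      fun i x _ => by simp [Profile.frame, frameQ, div_div]
  · exact ((cst I).mul hz).neg
  · exact (dk (dk (du ((hpS.mul hv).mul hd)))).congr
      fun i x _ => by simp [Profile.frame, frameQ, div_div, sq, mul_assoc]
  · exact ((cst ε).mul (dk (dk (hpS.mul (hv.pow 2))))).neg.congr
      fun i x _ => by simp [Profile.frame, frameQ, div_div, sq]
  · exact (dk (dk (du ((hpl.mul hv).mul hd)))).congr
      fun i x _ => by simp [Profile.frame, frameQ, div_div, sq, mul_assoc]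
  · exact ((cst ε).mul (dk (dk (hpl.mul (hv.pow 2))))).neg.congr
      fun i x _ => by simp [Profile.frame, frameQ, div_div, sq]

theorem tame_frameP (hs : SepFamily w th a ζ h ν) (hw : w.IsReactionZone th β)
    (hr : th.RateAssumption) (ha : 0 ≤ a) {n : ℕ} {α : ι → ℝ → ℂ} (hα : Tame a β n α)
    (ε E : ℂ) (j l : Fin 5) :
    Tame a β n (fun i x => w.frameP th x (ζ + h i * ν i) (α i x) ε E j l) := by
  refine Tame.matrix_mul (fun j l => ?_) (hs.tame_frame hw hr ha hα ε E) j l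
  have ho := th.isOpen_dom
  have hu := (hw.tame_derivs (ι := ι) hr (hw.tame_comp_state hr n)).1.mono ha
  have hv : Tame a β n (fun (_ : ι) x => ((w.v x : ℝ) : ℂ)) :=
    (hw.tame_comp_state hr n (fun z => z.1) fun z _ => analyticAt_fst).mono ha
  have hpv := (hw.tame_comp_state (ι := ι) hr n _ (analytic_pdv ho th.analytic_p)).mono ha
  have hpS := (hw.tame_comp_state (ι := ι) hr n _ (analytic_pdS ho th.analytic_p)).mono ha
  have hpl := (hw.tame_comp_state (ι := ι) hr n _ (analytic_pdlam ho th.analytic_p)).mono ha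
  have z : Tame a β n (fun (_ : ι) (_ : ℝ) => (0 : ℂ)) := Tame.const' 0
  fin_cases j <;> fin_cases l <;> simp [Profile.Ax]
  all_goals first
    | exact z
    | exact hu
    | exact hv.neg
    | exact hv.mul hpv
    | exact hv.mul hpS
    | exact hv.mul hpl

theorem gap_eq (hw : w.IsReactionZone th β) {x : ℝ} (hx : 0 ≤ x) (z : ℂ) :
    z - w.u x * symMu₁ (w.u x) (w.c0 th x) z (w.s th x z) =
      w.u x * (z / w.u x - w.mu th x z 0) := by
  rw [hw.mu_zero hx]
  have := (hw.ofReal_ne hx).2.1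
  field_simp

theorem det_frameP_lower (hs : SepFamily w th a ζ h ν) (hw : w.IsReactionZone th β)
    (hr : th.RateAssumption) (ha : 0 ≤ a) (α : ι → ℝ → ℂ) {ε E : ℝ} (hε : 0 < ε) (hE : 0 < E) :
    ∃ c : ℝ, 0 < c ∧ ∀ i x, a ≤ x →
      c ≤ ‖(w.frameP th x (ζ + h i * ν i) (α i x) ε E).det‖ := by
  obtain ⟨c, hc, hle⟩ := hs.lower
  obtain ⟨c', hc', hb⟩ := hw.exists_bounds
  obtain ⟨Ck, hCk, hk⟩ := ((hw.tame_c0 (ι := Unit) hr 0).mono ha).bdd.exists_pos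
  refine ⟨2 * ε * E * c' ^ 2 * (c' * c) * c * c' / Ck, by positivity, fun i x hx => ?_⟩
  have hx0 := ha.trans hx
  obtain ⟨b1, b2, b3, b4⟩ := hb x hx0
  obtain ⟨l1, l2⟩ := hle i x hx
  have hu := hw.u_pos hx0
  rw [hw.frameP_det hx0, gap_eq hw hx0]
  simp only [norm_mul, norm_div, norm_pow, norm_I, norm_real, norm_ofNat, mul_one]
  have hD : ‖(w.c0 th x : ℂ) ^ 2 - (w.u x : ℂ) ^ 2‖ = w.c0 th x ^ 2 - w.u x ^ 2 := by
    rw [← ofReal_pow, ← ofReal_pow, ← ofReal_sub, norm_real, Real.norm_of_nonneg (by linarith)]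
  have hk' := hk () x hx
  rw [norm_real] at hk'
  have hkpos : 0 < ‖w.c0 th x‖ := norm_pos_iff.2 (hw.c0_pos hx0).ne'
  rw [hD, Real.norm_of_nonneg hε.le, Real.norm_of_nonneg hE.le, Real.norm_of_nonneg hu.le]
  have hu' : 0 ≤ w.u x := hu.le
  have hD0 : 0 ≤ w.c0 th x ^ 2 - w.u x ^ 2 := by linarith
  gcongr

theorem tame_frameRow (hs : SepFamily w th a ζ h ν) (hw : w.IsReactionZone th β)
    (hr : th.RateAssumption) (ha : 0 ≤ a) {n : ℕ} {α : ι → ℝ → ℂ} (hα : Tame a β n α)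
    (ε E : ℂ) (l : Fin 5) :
    Tame a β n (fun i x => w.frameRow th x (ζ + h i * ν i) (α i x) ε E l) := by
  have ho := th.isOpen_dom
  have h1 := (hw.tame_comp_state (ι := ι) hr n _
    (analytic_pdlam ho th.analytic_entropySource)).mono ha
  have h2 := (hw.tame_comp_state (ι := ι) hr n _ (analytic_pdlam ho th.analytic_r)).mono ha
  refine ((tame_div_u hw hr ha ((h1.mul (hs.tame_frame hw hr ha hα ε E 3 l)).add
    (h2.mul (hs.tame_frame hw hr ha hα ε E 4 l))).neg).mul (Tame.const' E⁻¹)).congr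
    fun i x _ => ?_
  simp only [Profile.frameRow]
  ring

theorem frameRow_eq_div (x : ℝ) (z α ε E : ℂ) {l : Fin 5} (hl : l ≠ 4) :
    w.frameRow th x z α ε E l = w.frameRow th x z α ε 1 l / E := by
  fin_cases l
  all_goals first
    | exact absurd rfl hl
    | simp [Profile.frameRow, Profile.frame, frameQ, div_div]

theorem frameRow_last (x : ℝ) (z α ε : ℂ) {E : ℂ} (hE : E ≠ 0) :
    w.frameRow th x z α ε E 4 = ((-pdlam th.r (w.state x) / w.u x : ℝ) : ℂ) := by
  simp [Profile.frameRow, Profile.frame, frameQ]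
  field_simp

/-- In the frame, with `E` large, the leading coefficients form a model family. The last row is
dominated by its diagonal entry `-r_λ / u > 0`. -/
theorem exists_modelFamily (hs : SepFamily w th a ζ h ν) (hw : w.IsReactionZone th β)
    (hr : th.RateAssumption) (ha : 0 ≤ a) {α : ι → ℝ → ℂ} (hα : Tame a β 1 α) (ε : ℂ)
    (hdom : ∀ i x, a ≤ x → ‖frameGamma (w.v x) (w.u x) (w.c0 th x) (ζ + h i * ν i)
      (w.s th x (ζ + h i * ν i)) (α i x) ε‖ ≤
        ((ζ + h i * ν i) / w.u x - w.mu th x (ζ + h i * ν i) 0).re / 2) :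
    ∃ E : ℝ, 0 < E ∧ ModelFamily a β h
      (fun i x => w.mu th x (ζ + h i * ν i) 1 - w.mu th x (ζ + h i * ν i) 0)
      (fun i x => (ζ + h i * ν i) / w.u x - w.mu th x (ζ + h i * ν i) 0)
      (fun i x => frameGamma (w.v x) (w.u x) (w.c0 th x) (ζ + h i * ν i)
        (w.s th x (ζ + h i * ν i)) (α i x) ε)
      (fun i x => w.frameRow th x (ζ + h i * ν i) (α i x) ε E) := by
  obtain ⟨c, hc, hle⟩ := hs.lower
  obtain ⟨c', hc', hb⟩ := hw.exists_bounds
  obtain ⟨cr, hcr, hrl⟩ := hw.exists_pos_le_comp_state (F := fun z => -pdlam th.r z)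
    (analytic_pdlam th.isOpen_dom th.analytic_r).neg
    fun z hz => neg_pos.2 (hr.rlam_neg z hz)
  obtain ⟨C, hC, hCb⟩ := exists_forall_bdd fun l => (hs.tame_frameRow hw hr ha hα ε 1 l).bdd
  obtain ⟨Ck, hCk, hk⟩ := ((hw.tame_c0 (ι := Unit) hr 0).mono ha).bdd.exists_pos
  obtain ⟨tm0, tm1, tm2⟩ := hs.tame_mu hw hr ha 1
  have hE : 0 < 8 * C / cr := by positivity
  have hE' : ((8 * C / cr : ℝ) : ℂ) ≠ 0 := ofReal_ne_zero.2 hE.ne'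
  have hlast : ∀ x, a ≤ x → cr ≤ -pdlam th.r (w.state x) / w.u x := fun x hx => by
    have hx0 := ha.trans hx
    refine (hrl x hx0).trans (le_div_self ?_ (hw.u_pos hx0) (hb x hx0).2.1)
    exact hcr.le.trans (hrl x hx0)
  have hre3 : ∀ i x, a ≤ x → 0 ≤ ((ζ + h i * ν i) / w.u x - w.mu th x (ζ + h i * ν i) 0).re :=
    fun i x hx => by
      have := (norm_nonneg _).trans (hdom i x hx)
      linarith
  refine ⟨8 * C / cr, hE, hs.h_pos, hs.h_le, tm1.sub tm0, tm2.sub tm0, ?_,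
    hs.tame_frameRow hw hr ha hα ε _, ?_, ?_, hdom, ?_⟩
  · have hv : Tame a β 1 (fun (_ : ι) x => ((w.v x : ℝ) : ℂ)) :=
      (hw.tame_comp_state hr 1 (fun z => z.1) fun z _ => analyticAt_fst).mono ha
    refine ((Tame.const' ε).mul ((tame_div_u hw hr ha (tame_div_u hw hr ha (tm1.mul hv))).add
      (hα.mul (tm2.sub tm1)))).congr fun i x hx => ?_
    rw [frameGamma, hw.mu_one (ha.trans hx), div_div, ← sq]
  · refine ⟨min c (2 * c' / Ck ^ 2 * c), by positivity, fun i x hx => ?_⟩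
    have hx0 := ha.trans hx
    obtain ⟨l1, l2⟩ := hle i x hx
    refine ⟨(min_le_right _ _).trans ?_, (min_le_left _ _).trans l2, (min_le_left _ _).trans ?_⟩
    · obtain ⟨b1, b2, b3, b4⟩ := hb x hx0
      have hk' := hk () x hx
      rw [norm_real, Real.norm_of_nonneg (hw.c0_pos hx0).le] at hk'
      have hD : 0 < w.c0 th x ^ 2 - w.u x ^ 2 := by linarith
      have hD' : w.c0 th x ^ 2 - w.u x ^ 2 ≤ Ck ^ 2 := by
        have := pow_le_pow_left₀ (hw.c0_pos hx0).le hk' 2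
        nlinarith [sq_nonneg (w.u x)]
      rw [hw.mu_one_sub_mu_zero hx0, norm_mul, norm_real, Real.norm_of_nonneg
        (div_nonneg (mul_nonneg zero_le_two (hw.c0_pos hx0).le) hD.le)]
      have := hw.c0_pos hx0
      gcongr
    · refine l2.trans ?_
      rw [frameRow_last x _ _ _ hE', ← ofReal_mul]
      exact norm_le_norm_add_ofReal (hre3 i x hx)
        (mul_nonneg (hs.h_pos i).le (hcr.le.trans (hlast x hx)))
  · intro i x hx
    have hx0 := ha.trans hx
    obtain ⟨b1, b2, b3, b4⟩ := hb x hx0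
    rw [hw.mu_one_sub_mu_zero hx0, re_ofReal_mul]
    refine mul_nonneg (div_nonneg (mul_nonneg zero_le_two (hw.c0_pos hx0).le) (by linarith)) ?_
    exact re_branchSqrt_nonneg (hw.cut_pos hx0) (hs.re_nonneg i)
  · intro i x hx
    have hterm : ∀ l : Fin 5, l ≠ 4 →
        ‖w.frameRow th x (ζ + h i * ν i) (α i x) ε ((8 * C / cr : ℝ) : ℂ) l‖ ≤ cr / 8 := by
      intro l hl
      rw [frameRow_eq_div x _ _ _ _ hl, norm_div, norm_real, Real.norm_of_nonneg hE.le,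
        div_le_iff₀ hE]
      refine (hCb l i x hx).trans (le_of_eq ?_)
      field_simp
    have h0 := hterm 0 (by decide)
    have h1 := hterm 1 (by decide)
    have h2 := hterm 2 (by decide)
    have h3 := hterm 3 (by decide)
    have h4 := hlast x hx
    simp only [frameRow_last x _ _ _ hE', ofReal_re]
    linarith

/-- The eigenvector `T e₁` at `ζ + hν` differs from the one at `ζ` by `O(h)`. -/
theorem exists_T_sub (hs : SepFamily w th a ζ h ν) (hw : w.IsReactionZone th β)
    (hr : th.RateAssumption) (ha : 0 ≤ a) : ∃ C : ℝ, 0 < C ∧ ∀ i x, a ≤ x →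
      ‖w.Tmat th x (ζ + h i * ν i) *ᵥ Pi.single 0 1 - w.Tmat th x ζ *ᵥ Pi.single 0 1‖ ≤
        C * h i := by
  obtain ⟨R, hR⟩ := hs.bdd
  obtain ⟨Cs, hCs⟩ := hs.s_sub
  have ho := th.isOpen_dom
  have hk := (hw.tame_c0 (ι := ι) hr 0).mono ha
  have hv : Tame a β 0 (fun (_ : ι) x => ((w.v x : ℝ) : ℂ)) :=
    (hw.tame_comp_state hr 0 (fun z => z.1) fun z _ => analyticAt_fst).mono ha
  have hpS := (hw.tame_comp_state (ι := ι) hr 0 _ (analytic_pdS ho th.analytic_p)).mono ha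
  have hpl := (hw.tame_comp_state (ι := ι) hr 0 _ (analytic_pdlam ho th.analytic_p)).mono ha
  -- the entries of `T e₁` are affine in `ζ` and `s`, with these coefficients
  have c0 := (tame_div_u hw hr ha (tame_div_v hw hr ha hk)).bdd
  have c1 := (tame_div_u hw hr ha (Tame.const' (ι := ι) (n := 0) 1)).bdd
  have c3 := (tame_div_u hw hr ha (tame_div_c0 hw hr ha (hpS.mul hv))).neg.bdd
  have c4 := (tame_div_u hw hr ha (tame_div_c0 hw hr ha (hpl.mul hv))).neg.bdd
  obtain ⟨C0, p0, b0⟩ := c0.exists_pos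
  obtain ⟨C1, p1, b1⟩ := c1.exists_pos
  obtain ⟨C3, p3, b3⟩ := c3.exists_pos
  obtain ⟨C4, p4, b4⟩ := c4.exists_pos
  refine ⟨(C0 + C1 + C3 + C4) * (|R| + |Cs| + 1), by positivity, fun i x hx => ?_⟩
  obtain ⟨h1, h2, h3, h4⟩ := hw.ofReal_ne (ha.trans hx)
  have h5 : (w.mflux x : ℂ) = w.u x / w.v x := by unfold Profile.mflux; push_cast; rfl
  have h6 : (w.kappa th x : ℂ) = w.u x / w.c0 th x := by unfold Profile.kappa; push_cast; rfl
  have hpos := hs.h_pos i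
  have hds : ‖w.s th x (ζ + h i * ν i) - w.s th x ζ‖ ≤ (|R| + |Cs| + 1) * h i := by
    refine (hCs i x hx).trans ?_
    gcongr
    linarith [le_abs_self Cs, abs_nonneg R]
  have hdz : ‖(h i : ℂ) * ν i‖ ≤ (|R| + |Cs| + 1) * h i := by
    rw [norm_mul, norm_real, Real.norm_of_nonneg hpos.le, mul_comm]
    gcongr
    linarith [hR i, le_abs_self R, abs_nonneg Cs]
  have key : ∀ {c d : ℂ} {A : ℝ}, ‖c‖ ≤ A → 0 < A → A ≤ C0 + C1 + C3 + C4 →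
      ‖d‖ ≤ (|R| + |Cs| + 1) * h i →
      ‖c * d‖ ≤ (C0 + C1 + C3 + C4) * (|R| + |Cs| + 1) * h i := by
    intro c d A hcA hA hA' hd
    rw [norm_mul, mul_assoc]
    exact mul_le_mul (hcA.trans hA') hd (norm_nonneg _) (by positivity)
  refine (pi_norm_le_iff_of_nonneg (by positivity)).2 fun j => ?_
  fin_cases j
  · refine le_of_eq_of_le (congrArg _ ?_) (key (b0 i x hx) p0 (by linarith) hds)
    simp [Profile.Tmat, h5, h6]
    field_simp
  · refine le_of_eq_of_le (congrArg _ ?_) (key (b1 i x hx) p1 (by linarith) hdz)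
    simp [Profile.Tmat]
    field_simp
    ring
  · simp [Profile.Tmat]
    positivity
  · refine le_of_eq_of_le (congrArg _ ?_) (key (b3 i x hx) p3 (by linarith) hds)
    simp [Profile.Tmat, h5, h6]
    field_simp
    ring
  · refine le_of_eq_of_le (congrArg _ ?_) (key (b4 i x hx) p4 (by linarith) hds)
    simp [Profile.Tmat, h5, h6]
    field_simp
    ring

end SepFamily

theorem UnifDecay.matrix_mul {m ι : Type*} [Fintype m] {a β : ℝ} {A B : ι → ℝ → Matrix m m ℂ}
    (hA : ∀ j l, UnifBdd a (fun i x => A i x j l))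
    (hB : ∀ j l, UnifDecay a β (fun i x => B i x j l)) (j l : m) :
    UnifDecay a β (fun i x => (A i x * B i x) j l) := by
  simp only [Matrix.mul_apply]
  exact UnifDecay.sum _ fun k _ => UnifDecay.bdd_mul (hA j k) (hB k l)

theorem UnifDecay.matrix_mul' {m ι : Type*} [Fintype m] {a β : ℝ} {A B : ι → ℝ → Matrix m m ℂ}
    (hA : ∀ j l, UnifDecay a β (fun i x => A i x j l))
    (hB : ∀ j l, UnifBdd a (fun i x => B i x j l)) (j l : m) :
    UnifDecay a β (fun i x => (A i x * B i x) j l) := by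
  simp only [Matrix.mul_apply]
  exact UnifDecay.sum _ fun k _ => (hA j k).mul_bdd (hB k l)

theorem hasDerivWithinAt_exp_integral {f : ℝ → ℂ} (hf : ContinuousOn f (Ici 0)) {a x : ℝ}
    (ha : 0 ≤ a) (hx : a ≤ x) (c : ℂ) :
    HasDerivWithinAt (fun x => exp (c * ∫ t in (0 : ℝ)..x, f t))
      (exp (c * ∫ t in (0 : ℝ)..x, f t) * (c * f x)) (Ici a) x := by
  have hcont : Continuous fun t => f (max 0 t) :=
    hf.comp_continuous (by fun_prop) fun t => mem_Ici.2 (le_max_left _ _)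
  have heq : ∀ y, 0 ≤ y → ∫ t in (0 : ℝ)..y, f t = ∫ t in (0 : ℝ)..y, f (max 0 t) := by
    intro y hy
    refine intervalIntegral.integral_congr fun t ht => ?_
    rw [uIcc_of_le hy] at ht
    simp only [max_eq_right ht.1]
  have h1 : HasDerivAt (fun y => ∫ t in (0 : ℝ)..y, f (max 0 t)) (f (max 0 x)) x :=
    (hcont.integral_hasStrictDerivAt 0 x).hasDerivAt
  rw [max_eq_right (ha.trans hx)] at h1
  have h2 : HasDerivWithinAt (fun y => ∫ t in (0 : ℝ)..y, f t) (f x) (Ici a) x :=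
    h1.hasDerivWithinAt.congr (fun y hy => heq y (ha.trans hy)) (heq x (ha.trans hx))
  exact (h2.const_mul c).cexp

/-- Change of unknowns `θ = φ P y`: if `P` takes the coefficient matrix `G` to `μ + M`, up to the
first order term `X = P N`, then `y` satisfies a system with coefficients `M`, and the scalar
factor `φ` accounts for `μ + h n`. -/
theorem hasDerivWithinAt_smul_mulVec {m : Type*} [Fintype m] [DecidableEq m]
    {P : ℝ → Matrix m m ℂ} {P' G M N X W : Matrix m m ℂ} {φ : ℝ → ℂ} {y : ℝ → m → ℂ}
    {μ n h : ℂ} {s : Set ℝ} {x : ℝ} (hh : h ≠ 0)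
    (hP : ∀ j l, HasDerivWithinAt (fun x => P x j l) (P' j l) s x)
    (hφ : HasDerivWithinAt φ (φ x * (1 / h * (μ + h * n))) s x)
    (hy : HasDerivWithinAt y ((1 / h) • (M *ᵥ y x) + (N - W - n • (1 : Matrix m m ℂ)) *ᵥ y x) s x)
    (hG : G * P x = P x * (μ • (1 : Matrix m m ℂ) + M) + h • X) (hN : P x * N = X)
    (hW : P x * W = P') :
    HasDerivWithinAt (fun x => φ x • (P x *ᵥ y x)) ((1 / h) • (G *ᵥ (φ x • (P x *ᵥ y x)))) s x := by
  have h1 := hφ.fun_smul (hasDerivWithinAt_mulVec hP hy)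
  refine h1.congr_deriv ?_
  rw [mulVec_smul, mulVec_mulVec, hG, ← hN, ← hW]
  simp only [mulVec_add, mulVec_smul, mulVec_mulVec, add_mulVec, sub_mulVec, smul_mulVec,
    Matrix.mul_add, Matrix.mul_smul, Matrix.mul_one, mulVec_sub, one_mulVec, smul_add, smul_sub]
  ext j
  simp only [Pi.add_apply, Pi.sub_apply, Pi.smul_apply, smul_eq_mul]
  field_simp
  ring

theorem mulVec_mulVec_eq_smul {m : Type*} [Fintype m] [DecidableEq m]
    {P G M N X : Matrix m m ℂ} {v : m → ℂ} {μ σ h : ℂ}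
    (hG : G * P = P * (μ • (1 : Matrix m m ℂ) + M) + h • X) (hN : P * N = X)
    (hv : (M + h • N) *ᵥ v = σ • v) : G *ᵥ (P *ᵥ v) = (μ + σ) • (P *ᵥ v) := by
  have h1 : G * P = P * (μ • (1 : Matrix m m ℂ) + (M + h • N)) := by
    rw [hG, ← hN, ← add_assoc, Matrix.mul_add _ _ (h • N), Matrix.mul_smul _ h]
  rw [mulVec_mulVec, h1, ← mulVec_mulVec, add_mulVec, hv, smul_mulVec, one_mulVec, ← add_smul,
    mulVec_smul]

namespace SepFamily

variable {w : Profile} {th : Thermo} {a β : ℝ} {ζ : ℂ} {ι : Type*} {h : ι → ℝ} {ν : ι → ℂ}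

/-- The exact solution and its approximation by an eigenvector, for a separated family. The
function `α` and the number `ε` are parameters of the frame, to be chosen such that the
coupling coefficient is dominated. -/
theorem exists_wkb (hs : SepFamily w th a ζ h ν) (hw : w.IsReactionZone th β)
    (hr : th.RateAssumption) (ha : 0 ≤ a) {α : ι → ℝ → ℂ} (hα : Tame a β 2 α) {ε : ℝ}
    (hε : 0 < ε)
    (hdom : ∀ i x, a ≤ x → ‖frameGamma (w.v x) (w.u x) (w.c0 th x) (ζ + h i * ν i)
      (w.s th x (ζ + h i * ν i)) (α i x) ε‖ ≤
        ((ζ + h i * ν i) / w.u x - w.mu th x (ζ + h i * ν i) 0).re / 2) :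
    ∃ K h₀ : ℝ, 0 < K ∧ 0 < h₀ ∧ ∀ i, h i ≤ h₀ →
      ∃ (θ : ℝ → Fin 5 → ℂ) (μs : ℝ → ℂ) (ρ : ℝ → Fin 5 → ℂ),
        (∀ x : ℝ, a ≤ x → HasDerivWithinAt θ
          ((1 / h i : ℂ) • ((w.Phi0 th x ζ + (h i : ℂ) • w.Phi1 th x (ν i)) *ᵥ θ x)) (Ici a) x) ∧
        ContinuousOn μs (Ici 0) ∧
        (∀ x : ℝ, 0 ≤ x →
          ‖μs x - w.mu th x (ζ + h i * ν i) 0‖ ≤ K * h i * Real.exp (-β * x)) ∧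
        (∀ x : ℝ, a ≤ x → ‖ρ x‖ ≤ K * h i ∧
          ∃ μ : ℂ, (w.Phi0 th x ζ + (h i : ℂ) • w.Phi1 th x (ν i)) *ᵥ
              (w.Tmat th x ζ *ᵥ Pi.single 0 1 + ρ x) =
            μ • (w.Tmat th x ζ *ᵥ Pi.single 0 1 + ρ x)) ∧
        (∀ x : ℝ, a ≤ x →
          ‖θ x - Complex.exp ((1 / h i : ℂ) * ∫ t in (0 : ℝ)..x, μs t) •
              (w.Tmat th x ζ *ᵥ Pi.single 0 1 + ρ x)‖ ≤
            K * h i * Real.exp (-β * x) *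
              ‖Complex.exp ((1 / h i : ℂ) * ∫ t in (0 : ℝ)..x, μs t)‖) := by
  have hβ := hw.beta_pos
  obtain ⟨E, hE, hm⟩ := hs.exists_modelFamily hw hr ha hα.of_succ ε hdom
  have hE' : (E : ℂ) ≠ 0 := ofReal_ne_zero.2 hE.ne'
  set P : ι → ℝ → Matrix (Fin 5) (Fin 5) ℂ :=
    fun i x => w.frameP th x (ζ + h i * ν i) (α i x) ε E with hP
  have tP : ∀ j l, Tame a β 2 (fun i x => P i x j l) := hs.tame_frameP hw hr ha hα ε E
  obtain ⟨c, hc, hdet⟩ := hs.det_frameP_lower hw hr ha α hε hE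
  have tPinv : ∀ j l, Tame a β 1 (fun i x => (P i x)⁻¹ j l) :=
    Tame.matrix_inv (fun j l => (tP j l).of_succ) hc hdet
  have hPinv : ∀ i x, a ≤ x → P i x * (P i x)⁻¹ = 1 := fun i x hx =>
    Matrix.mul_nonsing_inv _ (isUnit_iff_ne_zero.2 (norm_pos_iff.1 (hc.trans_le (hdet i x hx))))
  choose P' hPd hP'd hP't using fun j l => (tP j l).exists_deriv
  -- the first order terms that decay, in the frame
  set X : ι → ℝ → Matrix (Fin 5) (Fin 5) ℂ := fun i x =>
    ((w.B th x).map ((↑) : ℝ → ℂ) - w.Bres th x)ᵀ * w.frame th x (ζ + h i * ν i) (α i x) ε E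
    with hX
  have hB : ∀ j l, Tame a β 1 (fun (_ : ι) x =>
      ((w.B th x).map ((↑) : ℝ → ℂ) - w.Bres th x)ᵀ j l) ∧ UnifDecay a β (fun (_ : ι) x =>
      ((w.B th x).map ((↑) : ℝ → ℂ) - w.Bres th x)ᵀ j l) := fun j l =>
    ⟨(hw.tame_B_sub_Bres hr 1 l j).1.mono ha, (hw.tame_B_sub_Bres hr 1 l j).2.mono ha⟩
  have tX : ∀ j l, Tame a β 1 (fun i x => X i x j l) :=
    Tame.matrix_mul (fun j l => (hB j l).1) (hs.tame_frame hw hr ha hα.of_succ ε E)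
  have dX : ∀ j l, UnifDecay a β (fun i x => X i x j l) :=
    UnifDecay.matrix_mul' (fun j l => (hB j l).2)
      fun j l => (hs.tame_frame hw hr ha hα.of_succ ε E j l).bdd
  set N : ι → ℝ → Matrix (Fin 5) (Fin 5) ℂ := fun i x => (P i x)⁻¹ * X i x with hN
  have tN : ∀ j l, Tame a β 1 (fun i x => N i x j l) := Tame.matrix_mul tPinv tX
  have dN : ∀ j l, UnifDecay a β (fun i x => N i x j l) :=
    UnifDecay.matrix_mul (fun j l => (tPinv j l).bdd) dX
  set W : ι → ℝ → Matrix (Fin 5) (Fin 5) ℂ :=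
    fun i x => (P i x)⁻¹ * Matrix.of fun j l => P' j l i x with hW
  have tW : ∀ j l, Tame a β 1 (fun i x => W i x j l) := Tame.matrix_mul tPinv hP't
  have dW : ∀ j l, UnifDecay a β (fun i x => W i x j l) :=
    UnifDecay.matrix_mul (fun j l => (tPinv j l).bdd) hP'd
  have hPN : ∀ i x, a ≤ x → P i x * N i x = X i x := fun i x hx => by
    simp only [hN]
    rw [← Matrix.mul_assoc, hPinv i x hx, Matrix.one_mul]
  have hPW : ∀ i x, a ≤ x → P i x * W i x = Matrix.of fun j l => P' j l i x := fun i x hx => by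
    simp only [hW]
    rw [← Matrix.mul_assoc, hPinv i x hx, Matrix.one_mul]
  set n : ι → ℝ → ℂ := fun i x => N i x 0 0 - W i x 0 0 with hn
  have tn : Tame a β 1 n := (tN 0 0).sub (tW 0 0)
  have dn : UnifDecay a β n := (dN 0 0).sub (dW 0 0)
  obtain ⟨K₁, hK₁, hsol⟩ := hm.exists_solution ha hβ
    (N := fun i x => N i x - W i x - n i x • (1 : Matrix (Fin 5) (Fin 5) ℂ))
    (fun j l => ((tN j l).sub (tW j l)).sub (tn.mul (Tame.const' _)))
    (fun j l => ((dN j l).sub (dW j l)).sub (dn.mul_bdd (Tame.const' (n := 0) (β := β) _).bdd))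
    (fun i x => by simp [hn])
  obtain ⟨K₂, h₀, hK₂, hh₀, heig⟩ := hm.exists_eigenvector ha hβ dN
  obtain ⟨K₃, hK₃, hn3⟩ := dn.exists_pos
  obtain ⟨K₄, hK₄, hq⟩ := hm.tame_last.bdd.exists_pos
  obtain ⟨K₅, hK₅, hT⟩ := hs.exists_T_sub hw hr ha
  obtain ⟨CP, hCP, hPb⟩ := exists_forall_bdd (σ := Fin 5 × Fin 5)
    (F := fun p i x => P i x p.1 p.2) fun p => (tP p.1 p.2).bdd
  have hPv : ∀ i x, a ≤ x → ∀ g, ‖P i x *ᵥ g‖ ≤ 5 * CP * ‖g‖ := fun i x hx g => by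
    simpa using norm_mulVec_le hCP.le (fun j l => hPb (j, l) i x hx) g
  set K : ℝ := K₃ + (K₅ + 5 * CP * K₄ + 5 * CP * K₂) + 5 * CP * (K₁ + K₂) with hK
  refine ⟨K, h₀, by positivity, hh₀, fun i hi => ?_⟩
  have hpos := hs.h_pos i
  have hpos' : (h i : ℂ) ≠ 0 := ofReal_ne_zero.2 hpos.ne'
  obtain ⟨y, hyd, hyb⟩ := hsol i
  choose! t ht σ hσ using heig i hi
  set V : ℝ → Fin 5 → ℂ := fun x => modelVec
    ((ζ + h i * ν i) / w.u x - w.mu th x (ζ + h i * ν i) 0)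
    (w.frameRow th x (ζ + h i * ν i) (α i x) ε E) (h i) with hV
  set μs : ℝ → ℂ := fun x => w.mu th x (ζ + h i * ν i) 0 + h i * n i (max a x) with hμs
  set T₁ : ℝ → Fin 5 → ℂ := fun x => w.Tmat th x ζ *ᵥ Pi.single 0 1 with hT₁
  set φ : ℝ → ℂ := fun x => exp ((1 / h i : ℂ) * ∫ t in (0 : ℝ)..x, μs t) with hφ
  have hμc : ContinuousOn μs (Ici 0) := by
    refine (hw.continuousOn_mu_zero hr (hs.re_nonneg i)).add (continuousOn_const.mul ?_)
    exact ((tn.continuousOn i).comp_continuous (by fun_prop) fun x => le_max_left a x).continuousOn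
  have hcoef := fun x (hx : a ≤ x) => hw.coeff_mul_frameP (ha.trans hx) hE' (h i) (ν i)
    (ζ := ζ) (α := α i x) (ε := ε)
  have hsum : ∀ x, T₁ x + (P i x *ᵥ (V x + t x) - T₁ x) = P i x *ᵥ (V x + t x) := fun x => by
    abel
  refine ⟨fun x => φ x • (P i x *ᵥ y x), μs, fun x => P i x *ᵥ (V x + t x) - T₁ x,
    fun x hx => ?_, hμc, fun x hx => ?_, fun x hx => ⟨?_, ?_⟩, fun x hx => ?_⟩
  · refine hasDerivWithinAt_smul_mulVec hpos' (fun j l => hPd j l i x hx)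
      ((hasDerivWithinAt_exp_integral hμc ha hx _).congr_deriv ?_) (hyd x hx) (hcoef x hx)
      (hPN i x hx) (hPW i x hx)
    simp only [hφ, hμs, max_eq_right hx]
  · rw [hμs, add_sub_cancel_left, norm_mul, norm_real, Real.norm_of_nonneg hpos.le]
    have h1 : Real.exp (-β * max a x) ≤ Real.exp (-β * x) :=
      Real.exp_le_exp.2 (by nlinarith [le_max_right a x])
    calc h i * ‖n i (max a x)‖ ≤ h i * (K₃ * Real.exp (-β * max a x)) := by
          gcongr
          exact hn3 i _ (le_max_left _ _)
      _ ≤ h i * (K * Real.exp (-β * x)) := by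
          gcongr
          have : 0 ≤ (K₅ + 5 * CP * K₄ + 5 * CP * K₂) + 5 * CP * (K₁ + K₂) := by positivity
          linarith
      _ = _ := by ring
  · have hexp : Real.exp (-β * x) ≤ 1 := Real.exp_le_one_iff.2 (by nlinarith)
    have e1 : ‖V x - Pi.single 0 1‖ ≤ K₄ * h i := by
      refine (pi_norm_le_iff_of_nonneg (by positivity)).2 fun j => ?_
      fin_cases j
      any_goals
        simp [hV, modelVec]
        positivity
      · have := hq i x hx
        simp only [hV, modelVec]
        simp [mul_div_assoc, abs_of_pos hpos]
        rw [mul_comm]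
        simpa using mul_le_mul_of_nonneg_right this hpos.le
    have e2 : ‖t x‖ ≤ K₂ * h i := by
      refine (ht x hx).trans ?_
      exact mul_le_of_le_one_right (by positivity) hexp
    have e3 : P i x *ᵥ (V x + t x) - T₁ x =
        (w.Tmat th x (ζ + h i * ν i) *ᵥ Pi.single 0 1 - T₁ x) +
          P i x *ᵥ (V x - Pi.single 0 1) + P i x *ᵥ t x := by
      rw [← hw.frameP_mulVec_single (ha.trans hx) (α := α i x) (ε := ε) (E := E), mulVec_add,
        mulVec_sub]
      abel
    change ‖P i x *ᵥ (V x + t x) - T₁ x‖ ≤ _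
    rw [e3]
    calc _ ≤ K₅ * h i + 5 * CP * (K₄ * h i) + 5 * CP * (K₂ * h i) := by
          refine (norm_add₃_le).trans (add_le_add (add_le_add (hT i x hx) ?_) ?_)
          · exact (hPv i x hx _).trans (by gcongr)
          · exact (hPv i x hx _).trans (by gcongr)
      _ = (K₅ + 5 * CP * K₄ + 5 * CP * K₂) * h i := by ring
      _ ≤ K * h i := by
          gcongr
          have : 0 ≤ 5 * CP * (K₁ + K₂) := by positivity
          linarith
  · refine ⟨w.mu th x (ζ + h i * ν i) 0 + σ x, ?_⟩
    change _ *ᵥ (T₁ x + (P i x *ᵥ (V x + t x) - T₁ x)) =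
      _ • (T₁ x + (P i x *ᵥ (V x + t x) - T₁ x))
    rw [hsum]
    exact mulVec_mulVec_eq_smul (hcoef x hx) (hPN i x hx) (hσ x hx)
  · change ‖φ x • (P i x *ᵥ y x) - φ x • (T₁ x + (P i x *ᵥ (V x + t x) - T₁ x))‖ ≤ _ * ‖φ x‖
    rw [hsum, ← smul_sub, norm_smul, mul_comm ‖φ x‖]
    refine mul_le_mul_of_nonneg_right ?_ (norm_nonneg _)
    have e1 : P i x *ᵥ y x - P i x *ᵥ (V x + t x) = P i x *ᵥ (y x - V x - t x) := by
      rw [← mulVec_sub]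
      congr 1
      abel
    rw [e1]
    calc _ ≤ 5 * CP * (K₁ * h i * Real.exp (-β * x) + K₂ * h i * Real.exp (-β * x)) := by
          refine (hPv i x hx _).trans ?_
          gcongr
          exact (norm_sub_le _ _).trans (add_le_add (hyb x hx) (ht x hx))
      _ = 5 * CP * (K₁ + K₂) * h i * Real.exp (-β * x) := by ring
      _ ≤ K * h i * Real.exp (-β * x) := by
          gcongr
          have : 0 ≤ K₃ + (K₅ + 5 * CP * K₄ + 5 * CP * K₂) := by positivity
          linarith

end SepFamily

/-! ### Separated parameters -/

/-- The product of the gaps between the eigenvalue `z / u` and the two acoustic eigenvalues. It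
vanishes only at `z = ± u`. -/
theorem Profile.IsReactionZone.gap_mul_gap {th : Thermo} {w : Profile} {β x : ℝ}
    (hw : w.IsReactionZone th β) (hx : 0 ≤ x) (z : ℂ) :
    (z / w.u x - w.mu th x z 0) * (z / w.u x - w.mu th x z 1) =
      ((w.c0 th x ^ 2 / (w.u x ^ 2 * (w.c0 th x ^ 2 - w.u x ^ 2)) : ℝ) : ℂ) *
        ((z - w.u x) * (z + w.u x)) := by
  obtain ⟨-, h2, -, h4⟩ := hw.ofReal_ne hx
  have hs := hw.s_sq hx z
  rw [hw.mu_zero hx, hw.mu_one hx]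
  unfold symMu₁ symMu₂
  push_cast
  field_simp
  ring_nf
  rw [hs]
  ring

theorem Profile.IsReactionZone.re_le_re_gap {th : Thermo} {w : Profile} {β x : ℝ}
    (hw : w.IsReactionZone th β) (hx : 0 ≤ x) {z : ℂ} (hz : 0 ≤ z.re) :
    z.re ≤ (z / w.u x - w.mu th x z 0).re := by
  obtain ⟨c', hc', hb⟩ := hw.exists_bounds
  obtain ⟨b1, b2, b3, b4⟩ := hb x hx
  have hu := hw.u_pos hx
  have hk := hw.c0_pos hx
  have hs : 0 ≤ (w.s th x z).re := re_branchSqrt_nonneg (hw.cut_pos hx) hz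
  have h1 : z / w.u x - w.mu th x z 0 = ((1 / w.u x : ℝ) : ℂ) * z +
      ((1 / (w.c0 th x ^ 2 - w.u x ^ 2) : ℝ) : ℂ) *
        ((w.u x : ℂ) * z + (w.c0 th x : ℂ) * w.s th x z) := by
    rw [hw.mu_zero hx]
    unfold symMu₁
    push_cast
    ring
  rw [h1, add_re, re_ofReal_mul, re_ofReal_mul, add_re, re_ofReal_mul, re_ofReal_mul]
  have h2 : z.re ≤ 1 / w.u x * z.re :=
    le_mul_of_one_le_left hz ((one_le_div hu).2 b2)
  have h3 : 0 ≤ 1 / (w.c0 th x ^ 2 - w.u x ^ 2) *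
      (w.u x * z.re + w.c0 th x * (w.s th x z).re) :=
    mul_nonneg (one_div_nonneg.2 (hc'.le.trans b4)) (by positivity)
  linarith

namespace SepFamily

variable {w : Profile} {th : Thermo} {a β c : ℝ} {ζ : ℂ} {ι : Type*} {h : ι → ℝ} {ν : ι → ℂ}

/-- Separation of `μ₁` from `μ₂` bounds `s` from below, since `μ₂ - μ₁` is a multiple of `s`. -/
theorem of_separated (hw : w.IsReactionZone th β) (hr : th.RateAssumption) (ha : 0 ≤ a)
    (hζ : 0 ≤ ζ.re) (hc : 0 < c) {R c' : ℝ} (hc' : 0 < c')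
    (hb : ∀ x, 0 ≤ x → c' ≤ w.c0 th x ^ 2 - w.u x ^ 2) (hpos : ∀ i, 0 < h i)
    (hle : ∀ i, h i ≤ 1) (hν : ∀ i, 0 ≤ (ν i).re) (hR : ∀ i, ‖ν i‖ ≤ R)
    (hsmall : ∀ i, ‖(h i : ℂ) * ν i‖ ≤ Real.sqrt c' / 2)
    (hsep : ∀ i x, a ≤ x → ∀ j : Fin 5, j ≠ 0 →
      c ≤ ‖w.mu th x (ζ + h i * ν i) 0 - w.mu th x (ζ + h i * ν i) j‖) :
    SepFamily w th a ζ h ν := by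
  obtain ⟨Ck, hCk, hk⟩ := ((hw.tame_c0 (ι := Unit) hr 0).mono ha).bdd.exists_pos
  have hs : ∀ i x, a ≤ x → c * c' / (2 * Ck) ≤ ‖w.s th x (ζ + h i * ν i)‖ := by
    intro i x hx
    have hx0 := ha.trans hx
    have h1 := hsep i x hx 1 (by decide)
    have hk0 := hw.c0_pos hx0
    have hk' := hk () x hx
    rw [norm_real, Real.norm_of_nonneg hk0.le] at hk'
    have hD := hb x hx0
    have hD0 := hc'.trans_le hD
    rw [norm_sub_rev, hw.mu_one_sub_mu_zero hx0, norm_mul, norm_real, Real.norm_of_nonneg (by positivity),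
      div_mul_eq_mul_div, le_div_iff₀ hD0] at h1
    rw [div_le_iff₀ (by positivity)]
    calc c * c' ≤ c * (w.c0 th x ^ 2 - w.u x ^ 2) := by gcongr
      _ ≤ 2 * w.c0 th x * ‖w.s th x (ζ + h i * ν i)‖ := h1
      _ ≤ 2 * Ck * ‖w.s th x (ζ + h i * ν i)‖ := by gcongr
      _ = _ := by ring
  have hre : ∀ i, 0 ≤ (ζ + h i * ν i).re := fun i => by
    rw [add_re, re_ofReal_mul]
    exact add_nonneg hζ (mul_nonneg (hpos i).le (hν i))
  refine ⟨hpos, hle, hre, ⟨R, hR⟩, ⟨min (c * c' / (2 * Ck)) c, by positivity, fun i x hx =>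
    ⟨(min_le_left _ _).trans (hs i x hx), (min_le_right _ _).trans ?_⟩⟩, ?_⟩
  · rw [norm_sub_rev]
    exact hsep i x hx 2 (by decide)
  · -- `(s(z) - s(ζ)) (s(z) + s(ζ)) = z² - ζ²`, and the sum stays away from zero
    set m := min (c * c' / (2 * Ck)) (Real.sqrt c' / 2) with hm
    have hm0 : 0 < m := by positivity
    refine ⟨R * (2 * ‖ζ‖ + R) / m, fun i x hx => ?_⟩
    have hx0 := ha.trans hx
    have hR0 : 0 ≤ R := (norm_nonneg _).trans (hR i)
    have hcut : Real.sqrt c' ≤ w.c0 th x * Real.sqrt (w.eta th x) := by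
      refine Real.sqrt_le_iff.2 ⟨(hw.cut_pos hx0).le, ?_⟩
      rw [hw.cut_sq hx0]
      exact hb x hx0
    have hsum : m ≤ ‖w.s th x ζ + w.s th x (ζ + h i * ν i)‖ := by
      refine (min_le_min (hs i x hx) ?_).trans (min_le_norm_branchSqrt_add (hw.cut_pos hx0) hζ
        (hre i) ?_)
      · linarith
      · rw [sub_add_cancel_left, norm_neg]
        linarith [hsmall i]
    have hprod : ‖w.s th x (ζ + h i * ν i) - w.s th x ζ‖ *
        ‖w.s th x ζ + w.s th x (ζ + h i * ν i)‖ ≤ h i * (R * (2 * ‖ζ‖ + R)) := by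
      have e1 : (w.s th x (ζ + h i * ν i) - w.s th x ζ) *
          (w.s th x ζ + w.s th x (ζ + h i * ν i)) = (h i : ℂ) * (ν i * (2 * ζ + h i * ν i)) := by
        linear_combination hw.s_sq hx0 (ζ + h i * ν i) - hw.s_sq hx0 ζ
      rw [← norm_mul, e1, norm_mul, norm_mul, norm_real, Real.norm_of_nonneg (hpos i).le]
      have h0 := (hpos i).le
      have e2 : ‖2 * ζ + h i * ν i‖ ≤ 2 * ‖ζ‖ + R := by
        refine (norm_add_le _ _).trans ?_
        rw [norm_mul, norm_mul, norm_real, Real.norm_of_nonneg (hpos i).le, norm_ofNat]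
        have := mul_le_mul (hle i) (hR i) (norm_nonneg _) zero_le_one
        linarith
      gcongr
      exact hR i
    rw [div_mul_eq_mul_div, le_div_iff₀ hm0]
    calc _ ≤ ‖w.s th x (ζ + h i * ν i) - w.s th x ζ‖ *
          ‖w.s th x ζ + w.s th x (ζ + h i * ν i)‖ := by gcongr
      _ ≤ h i * (R * (2 * ‖ζ‖ + R)) := hprod
      _ = _ := by ring

/-- The frame can be chosen such that its coupling coefficient is dominated by the gap between
`z / u` and `μ₁`. If `Re ζ > 0`, the gap has a positive real part, and the coupling is made small by
scaling. If `Re ζ = 0`, then `z` stays away from `± u`, hence `μ₂` from `z / u`, and the coupling is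
removed by diagonalization. -/
theorem exists_coupling_le (hs : SepFamily w th a ζ h ν) (hw : w.IsReactionZone th β)
    (hr : th.RateAssumption) (ha : 0 ≤ a) (hζ : 0 ≤ ζ.re) {c' : ℝ} (hc' : 0 < c')
    (hb : ∀ x, 0 ≤ x → c' ≤ w.u x) (hν : ∀ i, 0 ≤ (ν i).re)
    (hsmall : ∀ i, ‖(h i : ℂ) * ν i‖ ≤ c' / 2) :
    ∃ (α : ι → ℝ → ℂ) (ε : ℝ), Tame a β 2 α ∧ 0 < ε ∧ ∀ i x, a ≤ x →
      ‖frameGamma (w.v x) (w.u x) (w.c0 th x) (ζ + h i * ν i)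
        (w.s th x (ζ + h i * ν i)) (α i x) ε‖ ≤
          ((ζ + h i * ν i) / w.u x - w.mu th x (ζ + h i * ν i) 0).re / 2 := by
  obtain ⟨tm0, tm1, tm2⟩ := hs.tame_mu hw hr ha 2
  have hv : Tame a β 2 (fun (_ : ι) x => ((w.v x : ℝ) : ℂ)) :=
    (hw.tame_comp_state hr 2 (fun z => z.1) fun z _ => analyticAt_fst).mono ha
  have hnum := tame_div_u hw hr ha (tame_div_u hw hr ha (tm1.mul hv))
  have hgap : ∀ i x, a ≤ x → ζ.re ≤
      ((ζ + h i * ν i) / w.u x - w.mu th x (ζ + h i * ν i) 0).re := fun i x hx => by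
    refine le_trans ?_ (hw.re_le_re_gap (ha.trans hx) (hs.re_nonneg i))
    rw [add_re, re_ofReal_mul]
    exact le_add_of_nonneg_right (mul_nonneg (hs.h_pos i).le (hν i))
  rcases hζ.lt_or_eq with hpos | hzero
  · obtain ⟨C, hC, hCb⟩ := hnum.bdd.exists_pos
    refine ⟨fun _ _ => 0, ζ.re / (2 * C), Tame.const' 0, by positivity, fun i x hx => ?_⟩
    have h1 := hCb i x hx
    rw [hw.mu_one (ha.trans hx), div_div, ← sq] at h1
    rw [frameGamma, zero_mul, add_zero, norm_mul, norm_real, Real.norm_of_nonneg (by positivity)]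
    calc _ ≤ ζ.re / (2 * C) * C := by gcongr
      _ = ζ.re / 2 := by field_simp
      _ ≤ _ := by linarith [hgap i x hx]
  · obtain ⟨C, hC, hCb⟩ := (tm2.sub tm0).bdd.exists_pos
    have hlow : ∀ i x, a ≤ x → c' / 2 * c' / C ≤
        ‖(ζ + h i * ν i) / w.u x - w.mu th x (ζ + h i * ν i) 1‖ := by
      intro i x hx
      have hx0 := ha.trans hx
      obtain ⟨c'', hc'', hb'⟩ := hw.exists_bounds
      obtain ⟨-, b2, -, b4⟩ := hb' x hx0
      have hu := hw.u_pos hx0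
      have hk := hw.c0_pos hx0
      have hD : 0 < w.c0 th x ^ 2 - w.u x ^ 2 := hc''.trans_le b4
      have hzre : (ζ + h i * ν i).re ≤ c' / 2 := by
        rw [add_re, ← hzero, zero_add]
        exact (re_le_norm _).trans (hsmall i)
      have n1 : c' / 2 ≤ ‖ζ + h i * ν i - w.u x‖ := by
        rw [norm_sub_rev]
        refine le_trans ?_ (re_le_norm _)
        rw [sub_re, ofReal_re]
        linarith [hb x hx0]
      have n2 : c' ≤ ‖ζ + h i * ν i + w.u x‖ := by
        refine le_trans ?_ (re_le_norm _)
        rw [add_re, ofReal_re]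
        linarith [hb x hx0, hs.re_nonneg i]
      have n3 : 1 ≤ w.c0 th x ^ 2 / (w.u x ^ 2 * (w.c0 th x ^ 2 - w.u x ^ 2)) := by
        rw [one_le_div (by positivity)]
        have : w.u x ^ 2 ≤ 1 := pow_le_one₀ hu.le b2
        nlinarith [sq_nonneg (w.u x)]
      have h1 := congrArg norm (hw.gap_mul_gap hx0 (ζ + h i * ν i))
      rw [norm_mul, norm_mul, norm_mul, norm_real, Real.norm_of_nonneg (by positivity)] at h1
      rw [div_le_iff₀ hC, mul_comm _ C]
      calc c' / 2 * c' ≤ 1 * (‖ζ + h i * ν i - w.u x‖ * ‖ζ + h i * ν i + w.u x‖) := by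
            rw [one_mul]
            gcongr
        _ ≤ _ := by gcongr
        _ = _ := h1.symm
        _ ≤ _ := by
            gcongr
            exact hCb i x hx
    refine ⟨_, 1, (hnum.div (tm2.sub tm1) (by positivity) hlow).neg, one_pos, fun i x hx => ?_⟩
    have hne : (ζ + h i * ν i) / w.u x - w.mu th x (ζ + h i * ν i) 1 ≠ 0 :=
      norm_pos_iff.1 (lt_of_lt_of_le (by positivity) (hlow i x hx))
    have hz := hgap i x hx
    rw [← hzero] at hz
    rw [frameGamma, ← hw.mu_one (ha.trans hx), neg_mul, div_mul_cancel₀ _ hne, div_div, ← sq,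
      add_neg_cancel, mul_zero, norm_zero]
    linarith

end SepFamily

end ZND

theorem theorem2p1 (th : ZND.Thermo) (hr : th.RateAssumption)
    (w : ZND.Profile) (β : ℝ) (hw : w.IsReactionZone th β)
    (a : ℝ) (ha : 0 ≤ a) (R : ℝ) (ζ : ℂ) (hζ : 0 ≤ ζ.re) (c : ℝ) (hc : 0 < c) :
    -- `K` and `C δ` do not depend on `ν`, `h`, `x`
    ∃ (K : ℝ) (C : ℝ → ℝ), ∀ ν : ℂ, 0 ≤ ν.re → ‖ν‖ ≤ R → w.Separated th a c ζ ν →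
      ∃ h₀ : ℝ, 0 < h₀ ∧ ∀ h : ℝ, 0 < h → h ≤ h₀ →
        ∃ (θ : ℝ → Fin 5 → ℂ) (μs : ℝ → ℂ) (ρ : ℝ → Fin 5 → ℂ),
          -- exact solution on `[a, ∞)`
          (∀ x : ℝ, a ≤ x → HasDerivWithinAt θ
            ((1 / h : ℂ) • ((w.Phi0 th x ζ + (h : ℂ) • w.Phi1 th x ν) *ᵥ θ x)) (Set.Ici a) x) ∧
          -- `μ₁♯ = μ₁(x, ζ + hν) + O(h e^{-βx})`
          ContinuousOn μs (Set.Ici 0) ∧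
          (∀ x : ℝ, 0 ≤ x →
            ‖μs x - w.mu th x (ζ + h * ν) 0‖ ≤ K * h * Real.exp (-β * x)) ∧
          -- `T e₁ + ρ` is an eigenvector of `Φ₀ + h Φ₁`, and `ρ = O(h)`
          (∀ x : ℝ, a ≤ x → ‖ρ x‖ ≤ K * h ∧
            ∃ μ : ℂ, (w.Phi0 th x ζ + (h : ℂ) • w.Phi1 th x ν) *ᵥ
                (w.Tmat th x ζ *ᵥ Pi.single 0 1 + ρ x) =
              μ • (w.Tmat th x ζ *ᵥ Pi.single 0 1 + ρ x)) ∧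
          -- the error estimate
          (∀ δ : ℝ, δ < β → ∀ x : ℝ, a ≤ x →
            ‖θ x - Complex.exp ((1 / h : ℂ) * ∫ t in (0 : ℝ)..x, μs t) •
                (w.Tmat th x ζ *ᵥ Pi.single 0 1 + ρ x)‖ ≤
              C δ * h * Real.exp (-δ * x) *
                ‖Complex.exp ((1 / h : ℂ) * ∫ t in (0 : ℝ)..x, μs t)‖) := by
  obtain ⟨c', hc', hb⟩ := hw.exists_bounds
  set d := min (Real.sqrt c' / 2) (c' / 2) with hd
  have hd0 : 0 < d := by positivity
  set H := min 1 (d / (|R| + 1)) with hH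
  have hH0 : 0 < H := by positivity
  -- all parameters for which the separation holds, as one family
  set ι := {q : ℝ × ℂ // 0 < q.1 ∧ q.1 ≤ H ∧ 0 ≤ q.2.re ∧ ‖q.2‖ ≤ R ∧ ∀ x, a ≤ x →
    ∀ j : Fin 5, j ≠ 0 → c ≤ ‖w.mu th x (ζ + q.1 * q.2) 0 - w.mu th x (ζ + q.1 * q.2) j‖} with hι
  have hsmall : ∀ i : ι, ‖(i.1.1 : ℂ) * i.1.2‖ ≤ d := by
    rintro ⟨⟨h, ν⟩, h1, h2, -, h4, -⟩
    have h5 : h ≤ d / (|R| + 1) := h2.trans (min_le_right _ _)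
    rw [norm_mul, Complex.norm_real, Real.norm_of_nonneg h1.le]
    calc h * ‖ν‖ ≤ d / (|R| + 1) * (|R| + 1) := by
          gcongr
          linarith [h4, le_abs_self R]
      _ = d := by field_simp
  have hs : ZND.SepFamily w th a ζ (fun i : ι => i.1.1) (fun i : ι => i.1.2) :=
    ZND.SepFamily.of_separated hw hr ha hζ hc hc' (fun x hx => (hb x hx).2.2.2)
      (fun i => i.2.1) (fun i => i.2.2.1.trans (min_le_left _ _)) (fun i => i.2.2.2.1)
      (fun i => i.2.2.2.2.1) (fun i => (hsmall i).trans (min_le_left _ _))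
      (fun i => i.2.2.2.2.2)
  obtain ⟨α, ε, hα, hε, hdom⟩ := hs.exists_coupling_le hw hr ha hζ hc' (fun x hx => (hb x hx).1)
    (fun i => i.2.2.2.1) (fun i => (hsmall i).trans (min_le_right _ _))
  obtain ⟨K, h₀, hK, hh₀, hmain⟩ := hs.exists_wkb hw hr ha hα hε hdom
  refine ⟨K, fun _ => K, fun ν hν hνR ⟨h₁, hh₁, hsep⟩ =>
    ⟨min h₀ (min H h₁), by positivity, fun h hpos hle => ?_⟩⟩
  have hle1 : h ≤ H := hle.trans ((min_le_right _ _).trans (min_le_left _ _))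
  have hle2 : h ≤ h₁ := hle.trans ((min_le_right _ _).trans (min_le_right _ _))
  obtain ⟨θ, μs, ρ, k1, k2, k3, k4, k5⟩ :=
    hmain ⟨(h, ν), hpos, hle1, hν, hνR, hsep h hpos hle2⟩ (hle.trans (min_le_left _ _))
  refine ⟨θ, μs, ρ, k1, k2, k3, k4, fun δ hδ x hx => (k5 x hx).trans ?_⟩
  have hx0 := ha.trans hx
  have hexp : Real.exp (-β * x) ≤ Real.exp (-δ * x) := Real.exp_le_exp.2 (by nlinarith)
  dsimp only
  gcongr
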